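/- Let $B>0$, $R>0$, and let $(\alpha_m)_{m\in\mathbb Z}$, $(\beta_{m'})_{m'\in\mathbb Z}$ be real numbers. **Notation.** For $m\in\mathbb Z$, $k\in\mathbb C$ and $r>0$ put, with $s_1=1$, $s_2=-1$ and $a^{(i)}_m(k)=\tfrac12\big(|m|+m+1-\tfrac{k-s_iB}{B}\big)$, $$F^{(i)}_{B,m}(k,r)=r^{1/2+|m|}e^{-Br^2/4}\,{}_1F_1\big(a^{(i)}_m(k),|m|+1;\tfrac B2r^2\big),\qquad G^{(i)}_{B,m}(k,r)=r^{1/2+|m|}e^{-Br^2/4}\,U\big(a^{(i)}_m(k),|m|+1;\tfrac B2r^2\big),$$ where ${}_1F_1$ is Kummer's and $U$ is Tricomi's confluent hypergeometric function; a prime on $F$ or $G$ denotes $d/dr$. Put $$N^i_{B,m}(k)=\Big(G^{(i)}_{B,m}(k,R)F'^{(i)}_{B,m}(k,R)-G'^{(i)}_{B,m}(k,R)F^{(i)}_{B,m}(k,R)\Big)^{-1},$$ $$\phi^i_{B,m}(k,r)=\begin{cases}N^i_{B,m}(k)\,G^{(i)}_{B,m}(k,R)\,F^{(i)}_{B,m}(k,r),&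 r\le R,\\ N^i_{B,m}(k)\,F^{(i)}_{B,m}(k,R)\,G^{(i)}_{B,m}(k,r),& r\ge R,\end{cases}$$ and $\tilde\Psi^1_{B,m,m'}(k)=(\phi^1_{B,m}(k,\cdot),0)$, $\tilde\Psi^2_{B,m,m'}(k)=(0,\phi^2_{B,m'}(k,\cdot))$. Inner products $(\cdot,\cdot)$ are antilinear in the first entry. **Operators.** Let $h^i_{B,m}=-\frac{d^2}{dr^2}+\big(\frac mr+\frac B2r\big)^2-\frac1{4r^2}+s_iB$ and $G_{m,m'}=\mathrm{diag}(\alpha_m,\beta_{m'})$. In $L^2((0,\infty),dr)\otimes\mathbb C^2$ let $H^{G_{m,m'}}_{B,m,m'}=\mathrm{diag}(h^1_{B,m},h^2_{B,m'})$, on the domain of all $f=(f_1,f_2)$ in this space such that $f_1,f_2\in H^{2,2}_{loc}((0,\infty)\setminus\{R\})$, $f(R_+)=f(R_-)\equiv f(R)$, $f'(R_+)-f'(R_-)=G_{m,m'}f(R)$, $h^1_{B,m}f_1,\,h^2_{B,m'}f_2\in L^2((0,\infty))$, and, for each component whose angular number ($m$ for $f_1$, $m'$ for $f_2$) is $0$,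 the component is regular at the origin: $f_i(r)/(\sqrt r\log r)\to0$ as $r\to0^+$. Let $H^O_{B,m,m'}$ be the case $G_{m,m'}=0$. For $m,m'\in\mathbb Z$ let $K_{m,m'}:L^2((0,\infty),dr)\otimes\mathbb C^2\to L^2(\mathbb R^2)\otimes\mathbb C^2$ be the isometry which, in polar coordinates $(r,\theta)$, is $K_{m,m'}(f_1,f_2)=\Big(r^{-1/2}f_1(r)\frac{e^{im\theta}}{\sqrt{2\pi}},\,r^{-1/2}f_2(r)\frac{e^{im'\theta}}{\sqrt{2\pi}}\Big)$. In $L^2(\mathbb R^2)\otimes\mathbb C^2$ let $H^G_B=\bigoplus_{m,m'}H^{G_{m,m'}}_{B,m,m'}$ be the operator whose graph consists of all pairs $(\Psi,\Phi)$ such that $(K_{m,m'}^*\Psi,K_{m,m'}^*\Phi)$ belongs to the graph of $H^{G_{m,m'}}_{B,m,m'}$ for all $m,m'$, and let $H^O_B$ be the case $G=0$. A bounded operator $T$ on $L^2(\mathbb R^2)\otimes\mathbb C^2$ is called the direct sum $\bigoplus_{m,m'}T_{m,m'}$ of bounded operators $T_{m,m'}$ on $L^2((0,\infty))\otimes\mathbb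 C^2$ if $TK_{m,m'}=K_{m,m'}T_{m,m'}$ for all $m,m'$. **Theorem.** (i) For all $m,m'\in\mathbb Z$ the operator $H^{G_{m,m'}}_{B,m,m'}$ is self-adjoint. For every $k\in\rho(H^{G_{m,m'}}_{B,m,m'})\cap\rho(H^O_{B,m,m'})$ the functions $\phi^1_{B,m}(k,\cdot)$, $\phi^1_{B,m}(\overline k,\cdot)$, $\phi^2_{B,m'}(k,\cdot)$, $\phi^2_{B,m'}(\overline k,\cdot)$ lie in $L^2((0,\infty))$ and $$\big(H^{G_{m,m'}}_{B,m,m'}-k\big)^{-1}=\big(H^O_{B,m,m'}-k\big)^{-1}+\sum_{i,j=1}^2\mu_{i,j}(k)\big(\tilde\Psi^i_{B,m,m'}(\overline k),\cdot\big)\tilde\Psi^j_{B,m,m'}(k),$$ where $\mu_{1,2}(k)=\mu_{2,1}(k)=0$ and $$\mu_{1,1}(k)=\frac{\alpha_m}{N^1_{B,m}(k)\Big(G'^{(1)}_{B,m}F^{(1)}_{B,m}-G^{(1)}_{B,m}F'^{(1)}_{B,m}-\alpha_mG^{(1)}_{B,m}F^{(1)}_{B,m}\Big)(k,R)},$$ $$\mu_{2,2}(k)=\frac{\beta_{m'}}{N^2_{B,m'}(k)\Big(G'^{(2)}_{B,m'}F^{(2)}_{B,m'}-G^{(2)}_{B,m'}F'^{(2)}_{B,m'}-\beta_{m'}G^{(2)}_{B,m'}F^{(2)}_{B,m'}\Big)(k,R)},$$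 the expressions in large parentheses being non-zero. For every $k\in\rho(H^O_{B,m,m'})$ the Wronskians defining $N^1_{B,m}(k)$, $N^2_{B,m'}(k)$ are non-zero, and $(H^O_{B,m,m'}-k)^{-1}$ is the integral operator on $(0,\infty)$ with the matrix kernel $\big(g^{i,j}_{m,m'}(k,r,r')\big)_{i,j=1,2}$ (the integrals converging absolutely for almost every $r$), where $g^{1,2}_{m,m'}=g^{2,1}_{m,m'}=0$ and, with $m_1=m$, $m_2=m'$, $$g^{i,i}_{m,m'}(k,r,r')=\begin{cases}N^i_{B,m_i}(k)\,G^{(i)}_{B,m_i}(k,r)\,F^{(i)}_{B,m_i}(k,r'),& r'\le r,\\ N^i_{B,m_i}(k)\,F^{(i)}_{B,m_i}(k,r)\,G^{(i)}_{B,m_i}(k,r'),& r'\ge r;\end{cases}$$ moreover $g^{i,i}_{m,m'}(k,R,r)=\phi^i_{B,m_i}(k,r)$. (ii) Let $k\in\rho(H^G_B)\cap\rho(H^O_B)$. Then $k\in\rho(H^{G_{m,m'}}_{B,m,m'})\cap\rho(H^O_{B,m,m'})$ for all $m,m'\in\mathbb Z$, $(H^G_B-k)^{-1}=\bigoplus_{m,m'}(H^{G_{m,m'}}_{B,m,m'}-k)^{-1}$,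 and $$(H^G_B-k)^{-1}=(H^O_B-k)^{-1}+\bigoplus_{m=-\infty}^{\infty}\bigoplus_{m'=-\infty}^{\infty}\sum_{i,j=1}^2\mu_{i,j}(k)\big(\tilde\Psi^i_{B,m,m'}(\overline k),\cdot\big)\tilde\Psi^j_{B,m,m'}(k),$$ where the direct sum is a bounded operator on $L^2(\mathbb R^2)\otimes\mathbb C^2$, and where $\tilde\Psi^i_{B,m,m'}$ is realised there as $K_{m,m'}\tilde\Psi^i_{B,m,m'}$. -/

import Mathlib

open MeasureTheory Set Filter Topology
open scoped ComplexConjugate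

noncomputable section

namespace DeltaCylinder

/-! ### Special functions -/

/-- Kummer's function `₁F₁(a, b; z) = ∑ₙ (a)ₙ / (b)ₙ * zⁿ / n!` (for `b ≠ 0, -1, -2, …`): Mathlib's
hypergeometric function is regularized, i.e. divided by `Γ(b)`. -/
def kummerM (a b z : ℂ) : ℂ := Complex.Gamma b * Complex.regularizedHGFun {a} {b} z

theorem kummerM_eq_tsum (a b z : ℂ) (hb : ∀ n : ℕ, b ≠ -n) :
    kummerM a b z = ∑' n : ℕ, (ascPochhammer ℂ n).eval a / (ascPochhammer ℂ n).eval b * z ^ n /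
      (n.factorial : ℂ) := by
  have hG := Complex.Gamma_ne_zero hb
  have hP : ∀ n : ℕ, Complex.Gamma (b + n) = (ascPochhammer ℂ n).eval b * Complex.Gamma b := by
    intro n
    induction n with
    | zero => simp
    | succ n ih =>
      have h : b + n ≠ 0 := fun h => hb n (by linear_combination h)
      rw [ascPochhammer_succ_eval, Nat.cast_succ, ← add_assoc, Complex.Gamma_add_one _ h, ih]
      ring
  rw [kummerM, Complex.regularizedHGFun, FormalMultilinearSeries.sum, ← tsum_mul_left]
  congr 1
  ext n
  rw [FormalMultilinearSeries.apply_eq_pow_smul_coeff, Complex.regularizedHGFunSeries_coeff,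
    Complex.regularizedHGFunCoeff]
  simp only [Multiset.map_singleton, Multiset.prod_singleton, hP, smul_eq_mul]
  field_simp

/-- Step `0` is the integral representation of Tricomi's function, valid for `Re a > 0`, `Re z > 0`.
Step `n + 1` is one use of the contiguous relation
`U(a, b, z) = z U(a+1, b+1, z) + (a + 1 - b) U(a+1, b, z)`, which raises `a` by one. -/
def tricomiUAux : ℕ → ℂ → ℂ → ℂ → ℂ
  | 0, a, b, z => (Complex.Gamma a)⁻¹ *
      ∫ t in Ioi (0 : ℝ), Complex.exp (-z * t) * (t : ℂ) ^ (a - 1) * (1 + t : ℂ) ^ (b - a - 1)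
  | n + 1, a, b, z =>
      z * tricomiUAux n (a + 1) (b + 1) z + (a + 1 - b) * tricomiUAux n (a + 1) b z

/-- Tricomi's confluent hypergeometric function `U(a, b, z)` for `Re z > 0` and arbitrary complex
`a`, `b`: the number `n = ⌊1 - Re a⌋₊` of raising steps is the least one with `Re (a + n) > 0`
(it is `0` if `Re a > 0`). -/
def tricomiU (a b z : ℂ) : ℂ := tricomiUAux ⌊1 - a.re⌋₊ a b z

/-! ### Radial solutions. The index `i : Fin 2` is the spin component. -/

/-- The eigenvalues of the third Pauli matrix. -/
def spinSign : Fin 2 → ℝ := ![1, -1]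

/-- The first Kummer parameter `(|m| + m + 1 - (k ∓ B) / B) / 2`. -/
def kummerParam (B : ℝ) (i : Fin 2) (m : ℤ) (k : ℂ) : ℂ :=
  (1 / 2 : ℂ) * ((|m| : ℤ) + m + 1 - (k - (spinSign i * B : ℝ)) / B)

/-- `F^{(i)}_{B,m}(k,r) = r^{1/2+|m|} e^{-Br²/4} ₁F₁(a, |m|+1; Br²/2)`. -/
def solF (B : ℝ) (i : Fin 2) (m : ℤ) (k : ℂ) (r : ℝ) : ℂ :=
  (r ^ (1 / 2 + (|m| : ℤ) : ℝ) * Real.exp (-(B * r ^ 2 / 4)) : ℝ) *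
    kummerM (kummerParam B i m k) ((|m| : ℤ) + 1) (B / 2 * r ^ 2 : ℝ)

/-- `G^{(i)}_{B,m}(k,r) = r^{1/2+|m|} e^{-Br²/4} U(a, |m|+1; Br²/2)`. -/
def solG (B : ℝ) (i : Fin 2) (m : ℤ) (k : ℂ) (r : ℝ) : ℂ :=
  (r ^ (1 / 2 + (|m| : ℤ) : ℝ) * Real.exp (-(B * r ^ 2 / 4)) : ℝ) *
    tricomiU (kummerParam B i m k) ((|m| : ℤ) + 1) (B / 2 * r ^ 2 : ℝ)

/-- The Wronskian `G F' - G' F` at `r = R`. (There is no first order term in the radial equation,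
so its value does not depend on `R`.) -/
def wronskianGF (B R : ℝ) (i : Fin 2) (m : ℤ) (k : ℂ) : ℂ :=
  solG B i m k R * deriv (solF B i m k) R - deriv (solG B i m k) R * solF B i m k R

/-- The normalizing constant `N^i_{B,m}(k)`: the reciprocal of the Wronskian. -/
def normConst (B R : ℝ) (i : Fin 2) (m : ℤ) (k : ℂ) : ℂ := (wronskianGF B R i m k)⁻¹

/-- `φ^i_{B,m}(k,r)`. -/
def phi (B R : ℝ) (i : Fin 2) (m : ℤ) (k : ℂ) (r : ℝ) : ℂ :=
  if r ≤ R then normConst B R i m k * solG B i m k R * solF B i m k r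
  else normConst B R i m k * solF B i m k R * solG B i m k r

/-- The kernel `N G(r) F(r')` for `r' ≤ r` and `N F(r) G(r')` for `r' ≥ r`. -/
def channelGreen (B R : ℝ) (i : Fin 2) (m : ℤ) (k : ℂ) (r r' : ℝ) : ℂ :=
  if r' ≤ r then normConst B R i m k * solG B i m k r * solF B i m k r'
  else normConst B R i m k * solF B i m k r * solG B i m k r'

/-- The matrix kernel `G^O_{B,m,m'}(k,r,r')`; `M = (m, m')`. -/
def freeGreen (B R : ℝ) (M : Fin 2 → ℤ) (k : ℂ) (r r' : ℝ) : Matrix (Fin 2) (Fin 2) ℂ :=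
  !![channelGreen B R 0 (M 0) k r r', 0;
     0, channelGreen B R 1 (M 1) k r r']

/-- The denominator factor `G' F - G F' - α G F` at `r = R`. -/
def kreinDenom (B R : ℝ) (i : Fin 2) (m : ℤ) (α : ℝ) (k : ℂ) : ℂ :=
  deriv (solG B i m k) R * solF B i m k R - solG B i m k R * deriv (solF B i m k) R
    - α * solG B i m k R * solF B i m k R

/-- The matrix `μ_{i,j}(k)`; `M = (m, m')` and `g = (α_m, β_{m'})`. -/
def kreinCoeff (B R : ℝ) (M : Fin 2 → ℤ) (g : Fin 2 → ℝ) (k : ℂ) : Matrix (Fin 2) (Fin 2) ℂ :=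
  !![g 0 / (normConst B R 0 (M 0) k * kreinDenom B R 0 (M 0) (g 0) k), 0;
     0, g 1 / (normConst B R 1 (M 1) k * kreinDenom B R 1 (M 1) (g 1) k)]

/-! ### Hilbert spaces -/

/-- `L²((0,∞), dr)`. -/
abbrev HalfLineL2 : Type := Lp ℂ 2 (volume.restrict (Ioi (0 : ℝ)))

/-- `L²((0,∞), dr) ⊗ ℂ²`. -/
abbrev RadialSpace : Type := PiLp 2 (fun _ : Fin 2 => HalfLineL2)

/-- `L²(ℝ²)`. -/
abbrev PlaneL2 : Type := Lp ℂ 2 (volume : Measure (ℝ × ℝ))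

/-- `L²(ℝ²) ⊗ ℂ²`. -/
abbrev SpinorSpace : Type := PiLp 2 (fun _ : Fin 2 => PlaneL2)

/-! ### Resolvents of unbounded operators -/

section Resolvent

variable {E : Type*} [NormedAddCommGroup E] [NormedSpace ℂ E]

/-- The bounded operator `S` is the inverse of `T - k`. -/
structure IsResolventAt (T : E →ₗ.[ℂ] E) (k : ℂ) (S : E →L[ℂ] E) : Prop where
  right_inv : ∀ g : E, ∃ f : T.domain, (f : E) = S g ∧ T f - k • (f : E) = g
  left_inv : ∀ f : T.domain, S (T f - k • (f : E)) = f

/-- The resolvent set `ρ(T)`. -/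
def opResolventSet (T : E →ₗ.[ℂ] E) : Set ℂ := {k | ∃ S : E →L[ℂ] E, IsResolventAt T k S}

open scoped Classical in
/-- The resolvent `(T - k)⁻¹`, for `k ∈ ρ(T)`. -/
def opResolvent (T : E →ₗ.[ℂ] E) (k : ℂ) : E →L[ℂ] E :=
  if h : k ∈ opResolventSet T then h.choose else 0

theorem isResolventAt_opResolvent {T : E →ₗ.[ℂ] E} {k : ℂ} (h : k ∈ opResolventSet T) :
    IsResolventAt T k (opResolvent T k) := by
  rw [opResolvent, dif_pos h]
  exact h.choose_spec

theorem IsResolventAt.eq_opResolvent {T : E →ₗ.[ℂ] E} {k : ℂ} {S : E →L[ℂ] E}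
    (h : IsResolventAt T k S) : S = opResolvent T k := by
  ext g
  obtain ⟨f, hf, rfl⟩ := (isResolventAt_opResolvent ⟨S, h⟩).right_inv g
  rw [h.left_inv f]
  exact hf

end Resolvent

/-! ### The radial operators -/

/-- The potential of `h^i_{B,m}`: `(m/r + Br/2)² - 1/(4r²) ± B`. -/
def radialPotential (B : ℝ) (i : Fin 2) (m : ℤ) (r : ℝ) : ℝ :=
  (m / r + B / 2 * r) ^ 2 - 1 / (4 * r ^ 2) + spinSign i * B

/-- `u` is the `C¹` representative of a function of `H^{2,2}_loc(Ω)`, for an open `Ω ⊆ ℝ`, with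
derivative `u₁` and second weak derivative `u₂`: `u₁` is locally absolutely continuous with density
`u₂ ∈ L²_loc(Ω)`. -/
structure IsH2Loc (Ω : Set ℝ) (u u₁ u₂ : ℝ → ℂ) : Prop where
  hasDerivAt : ∀ r ∈ Ω, HasDerivAt u (u₁ r) r
  memLp : ∀ x y, x ≤ y → Icc x y ⊆ Ω → MemLp u₂ 2 (volume.restrict (Icc x y))
  integral_eq : ∀ x y, x ≤ y → Icc x y ⊆ Ω → ∫ t in x..y, u₂ t = u₁ y - u₁ x

/-- `u(R₊) = u(R₋) = u(R)` and `u'(R₊) - u'(R₋) = α u(R)`, where `u₁ = u'`. -/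
def DeltaCondition (R α : ℝ) (u u₁ : ℝ → ℂ) : Prop :=
  ∃ c d₁ d₂ : ℂ, Tendsto u (𝓝[<] R) (𝓝 c) ∧ Tendsto u (𝓝[>] R) (𝓝 c) ∧
    Tendsto u₁ (𝓝[<] R) (𝓝 d₁) ∧ Tendsto u₁ (𝓝[>] R) (𝓝 d₂) ∧ d₂ - d₁ = α * c

/-- Regularity at the origin: for `m = 0` there is no `√r log r` singularity. For `m ≠ 0` no
condition is needed (limit point case). -/
def OriginCondition (m : ℤ) (u : ℝ → ℂ) : Prop :=
  m = 0 → Tendsto (fun r : ℝ => u r / (√r * Real.log r : ℝ)) (𝓝[>] 0) (𝓝 0)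

theorem IsH2Loc.add {Ω : Set ℝ} {u u₁ u₂ v v₁ v₂ : ℝ → ℂ} (hu : IsH2Loc Ω u u₁ u₂)
    (hv : IsH2Loc Ω v v₁ v₂) : IsH2Loc Ω (u + v) (u₁ + v₁) (u₂ + v₂) where
  hasDerivAt r hr := (hu.hasDerivAt r hr).add (hv.hasDerivAt r hr)
  memLp x y hxy h := (hu.memLp x y hxy h).add (hv.memLp x y hxy h)
  integral_eq x y hxy h := by
    have key : ∀ w : ℝ → ℂ, MemLp w 2 (volume.restrict (Icc x y)) →
        IntervalIntegrable w volume x y := fun w hw => by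
      rw [intervalIntegrable_iff_integrableOn_Icc_of_le hxy]
      exact hw.integrable (by norm_num)
    have := intervalIntegral.integral_add (key _ (hu.memLp x y hxy h)) (key _ (hv.memLp x y hxy h))
    simp only [Pi.add_apply, this, hu.integral_eq x y hxy h, hv.integral_eq x y hxy h]
    ring

theorem IsH2Loc.smul {Ω : Set ℝ} {u u₁ u₂ : ℝ → ℂ} (c : ℂ) (hu : IsH2Loc Ω u u₁ u₂) :
    IsH2Loc Ω (c • u) (c • u₁) (c • u₂) where
  hasDerivAt r hr := (hu.hasDerivAt r hr).const_smul c
  memLp x y hxy h := (hu.memLp x y hxy h).const_smul c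
  integral_eq x y hxy h := by
    simp only [Pi.smul_apply, intervalIntegral.integral_smul, hu.integral_eq x y hxy h, smul_sub]

/-- The graph of the channel operator `h^i_{B,m}` with the `δ`-type condition of strength `α` at
`r = R`: the pairs `(f, -f'' + V f)` of elements of `L²((0,∞))`, with `f ∈ H^{2,2}_loc((0,∞) ∖ {R})`
subject to the conditions at `R` and at the origin. -/
def channelGraph (B R : ℝ) (i : Fin 2) (m : ℤ) (α : ℝ) : Submodule ℂ (HalfLineL2 × HalfLineL2) where
  carrier := {p | ∃ u u₁ u₂ : ℝ → ℂ, IsH2Loc (Ioi 0 \ {R}) u u₁ u₂ ∧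
    DeltaCondition R α u u₁ ∧ OriginCondition m u ∧
    p.1 =ᵐ[volume.restrict (Ioi 0)] u ∧
    p.2 =ᵐ[volume.restrict (Ioi 0)] fun r => -u₂ r + radialPotential B i m r * u r}
  zero_mem' := by
    refine ⟨0, 0, 0, ⟨fun r _ => hasDerivAt_const r 0, fun x y _ _ => MemLp.zero, ?_⟩,
      ⟨0, 0, 0, ?_⟩, ?_, ?_, ?_⟩
    · intros; simp
    · simp [Pi.zero_def]
    · intro _; simp
    · exact Lp.coeFn_zero ..
    · filter_upwards [Lp.coeFn_zero ℂ 2 (volume.restrict (Ioi (0 : ℝ)))] with r hr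
      simpa using hr
  add_mem' := by
    rintro p q ⟨u, u₁, u₂, hu, ⟨c, d₁, d₂, hc₁, hc₂, hd₁, hd₂, hd⟩, ho, hp, hp'⟩
      ⟨v, v₁, v₂, hv, ⟨c', d₁', d₂', hc₁', hc₂', hd₁', hd₂', hd'⟩, ho', hq, hq'⟩
    refine ⟨u + v, u₁ + v₁, u₂ + v₂, hu.add hv, ⟨c + c', d₁ + d₁', d₂ + d₂', hc₁.add hc₁',
      hc₂.add hc₂', hd₁.add hd₁', hd₂.add hd₂', by linear_combination hd + hd'⟩, fun hm => ?_,
      (Lp.coeFn_add _ _).trans (hp.add hq), ?_⟩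
    · simpa [add_div] using (ho hm).add (ho' hm)
    · filter_upwards [Lp.coeFn_add p.2 q.2, hp', hq'] with r h₁ h₂ h₃
      simp only [Prod.snd_add, h₁, Pi.add_apply, h₂, h₃]
      ring
  smul_mem' := by
    rintro a p ⟨u, u₁, u₂, hu, ⟨c, d₁, d₂, hc₁, hc₂, hd₁, hd₂, hd⟩, ho, hp, hp'⟩
    refine ⟨a • u, a • u₁, a • u₂, hu.smul a, ⟨a * c, a * d₁, a * d₂, hc₁.const_smul a,
      hc₂.const_smul a, hd₁.const_smul a, hd₂.const_smul a, by linear_combination a * hd⟩,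
      fun hm => ?_, (Lp.coeFn_smul _ _).trans (hp.const_smul a), ?_⟩
    · simpa [mul_div_assoc] using (ho hm).const_mul a
    · filter_upwards [Lp.coeFn_smul a p.2, hp'] with r h₁ h₂
      simp only [Prod.smul_snd, h₁, Pi.smul_apply, h₂, smul_eq_mul]
      ring

/-- The channel graph is the graph of an operator. -/
theorem channelGraph_functional (B R : ℝ) (i : Fin 2) (m : ℤ) (α : ℝ)
    (p : HalfLineL2 × HalfLineL2) (hp : p ∈ channelGraph B R i m α) (h0 : p.1 = 0) : p.2 = 0 := by
  obtain ⟨u, u₁, u₂, hu, -, -, h₁, h₂⟩ := hp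
  have hopen : IsOpen (Ioi (0 : ℝ) \ {R}) := isOpen_Ioi.sdiff isClosed_singleton
  have hu0 : EqOn u 0 (Ioi 0 \ {R}) := by
    refine Measure.eqOn_open_of_ae_eq (μ := volume) ?_ hopen
      (fun r hr => (hu.hasDerivAt r hr).continuousAt.continuousWithinAt) continuousOn_const
    refine ae_restrict_of_ae_restrict_of_subset sdiff_subset (h₁.symm.trans ?_)
    rw [h0]
    exact Lp.coeFn_zero ..
  have hu1 : ∀ r ∈ Ioi 0 \ {R}, u₁ r = 0 := fun r hr =>
    (hu.hasDerivAt r hr).unique ((hasDerivAt_const r (0 : ℂ)).congr_of_eventuallyEq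
      (eventually_of_mem (hopen.mem_nhds hr) hu0))
  have hu2 : ∀ᵐ r, r ∈ Ioi 0 \ {R} → u₂ r = 0 := by
    have key : ∀ q : ℚ × ℚ, ∀ᵐ r : ℝ, Icc (q.1 : ℝ) q.2 ⊆ Ioi 0 \ {R} →
        r ∈ Ioo (q.1 : ℝ) q.2 → u₂ r = 0 := by
      rintro ⟨x, y⟩
      by_cases hsub : Icc (x : ℝ) y ⊆ Ioi 0 \ {R}
      swap
      · exact ae_of_all _ fun r h => absurd h hsub
      by_cases hxy : (x : ℝ) ≤ y
      swap
      · exact ae_of_all _ fun r _ h => absurd (h.1.trans h.2).le hxy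
      have hint : IntervalIntegrable u₂ volume x y := by
        rw [intervalIntegrable_iff_integrableOn_Icc_of_le hxy]
        exact (hu.memLp x y hxy hsub).integrable (by norm_num)
      filter_upwards [hint.ae_hasDerivAt_integral] with r hr _ hrm
      have hd := hr (by rw [uIcc_of_le hxy]; exact Ioo_subset_Icc_self hrm) x left_mem_uIcc
      refine hd.unique ((hasDerivAt_const r (0 : ℂ)).congr_of_eventuallyEq ?_)
      filter_upwards [Ioo_mem_nhds hrm.1 hrm.2] with s hs
      have hsub' : Icc (x : ℝ) s ⊆ Ioi 0 \ {R} := (Icc_subset_Icc_right hs.2.le).trans hsub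
      rw [hu.integral_eq x s hs.1.le hsub', hu1 s (hsub' ⟨hs.1.le, le_rfl⟩),
        hu1 x (hsub' ⟨le_rfl, hs.1.le⟩), sub_zero]
    filter_upwards [ae_all_iff.2 key] with r hr hmem
    obtain ⟨ε, hε, hball⟩ := Metric.isOpen_iff.1 hopen r hmem
    obtain ⟨x, hx₁, hx₂⟩ := exists_rat_btwn (show r - ε < r by linarith)
    obtain ⟨y, hy₁, hy₂⟩ := exists_rat_btwn (show r < r + ε by linarith)
    refine hr (x, y) (fun s hs => hball ?_) ⟨hx₂, hy₁⟩
    rw [Metric.mem_ball, Real.dist_eq, abs_lt]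
    constructor <;> linarith [hs.1, hs.2]
  have hR : ∀ᵐ r : ℝ, r ≠ R := by simp [ae_iff, measure_singleton]
  refine Lp.ext (h₂.trans (EventuallyEq.trans ?_ (Lp.coeFn_zero ..).symm))
  rw [EventuallyEq, ae_restrict_iff' measurableSet_Ioi]
  filter_upwards [hu2, hR] with r h₂ hr h
  rw [h₂ ⟨h, hr⟩, hu0 ⟨h, hr⟩]
  simp

/-- The graph of `diag(h^1_{B,m}, h^2_{B,m'})` with strengths `g = (α_m, β_{m'})`, where
`M = (m, m')`. -/
def radialGraph (B R : ℝ) (M : Fin 2 → ℤ) (g : Fin 2 → ℝ) :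
    Submodule ℂ (RadialSpace × RadialSpace) where
  carrier := {p | ∀ i, (p.1 i, p.2 i) ∈ channelGraph B R i (M i) (g i)}
  zero_mem' i := (channelGraph B R i (M i) (g i)).zero_mem
  add_mem' hp hq i := (channelGraph B R i (M i) (g i)).add_mem (hp i) (hq i)
  smul_mem' c _ hp i := (channelGraph B R i (M i) (g i)).smul_mem c (hp i)

theorem radialGraph_functional (B R : ℝ) (M : Fin 2 → ℤ) (g : Fin 2 → ℝ)
    (p : RadialSpace × RadialSpace) (hp : p ∈ radialGraph B R M g) (h0 : p.1 = 0) : p.2 = 0 := by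
  ext1 i
  exact channelGraph_functional B R i (M i) (g i) _ (hp i) (by simp [h0])

/-- The operator `H^{G_{m,m'}}_{B,m,m'}`; `M = (m, m')` and `g = (α_m, β_{m'})`. The free operator
`H^O_{B,m,m'}` is the case `g = 0`. -/
def radialHamiltonian (B R : ℝ) (M : Fin 2 → ℤ) (g : Fin 2 → ℝ) : RadialSpace →ₗ.[ℂ] RadialSpace :=
  (radialGraph B R M g).toLinearPMap

theorem graph_radialHamiltonian (B R : ℝ) (M : Fin 2 → ℤ) (g : Fin 2 → ℝ) :
    (radialHamiltonian B R M g).graph = radialGraph B R M g :=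
  Submodule.toLinearPMap_graph_eq _ (radialGraph_functional B R M g)

/-! ### Polar decomposition of `L²(ℝ²)` -/

theorem measurable_polarCoord : Measurable (fun x : ℝ × ℝ => polarCoord x) := by
  simp only [polarCoord_apply]
  have h : Measurable fun x : ℝ × ℝ => Complex.equivRealProd.symm x :=
    Complex.equivRealProdCLM.symm.continuous.measurable
  exact Measurable.prodMk (by fun_prop) (Complex.measurable_arg.comp h)

theorem lintegral_polarCoord (f : ℝ × ℝ → ENNReal) :
    ∫⁻ x : ℝ × ℝ, f (polarCoord x) =
      ∫⁻ p in Ioi (0 : ℝ) ×ˢ Ioo (-Real.pi) Real.pi, ENNReal.ofReal p.1 * f p := by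
  rw [← lintegral_comp_polarCoord_symm]
  refine setLIntegral_congr_fun polarCoord.open_target.measurableSet fun p hp => ?_
  simp only [smul_eq_mul, polarCoord.right_inv hp]

theorem lintegral_polarCoord_radial {f : ℝ → ENNReal} (hf : Measurable f) :
    ∫⁻ x : ℝ × ℝ, f (polarCoord x).1 =
      ENNReal.ofReal (2 * Real.pi) * ∫⁻ r in Ioi (0 : ℝ), ENNReal.ofReal r * f r := by
  rw [lintegral_polarCoord fun p => f p.1, Measure.volume_eq_prod, ← Measure.prod_restrict,
    lintegral_prod _ (by fun_prop)]
  simp only [lintegral_const, Measure.restrict_apply MeasurableSet.univ, univ_inter,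
    Real.volume_Ioo]
  rw [lintegral_mul_const _ (by fun_prop), mul_comm]
  congr 2
  ring

theorem ae_polarCoord_fst {P : ℝ → Prop} (h : ∀ᵐ r ∂volume.restrict (Ioi (0 : ℝ)), P r) :
    ∀ᵐ x : ℝ × ℝ, P (polarCoord x).1 := by
  obtain ⟨s, hs, hms, hs0⟩ := exists_measurable_superset_of_null h
  have hmeas : Measurable (s.indicator (fun _ => (1 : ENNReal))) := measurable_const.indicator hms
  have h0 : ∫⁻ x : ℝ × ℝ, s.indicator (fun _ => (1 : ENNReal)) (polarCoord x).1 = 0 := by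
    rw [lintegral_polarCoord_radial hmeas]
    have : ∫⁻ r in Ioi (0 : ℝ), ENNReal.ofReal r * s.indicator (fun _ => (1 : ENNReal)) r = 0 := by
      rw [lintegral_eq_zero_iff (by fun_prop)]
      filter_upwards [measure_eq_zero_iff_ae_notMem.1 hs0] with r hr
      simp [hr]
    rw [this, mul_zero]
  rw [lintegral_eq_zero_iff (by exact hmeas.comp measurable_polarCoord.fst)] at h0
  filter_upwards [h0] with x hx
  by_contra hP
  have : (polarCoord x).1 ∈ s := hs hP
  rw [indicator_of_mem this] at hx
  exact one_ne_zero hx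

/-- `(Ũ⁻¹ f)(|x|) e^{imθ} / √(2π)`, i.e. `|x|^{-1/2} f(|x|) e^{imθ} / √(2π)`, where `(|x|, θ)` are the
polar coordinates of `x`. -/
def partialWaveFun (m : ℤ) (f : ℝ → ℂ) (x : ℝ × ℝ) : ℂ :=
  ((polarCoord x).1 ^ (-(1 / 2) : ℝ) : ℝ) * f (polarCoord x).1 *
    (Complex.exp (m * (polarCoord x).2 * Complex.I) / (√(2 * Real.pi) : ℝ))

theorem measurable_partialWaveFun (m : ℤ) {f : ℝ → ℂ} (hf : Measurable f) :
    Measurable (partialWaveFun m f) := by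
  have h1 := measurable_polarCoord.fst
  have h2 := measurable_polarCoord.snd
  unfold partialWaveFun
  exact ((Complex.measurable_ofReal.comp (h1.pow_const _)).mul (hf.comp h1)).mul (by fun_prop)

theorem enorm_sq_partialWaveFun (m : ℤ) (f : ℝ → ℂ) {x : ℝ × ℝ} :
    ‖partialWaveFun m f x‖ₑ ^ (2 : ℝ) = ENNReal.ofReal ((polarCoord x).1⁻¹ / (2 * Real.pi)) *
      ‖f (polarCoord x).1‖ₑ ^ (2 : ℝ) := by
  have hr : 0 ≤ (polarCoord x).1 := Real.sqrt_nonneg _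
  have he : ‖Complex.exp (m * (polarCoord x).2 * Complex.I)‖ = 1 := by
    have := Complex.norm_exp_ofReal_mul_I (m * (polarCoord x).2)
    push_cast at this
    exact this
  have hn : ‖partialWaveFun m f x‖ ^ (2 : ℝ) =
      (polarCoord x).1⁻¹ / (2 * Real.pi) * ‖f (polarCoord x).1‖ ^ (2 : ℝ) := by
    have hs : ((polarCoord x).1 ^ (-(1 / 2) : ℝ)) ^ 2 = (polarCoord x).1⁻¹ := by
      rw [← Real.rpow_natCast, ← Real.rpow_mul hr, ← Real.rpow_neg_one]
      norm_num
    rw [partialWaveFun, norm_mul, norm_mul, norm_div, he, Complex.norm_of_nonneg (by positivity),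
      Complex.norm_of_nonneg (by positivity), Real.rpow_two, Real.rpow_two, mul_pow, mul_pow, hs,
      div_pow, Real.sq_sqrt (by positivity)]
    ring
  rw [← ofReal_norm, ← ofReal_norm, ENNReal.ofReal_rpow_of_nonneg (norm_nonneg _) (by norm_num),
    ENNReal.ofReal_rpow_of_nonneg (norm_nonneg _) (by norm_num), hn,
    ENNReal.ofReal_mul (by positivity)]

theorem eLpNorm_partialWaveFun (m : ℤ) {f : ℝ → ℂ} (hf : Measurable f) :
    eLpNorm (partialWaveFun m f) 2 volume = eLpNorm f 2 (volume.restrict (Ioi (0 : ℝ))) := by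
  rw [eLpNorm_eq_lintegral_rpow_enorm_toReal (by norm_num) (by norm_num),
    eLpNorm_eq_lintegral_rpow_enorm_toReal (by norm_num) (by norm_num)]
  congr 1
  simp only [ENNReal.toReal_ofNat, enorm_sq_partialWaveFun]
  rw [lintegral_polarCoord_radial
    (f := fun r => ENNReal.ofReal (r⁻¹ / (2 * Real.pi)) * ‖f r‖ₑ ^ (2 : ℝ)) (by fun_prop),
    ← lintegral_const_mul _ (by fun_prop)]
  refine setLIntegral_congr_fun measurableSet_Ioi fun r hr => ?_
  have hr' : (0 : ℝ) < r := hr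
  simp only [← mul_assoc]
  rw [← ENNReal.ofReal_mul (by positivity), ← ENNReal.ofReal_mul (by positivity)]
  have : 2 * Real.pi * r * (r⁻¹ / (2 * Real.pi)) = 1 := by
    field_simp
  rw [this, ENNReal.ofReal_one, one_mul]

theorem memLp_partialWaveFun (m : ℤ) (f : HalfLineL2) :
    MemLp (partialWaveFun m f) 2 (volume : Measure (ℝ × ℝ)) := by
  have hf := (Lp.stronglyMeasurable f).measurable
  refine ⟨(measurable_partialWaveFun m hf).aestronglyMeasurable, ?_⟩
  rw [eLpNorm_partialWaveFun m hf]
  exact (Lp.memLp f).2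

/-- The isometry `f ↦ Ũ⁻¹ f ⊗ e^{imθ} / √(2π)` of `L²((0,∞), dr)` onto the `m`-th partial wave
subspace of `L²(ℝ²)`. -/
def partialWave (m : ℤ) : HalfLineL2 →ₗᵢ[ℂ] PlaneL2 where
  toFun f := (memLp_partialWaveFun m f).toLp
  map_add' f g := by
    refine Lp.ext ?_
    filter_upwards [(memLp_partialWaveFun m (f + g)).coeFn_toLp,
      Lp.coeFn_add (memLp_partialWaveFun m f).toLp (memLp_partialWaveFun m g).toLp,
      (memLp_partialWaveFun m f).coeFn_toLp, (memLp_partialWaveFun m g).coeFn_toLp,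
      ae_polarCoord_fst (Lp.coeFn_add f g)] with x h₁ h₂ h₃ h₄ h₅
    rw [h₁, h₂, Pi.add_apply, h₃, h₄]
    simp only [partialWaveFun, h₅, Pi.add_apply]
    ring
  map_smul' c f := by
    refine Lp.ext ?_
    filter_upwards [(memLp_partialWaveFun m (c • f)).coeFn_toLp,
      Lp.coeFn_smul c (memLp_partialWaveFun m f).toLp, (memLp_partialWaveFun m f).coeFn_toLp,
      ae_polarCoord_fst (Lp.coeFn_smul c f)] with x h₁ h₂ h₃ h₄
    rw [h₁, RingHom.id_apply, h₂, Pi.smul_apply, h₃]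
    simp only [partialWaveFun, h₄, Pi.smul_apply, smul_eq_mul]
    ring
  norm_map' f := by
    change ‖(memLp_partialWaveFun m f).toLp‖ = _
    rw [Lp.norm_toLp, eLpNorm_partialWaveFun m (Lp.stronglyMeasurable f).measurable, Lp.norm_def]

/-- The embedding of `L²((0,∞)) ⊗ ℂ²` as the `(m, m')` summand of `L²(ℝ²) ⊗ ℂ²`: the `m`-th partial
wave in the upper and the `m'`-th partial wave in the lower spin component; `M = (m, m')`. -/
def sector (M : Fin 2 → ℤ) : RadialSpace →L[ℂ] SpinorSpace :=
  ((PiLp.continuousLinearEquiv 2 ℂ (fun _ : Fin 2 => PlaneL2)).symm : _ →L[ℂ] SpinorSpace) ∘L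
    ContinuousLinearMap.pi fun i =>
      (partialWave (M i)).toContinuousLinearMap ∘L PiLp.proj 2 (fun _ : Fin 2 => HalfLineL2) i

theorem sector_apply (M : Fin 2 → ℤ) (f : RadialSpace) (i : Fin 2) :
    sector M f i = partialWave (M i) (f i) := rfl

/-- The graph of the direct sum over all `(m, m')` of the operators
`H^{G_{m,m'}}_{B,m,m'}`, with `G_{m,m'} = diag(α_m, β_{m'})`: the `(m, m')` components of the two
entries of a pair (their images under the adjoint of the embedding) form a pair of the graph of
`H^{G_{m,m'}}_{B,m,m'}`, for all `(m, m')`. -/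
def fullGraph (B R : ℝ) (α β : ℤ → ℝ) : Submodule ℂ (SpinorSpace × SpinorSpace) where
  carrier := {p | ∀ m m' : ℤ, ((sector ![m, m']).adjoint p.1, (sector ![m, m']).adjoint p.2) ∈
    radialGraph B R ![m, m'] ![α m, β m']}
  zero_mem' m m' := by
    simp only [Prod.fst_zero, Prod.snd_zero, map_zero]
    exact (radialGraph B R ![m, m'] ![α m, β m']).zero_mem
  add_mem' hp hq m m' := by
    simpa using (radialGraph B R ![m, m'] ![α m, β m']).add_mem (hp m m') (hq m m')
  smul_mem' c _ hp m m' := by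
    simpa using (radialGraph B R ![m, m'] ![α m, β m']).smul_mem c (hp m m')

theorem partialWave_complete (ψ : PlaneL2)
    (h : ∀ (m : ℤ) (f : HalfLineL2), inner ℂ (partialWave m f) ψ = 0) : ψ = 0 := by
  set μ : Measure ℝ := volume.restrict (Ioi (0 : ℝ)) with hμ
  set ν : Measure ℝ := volume.restrict (Ioo (-Real.pi) Real.pi) with hν
  have hprod : (volume : Measure (ℝ × ℝ)).restrict polarCoord.target = μ.prod ν := by
    rw [hμ, hν, Measure.prod_restrict]; rfl
  have hψ : Measurable ψ := (Lp.stronglyMeasurable ψ).measurable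
  set w : ℝ × ℝ → ℂ := fun p => (√p.1 : ℝ) * ψ (polarCoord.symm p) with hw
  have hwm : Measurable w := by
    have h1 : Measurable fun p => ψ (polarCoord.symm p) :=
      hψ.comp continuous_polarCoord_symm.measurable
    exact (Complex.measurable_ofReal.comp measurable_fst.sqrt).mul h1
  have hnorm : ∫⁻ p, ‖w p‖ₑ ^ (2 : ℝ) ∂(μ.prod ν) = ∫⁻ x, ‖ψ x‖ₑ ^ (2 : ℝ) := by
    rw [← lintegral_comp_polarCoord_symm, ← hprod]
    refine setLIntegral_congr_fun polarCoord.open_target.measurableSet fun p hp => ?_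
    have hp0 : 0 < p.1 := hp.1
    have : ‖((√p.1 : ℝ) : ℂ)‖ₑ ^ (2 : ℝ) = ENNReal.ofReal p.1 := by
      rw [← ofReal_norm, Complex.norm_of_nonneg (Real.sqrt_nonneg _),
        ENNReal.ofReal_rpow_of_nonneg (Real.sqrt_nonneg _) (by norm_num), Real.rpow_two,
        Real.sq_sqrt hp0.le]
    simp only [hw, smul_eq_mul, enorm_mul]
    rw [ENNReal.mul_rpow_of_nonneg _ _ (by norm_num), this]
  have hwL2 : MemLp w 2 (μ.prod ν) := by
    refine ⟨hwm.aestronglyMeasurable, ?_⟩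
    have h2 := (Lp.memLp ψ).2
    rw [eLpNorm_eq_lintegral_rpow_enorm_toReal (by norm_num) (by norm_num)] at h2 ⊢
    simp only [ENNReal.toReal_ofNat] at h2 ⊢
    rwa [hnorm]
  -- the Fourier coefficients vanish for almost every radius
  have hcoef : ∀ m : ℤ, ∀ᵐ r ∂μ,
      ∫ θ, Complex.exp (-(m * θ * Complex.I)) * w (r, θ) ∂ν = 0 := by
    intro m
    set e : ℝ × ℝ → ℂ := fun p => Complex.exp (-(m * p.2 * Complex.I)) * w p with he
    have heL2 : MemLp e 2 (μ.prod ν) := by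
      refine hwL2.of_le (Measurable.aestronglyMeasurable ?_) (ae_of_all _ fun p => ?_)
      · exact Measurable.mul (by fun_prop) hwm
      · have := Complex.norm_exp_ofReal_mul_I (-(m * p.2))
        push_cast at this
        rw [he, norm_mul, ← neg_mul, this, one_mul]
    have hint : ∀ s, MeasurableSet s → μ s < ⊤ → Integrable e ((μ.restrict s).prod ν) := by
      intro s hs hμs
      have : IsFiniteMeasure (μ.restrict s) := ⟨by simpa using hμs⟩
      have : IsFiniteMeasure ν := ⟨by simp [hν]⟩
      have hle : (μ.restrict s).prod ν ≤ μ.prod ν := by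
        have : (μ.restrict s).prod ν = (μ.prod ν).restrict (s ×ˢ univ) := by
          rw [← Measure.prod_restrict, Measure.restrict_univ]
        rw [this]
        exact Measure.restrict_le_self
      exact (heL2.mono_measure hle).integrable (by norm_num)
    refine ae_eq_zero_of_forall_setIntegral_eq_of_sigmaFinite
      (fun s hs hμs => (hint s hs hμs).integral_prod_left) fun s hs hμs => ?_
    have h0 := h m (indicatorConstLp 2 hs hμs.ne (1 : ℂ))
    rw [L2.inner_def] at h0
    have hpw : ∀ᵐ x : ℝ × ℝ, inner ℂ (partialWave m (indicatorConstLp 2 hs hμs.ne (1 : ℂ)) x) (ψ x)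
        = inner ℂ (partialWaveFun m (s.indicator fun _ => (1 : ℂ)) x) (ψ x) := by
      filter_upwards [(memLp_partialWaveFun m (indicatorConstLp 2 hs hμs.ne (1 : ℂ))).coeFn_toLp,
        ae_polarCoord_fst (indicatorConstLp_coeFn (p := 2) (hs := hs) (hμs := hμs.ne)
          (c := (1 : ℂ)))] with x h₁ h₂
      change inner ℂ ((memLp_partialWaveFun m (indicatorConstLp 2 hs hμs.ne (1 : ℂ))).toLp _ x)
        (ψ x) = _
      rw [h₁]
      simp only [partialWaveFun, h₂]
    rw [integral_congr_ae hpw, ← integral_comp_polarCoord_symm, hprod] at h0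
    have hpt : ∀ᵐ p ∂(μ.prod ν), p.1 • inner ℂ
        (partialWaveFun m (s.indicator fun _ => (1 : ℂ)) (polarCoord.symm p))
        (ψ (polarCoord.symm p)) =
        ((√(2 * Real.pi) : ℝ) : ℂ)⁻¹ * (s ×ˢ univ).indicator e p := by
      rw [← hprod]
      refine (ae_restrict_iff' polarCoord.open_target.measurableSet).2 (ae_of_all _ fun p hp => ?_)
      have hp0 : 0 < p.1 := hp.1
      rw [partialWaveFun, polarCoord.right_inv hp, RCLike.inner_apply']
      by_cases hps : p.1 ∈ s
      · have h3 : p ∈ s ×ˢ (univ : Set ℝ) := ⟨hps, trivial⟩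
        have h4 : p.1 * p.1 ^ (-(1 / 2) : ℝ) = √p.1 := by
          rw [Real.sqrt_eq_rpow]
          nth_rewrite 1 [← Real.rpow_one p.1]
          rw [← Real.rpow_add hp0]
          norm_num
        rw [indicator_of_mem hps, indicator_of_mem h3]
        simp only [he, hw, ← h4, map_mul, map_div₀, Complex.conj_ofReal, ← Complex.exp_conj,
          map_intCast, Complex.conj_I, map_one, mul_neg, Complex.real_smul]
        push_cast
        ring
      · have h3 : p ∉ s ×ˢ (univ : Set ℝ) := fun h => hps h.1
        rw [indicator_of_notMem hps, indicator_of_notMem h3]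
        simp
    rw [integral_congr_ae hpt, integral_const_mul, integral_indicator (hs.prod MeasurableSet.univ),
      ← Measure.prod_restrict, Measure.restrict_univ, integral_prod _ (hint s hs hμs)] at h0
    have hpi : ((√(2 * Real.pi) : ℝ) : ℂ)⁻¹ ≠ 0 := by
      simp [Real.pi_pos.le, Real.pi_ne_zero]
    exact (mul_eq_zero.1 h0).resolve_left hpi
  -- hence almost every angular slice vanishes
  have hsq : Integrable (fun p => ‖w p‖ ^ 2) (μ.prod ν) := hwL2.integrable_norm_pow (by norm_num)
  have hslice : ∀ᵐ r ∂μ, ∀ᵐ θ ∂ν, w (r, θ) = 0 := by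
    filter_upwards [ae_all_iff.2 hcoef, hsq.prod_right_ae] with r hr hri
    have hab : -Real.pi < Real.pi := by linarith [Real.pi_pos]
    have hνc : volume.restrict (Ioc (-Real.pi) Real.pi) = ν := Measure.restrict_congr_set Ioo_ae_eq_Ioc.symm
    have hL : MemLp (fun θ => w (r, θ)) 2 (volume.restrict (Ioc (-Real.pi) Real.pi)) := by
      rw [hνc]
      exact (memLp_two_iff_integrable_sq_norm
        (hwm.comp measurable_prodMk_left).aestronglyMeasurable).2 hri
    have hs := hasSum_sq_fourierCoeffOn hab hL
    have hz : ∀ n : ℤ, fourierCoeffOn hab (fun θ => w (r, θ)) n = 0 := by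
      intro n
      rw [fourierCoeffOn_eq_integral, intervalIntegral.integral_of_le hab.le, hνc]
      have := hr n
      have h5 : ∀ θ : ℝ, fourier (-n) (θ : AddCircle (Real.pi - -Real.pi)) • w (r, θ) =
          Complex.exp (-(n * θ * Complex.I)) * w (r, θ) := by
        intro θ
        rw [fourier_coe_apply, smul_eq_mul]
        congr 2
        have : (Real.pi : ℂ) ≠ 0 := by exact_mod_cast Real.pi_ne_zero
        push_cast
        field_simp
        ring
      simp only [h5, this, smul_zero]
    simp only [hz, norm_zero, ne_eq, OfNat.ofNat_ne_zero, not_false_eq_true, zero_pow] at hs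
    have h6 := hasSum_zero.unique hs
    rw [eq_comm, smul_eq_zero, intervalIntegral.integral_of_le hab.le, hνc] at h6
    have h7 := h6.resolve_left (inv_ne_zero (by linarith [Real.pi_pos]))
    rw [integral_eq_zero_iff_of_nonneg (fun θ => by positivity) hri] at h7
    filter_upwards [h7] with θ hθ
    simpa using hθ
  have hw0 : ∀ᵐ p ∂(μ.prod ν), w p = 0 := by
    have hm0 : MeasurableSet {p | w p = 0} := hwm (measurableSet_singleton 0)
    rw [Measure.ae_prod_iff_ae_ae hm0]
    exact hslice
  have hfin : ∫⁻ x, ‖ψ x‖ₑ ^ (2 : ℝ) = 0 := by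
    rw [← hnorm, lintegral_eq_zero_iff (by fun_prop)]
    filter_upwards [hw0] with p hp
    simp [hp]
  rw [lintegral_eq_zero_iff (by fun_prop)] at hfin
  refine Lp.ext (EventuallyEq.trans ?_ (Lp.coeFn_zero ..).symm)
  filter_upwards [hfin] with x hx
  simpa using hx

theorem fullGraph_functional (B R : ℝ) (α β : ℤ → ℝ) (p : SpinorSpace × SpinorSpace)
    (hp : p ∈ fullGraph B R α β) (h0 : p.1 = 0) : p.2 = 0 := by
  ext1 i
  refine partialWave_complete _ fun n f => ?_
  have h1 : (sector ![n, n]).adjoint p.2 = 0 :=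
    radialGraph_functional B R _ _ _ (hp n n) (by simp [h0])
  have h2 : inner ℂ (sector ![n, n] (PiLp.single 2 i f)) p.2 = 0 := by
    rw [← ContinuousLinearMap.adjoint_inner_right, h1, inner_zero_right]
  rw [PiLp.inner_apply, Fin.sum_univ_two, sector_apply, sector_apply] at h2
  fin_cases i <;> simpa using h2

/-- The operator `H^G_B` on `L²(ℝ²) ⊗ ℂ²`, with `G_{m,m'} = diag(α_m, β_{m'})`. -/
def fullHamiltonian (B R : ℝ) (α β : ℤ → ℝ) : SpinorSpace →ₗ.[ℂ] SpinorSpace :=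
  (fullGraph B R α β).toLinearPMap

theorem graph_fullHamiltonian (B R : ℝ) (α β : ℤ → ℝ) :
    (fullHamiltonian B R α β).graph = fullGraph B R α β :=
  Submodule.toLinearPMap_graph_eq _ (fullGraph_functional B R α β)

/-- The bounded operator `T` on `L²(ℝ²) ⊗ ℂ²` is the direct sum of the operators `S m m'` acting on
the `(m, m')` summands. -/
def IsDirectSum (T : SpinorSpace →L[ℂ] SpinorSpace) (S : ℤ → ℤ → RadialSpace →L[ℂ] RadialSpace) :
    Prop :=
  ∀ m m' : ℤ, T ∘L sector ![m, m'] = sector ![m, m'] ∘L S m m'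

/-! ### The Krein correction -/

open scoped Classical in
/-- The element of `L²((0,∞))` given by a square integrable function. -/
def toHalfLineL2 (f : ℝ → ℂ) : HalfLineL2 :=
  if h : MemLp f 2 (volume.restrict (Ioi (0 : ℝ))) then h.toLp f else 0

/-- `Ψ̃¹ = (φ¹, 0)` and `Ψ̃² = (0, φ²)`, for `M = (m, m')`. -/
def psi (B R : ℝ) (M : Fin 2 → ℤ) (i : Fin 2) (k : ℂ) : RadialSpace :=
  PiLp.single 2 i (toHalfLineL2 (phi B R i (M i) k))

/-- `∑_{i,j} μ_{i,j}(k) (Ψ̃^i(k̄), ·) Ψ̃^j(k)`. -/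
def kreinCorrection (B R : ℝ) (M : Fin 2 → ℤ) (g : Fin 2 → ℝ) (k : ℂ) :
    RadialSpace →L[ℂ] RadialSpace :=
  ∑ i, ∑ j, kreinCoeff B R M g k i j •
    InnerProductSpace.rankOne ℂ (psi B R M j k) (psi B R M i (conj k))

end DeltaCylinder

end

open DeltaCylinder

/-! Each spin component with fixed angular number is a half-line Schrödinger operator `-d²/dr² + V`
with a point interaction at `R`, so everything is proved in one channel and then assembled.

Self-adjointness. At the real energy `E = refEnergy` the first Kummer parameter equals `|m| + 1`,
and the radial equation has the explicit positive solution `F = r^ν e^{Br²/4}`, `ν = 1/2 + |m|`. Its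
logarithmic derivative `w` satisfies `w' + w² = V - E` (`riccati`), so the operator minus `E`
factors as `(-d/dr - w)(d/dr - w)`. The two factors are inverted by integral operators with kernel
`F(s)/F(t)`, `s < t`, and its transpose. This kernel decays exponentially in `t - s`, so the Schur
test makes both bounded, and their product `S` (`refGreen`) is a symmetric operator on `L²`. A
homogeneous solution that is square integrable, regular at the origin and continuous at `R` is a
multiple of one function `χ` (`refChi`), whose derivative jumps by `-1` at `R`. Hence `(f, h)` lies
in the channel graph exactly when, with `g = h - E f`, one has `f = S g + c χ` and `(1 + α χ(R)) c =
-α (χ, g)` (`mem_channelGraph_iff`). Since `α` and `χ(R)` are real, pure Hilbert space algebra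
(`self_adjoint_relation`) shows that such a relation is its own adjoint, including the case `1 + α
χ(R) = 0` in which `E` is an eigenvalue.

Green function. At complex `k`, Kummer's and Tricomi's functions give a solution `F` regular at `0`
and a solution `G` square integrable at infinity. If their Wronskian vanished, `F` would be an
eigenfunction, which is impossible for `k` in the resolvent set. For compactly supported data,
variation of constants produces an element of the domain, which must be the value of the resolvent.
For fixed `r` the kernel is in `L²`, so the formula extends by density to all of `L²`, without any
norm bound on the Green operator (`IsChannelResolvent.ae_eq_greenOp`).

Krein formula. The function `φ` is the free Green function with one variable at `R`. Adding `a φ` to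
the free resolvent keeps the differential equation, and the jump condition fixes `a`; the trace of
the free resolvent at `R` is `(φ(k̄), f)`. A zero of the denominator would turn `φ` into an
eigenfunction (`krein_channel`, `kreinDenom_ne_zero`).

Direct sum. Orthogonality of the `e^{imθ}` makes the sectors invariant. The correction on the plane
is taken to be the difference of two bounded resolvents, so its boundedness needs no estimate. -/

open MeasureTheory Set Filter Topology
open scoped ComplexConjugate

noncomputable section

namespace DeltaCylinder

/-! ### Calculus of absolutely continuous functions through their densities. -/

section Densities

/-! ### Absolutely continuous functions with a given density -/

/-- On every compact interval contained in `Ω` the function `f` is absolutely continuous with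
density `f'`. -/
structure HasDens (Ω : Set ℝ) (f f' : ℝ → ℂ) : Prop where
  intervalIntegrable : ∀ x y, x ≤ y → Icc x y ⊆ Ω → IntervalIntegrable f' volume x y
  integral_eq : ∀ x y, x ≤ y → Icc x y ⊆ Ω → ∫ t in x..y, f' t = f y - f x

/-- Real and imaginary parts are primitives of real integrable functions; multiplying them by the
constants `1` and `Complex.I` and adding keeps absolute continuity. The `ε`-`δ` condition only sees
values on the interval, where the sum agrees with the complex primitive. -/
theorem absolutelyContinuousOnInterval_integral_complex {f : ℝ → ℂ} {x y : ℝ}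
    (h : IntervalIntegrable f volume x y) :
    AbsolutelyContinuousOnInterval (fun t => ∫ s in x..t, f s) x y := by
  have hre : IntervalIntegrable (fun t => (f t).re) volume x y := ⟨h.1.re, h.2.re⟩
  have him : IntervalIntegrable (fun t => (f t).im) volume x y := ⟨h.1.im, h.2.im⟩
  have h1 := hre.absolutelyContinuousOnInterval_intervalIntegral left_mem_uIcc
  have h2 := him.absolutelyContinuousOnInterval_intervalIntegral left_mem_uIcc
  have hc : ∀ c : ℂ, AbsolutelyContinuousOnInterval (fun _ : ℝ => c) x y := fun c =>
    (LipschitzWith.const c).lipschitzOnWith.absolutelyContinuousOnInterval (K := 0)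
  have h3 := (h1.smul (hc 1)).add (h2.smul (hc Complex.I))
  have key : ∀ t ∈ uIcc x y, ((fun t => ∫ s in x..t, (f s).re) • (fun _ : ℝ => (1 : ℂ)) +
      (fun t => ∫ s in x..t, (f s).im) • (fun _ : ℝ => Complex.I)) t = ∫ s in x..t, f s := by
    intro t ht
    have hsub : IntervalIntegrable f volume x t := h.mono_set (uIcc_subset_uIcc_left ht)
    have hre' : IntervalIntegrable (fun t => ((f t).re : ℂ)) volume x t :=
      ⟨hsub.1.re.ofReal, hsub.2.re.ofReal⟩
    have him' : IntervalIntegrable (fun t => ((f t).im : ℂ)) volume x t :=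
      ⟨hsub.1.im.ofReal, hsub.2.im.ofReal⟩
    simp only [Pi.add_apply, Pi.smul_apply', Complex.real_smul, mul_one]
    rw [← intervalIntegral.integral_ofReal, ← intervalIntegral.integral_ofReal,
      ← intervalIntegral.integral_mul_const, ← intervalIntegral.integral_add hre'
        (him'.mul_const _)]
    exact intervalIntegral.integral_congr fun s _ => by simp [Complex.re_add_im]
  rw [absolutelyContinuousOnInterval_iff] at h3 ⊢
  intro ε hε
  obtain ⟨δ, hδ, H⟩ := h3 ε hε
  refine ⟨δ, hδ, fun E hE hl => ?_⟩
  have := H E hE hl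
  refine lt_of_eq_of_lt (Finset.sum_congr rfl fun i hi => ?_) this
  have h5 := hE.1 i hi
  rw [key _ h5.1, key _ h5.2]

namespace HasDens

variable {Ω Ω' : Set ℝ} {f f' g g' : ℝ → ℂ}

theorem mono (h : HasDens Ω f f') (hs : Ω' ⊆ Ω) : HasDens Ω' f f' :=
  ⟨fun x y hxy hi => h.intervalIntegrable x y hxy (hi.trans hs),
    fun x y hxy hi => h.integral_eq x y hxy (hi.trans hs)⟩

theorem eq_add (h : HasDens Ω f f') {x y t : ℝ} (hs : Icc x y ⊆ Ω) (ht : t ∈ Icc x y) :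
    f t = f x + ∫ s in x..t, f' s := by
  rw [h.integral_eq x t ht.1 ((Icc_subset_Icc_right ht.2).trans hs)]
  ring

theorem continuousOn_Icc (h : HasDens Ω f f') {x y : ℝ} (hs : Icc x y ⊆ Ω) :
    ContinuousOn f (Icc x y) := by
  rcases le_or_gt x y with hxy | hxy
  swap
  · simp [Icc_eq_empty hxy.not_ge]
  have h1 := h.intervalIntegrable x y hxy hs
  have h2 : ContinuousOn (fun t => f x + ∫ s in x..t, f' s) (Icc x y) := by
    refine continuousOn_const.add ?_
    have := intervalIntegral.continuousOn_primitive_interval' h1 left_mem_uIcc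
    rwa [uIcc_of_le hxy] at this
  exact h2.congr fun t ht => h.eq_add hs ht

theorem add (hf : HasDens Ω f f') (hg : HasDens Ω g g') :
    HasDens Ω (fun t => f t + g t) (fun t => f' t + g' t) where
  intervalIntegrable x y hxy hs :=
    (hf.intervalIntegrable x y hxy hs).add (hg.intervalIntegrable x y hxy hs)
  integral_eq x y hxy hs := by
    rw [intervalIntegral.integral_add (hf.intervalIntegrable x y hxy hs)
      (hg.intervalIntegrable x y hxy hs), hf.integral_eq x y hxy hs, hg.integral_eq x y hxy hs]
    ring

theorem const_mul (c : ℂ) (hf : HasDens Ω f f') :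
    HasDens Ω (fun t => c * f t) (fun t => c * f' t) where
  intervalIntegrable x y hxy hs := (hf.intervalIntegrable x y hxy hs).const_mul c
  integral_eq x y hxy hs := by
    rw [intervalIntegral.integral_const_mul, hf.integral_eq x y hxy hs]
    ring

theorem sub (hf : HasDens Ω f f') (hg : HasDens Ω g g') :
    HasDens Ω (fun t => f t - g t) (fun t => f' t - g' t) := by
  simpa [sub_eq_add_neg] using hf.add (hg.const_mul (-1))

theorem congr_dens (hf : HasDens Ω f f') (h : ∀ t ∈ Ω, f' t = g' t) : HasDens Ω f g' where
  intervalIntegrable x y hxy hs := by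
    refine (hf.intervalIntegrable x y hxy hs).congr fun t ht => h t (hs ?_)
    rw [uIoc_of_le hxy] at ht
    exact Ioc_subset_Icc_self ht
  integral_eq x y hxy hs := by
    rw [← hf.integral_eq x y hxy hs]
    refine intervalIntegral.integral_congr fun t ht => (h t (hs ?_)).symm
    rwa [uIcc_of_le hxy] at ht

theorem congr_ae (hf : HasDens Ω f f') (hΩ : MeasurableSet Ω)
    (h : f' =ᵐ[volume.restrict Ω] g') : HasDens Ω f g' := by
  rw [EventuallyEq, ae_restrict_iff' hΩ] at h
  refine ⟨fun x y hxy hs => ?_, fun x y hxy hs => ?_⟩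
  · refine (hf.intervalIntegrable x y hxy hs).congr_ae ?_
    rw [EventuallyEq, ae_restrict_iff' measurableSet_uIoc, uIoc_of_le hxy]
    filter_upwards [h] with t ht hm using ht (hs (Ioc_subset_Icc_self hm))
  · rw [← hf.integral_eq x y hxy hs]
    refine intervalIntegral.integral_congr_ae ?_
    rw [uIoc_of_le hxy]
    filter_upwards [h] with t ht hm using (ht (hs (Ioc_subset_Icc_self hm))).symm

theorem congr_fun (hf : HasDens Ω f f') (h : ∀ t ∈ Ω, f t = g t) : HasDens Ω g f' where
  intervalIntegrable := hf.intervalIntegrable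
  integral_eq x y hxy hs := by
    rw [hf.integral_eq x y hxy hs, h x (hs (left_mem_Icc.2 hxy)), h y (hs (right_mem_Icc.2 hxy))]

theorem of_hasDerivAt (h : ∀ t ∈ Ω, HasDerivAt f (f' t) t) (hc : ContinuousOn f' Ω) :
    HasDens Ω f f' := by
  have hi : ∀ x y, x ≤ y → Icc x y ⊆ Ω → IntervalIntegrable f' volume x y := fun x y hxy hs => by
    refine ContinuousOn.intervalIntegrable ?_
    rw [uIcc_of_le hxy]
    exact hc.mono hs
  refine ⟨hi, fun x y hxy hs => ?_⟩
  refine intervalIntegral.integral_eq_sub_of_hasDerivAt (fun t ht => h t (hs ?_)) (hi x y hxy hs)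
  rwa [uIcc_of_le hxy] at ht

/-- Product rule: `f g` minus the primitive of `f' g + f g'` is absolutely continuous with
derivative zero almost everywhere, hence constant. -/
theorem mul (hf : HasDens Ω f f') (hg : HasDens Ω g g') :
    HasDens Ω (fun t => f t * g t) (fun t => f' t * g t + f t * g' t) := by
  have hint : ∀ x y, x ≤ y → Icc x y ⊆ Ω →
      IntervalIntegrable (fun t => f' t * g t + f t * g' t) volume x y := fun x y hxy hs => by
    have h1 := hf.continuousOn_Icc hs
    have h2 := hg.continuousOn_Icc hs
    rw [← uIcc_of_le hxy] at h1 h2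
    exact ((hf.intervalIntegrable x y hxy hs).mul_continuousOn h2).add
      ((hg.intervalIntegrable x y hxy hs).continuousOn_mul h1)
  refine ⟨hint, fun x y hxy hs => ?_⟩
  have hc : ∀ c : ℂ, AbsolutelyContinuousOnInterval (fun _ : ℝ => c) x y := fun c =>
    (LipschitzWith.const c).lipschitzOnWith.absolutelyContinuousOnInterval (K := 0)
  have hf1 := hf.intervalIntegrable x y hxy hs
  have hg1 := hg.intervalIntegrable x y hxy hs
  have hF := (hc (f x)).add (absolutelyContinuousOnInterval_integral_complex hf1)
  have hG := (hc (g x)).add (absolutelyContinuousOnInterval_integral_complex hg1)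
  have hH := (hF.smul hG).sub
    (absolutelyContinuousOnInterval_integral_complex (hint x y hxy hs))
  obtain ⟨C, hC⟩ := hH.const_of_ae_hasDerivAt_zero (by
    filter_upwards [hf1.ae_hasDerivAt_integral, hg1.ae_hasDerivAt_integral,
      (hint x y hxy hs).ae_hasDerivAt_integral] with t h1 h2 h3 ht
    have h4 := ((h1 ht x left_mem_uIcc).const_add (f x)).mul
      ((h2 ht x left_mem_uIcc).const_add (g x))
    have h5 := h4.sub (h3 ht x left_mem_uIcc)
    rw [uIcc_of_le hxy] at ht
    refine h5.congr_deriv ?_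
    rw [← hf.eq_add hs ht, ← hg.eq_add hs ht]
    ring)
  have hx := hC x left_mem_uIcc
  have hy := hC y right_mem_uIcc
  simp only [Pi.sub_apply, smul_eq_mul, Pi.mul_apply, Pi.add_apply,
    intervalIntegral.integral_same, add_zero, sub_zero,
    ← hf.eq_add hs (right_mem_Icc.2 hxy), ← hg.eq_add hs (right_mem_Icc.2 hxy)] at hx hy
  rw [hx, ← hy]
  ring

/-- This is where almost-everywhere information becomes classical: for a continuous density the
fundamental theorem of calculus holds at every point. -/
theorem hasDerivAt (hf : HasDens Ω f f') (hΩ : IsOpen Ω) (hc : ContinuousOn f' Ω) {t : ℝ}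
    (ht : t ∈ Ω) : HasDerivAt f (f' t) t := by
  obtain ⟨ε, hε, hball⟩ := Metric.isOpen_iff.1 hΩ t ht
  have hs : Icc (t - ε / 2) (t + ε / 2) ⊆ Ω := fun s hs => hball (by
    rw [Metric.mem_ball, Real.dist_eq, abs_lt]
    constructor <;> linarith [hs.1, hs.2])
  have h1 : HasDerivAt (fun s => f (t - ε / 2) + ∫ r in (t - ε / 2)..s, f' r) (f' t) t := by
    refine HasDerivAt.const_add _ ?_
    refine intervalIntegral.integral_hasDerivAt_right
      ((hf.intervalIntegrable _ _ (by linarith) hs).mono_set ?_) ?_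
      (hc.continuousAt (hΩ.mem_nhds ht))
    · rw [uIcc_of_le (by linarith), uIcc_of_le (by linarith)]
      exact Icc_subset_Icc_right (by linarith)
    · exact ContinuousOn.stronglyMeasurableAtFilter hΩ hc t ht
  refine h1.congr_of_eventuallyEq ?_
  filter_upwards [Icc_mem_nhds (show t - ε / 2 < t by linarith) (show t < t + ε / 2 by linarith)]
    with s hs' using hf.eq_add hs hs'

theorem continuousOn (hf : HasDens Ω f f') (hΩ : IsOpen Ω) : ContinuousOn f Ω := by
  intro t ht
  obtain ⟨ε, hε, hball⟩ := Metric.isOpen_iff.1 hΩ t ht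
  have hs : Icc (t - ε / 2) (t + ε / 2) ⊆ Ω := fun s hs => hball (by
    rw [Metric.mem_ball, Real.dist_eq, abs_lt]
    constructor <;> linarith [hs.1, hs.2])
  exact ((hf.continuousOn_Icc hs).continuousAt
    (Icc_mem_nhds (by linarith) (by linarith))).continuousWithinAt

/-- A primitive. -/
theorem primitive {c : ℝ} (h : ∀ x ∈ Ω, IntervalIntegrable f' volume c x) :
    HasDens Ω (fun t => ∫ s in c..t, f' s) f' where
  intervalIntegrable x y hxy hs :=
    (h x (hs (left_mem_Icc.2 hxy))).symm.trans (h y (hs (right_mem_Icc.2 hxy)))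
  integral_eq x y hxy hs :=
    (intervalIntegral.integral_interval_sub_left (h y (hs (right_mem_Icc.2 hxy)))
      (h x (hs (left_mem_Icc.2 hxy)))).symm

end HasDens

theorem IsH2Loc.hasDens {Ω : Set ℝ} {u u₁ u₂ : ℝ → ℂ} (h : IsH2Loc Ω u u₁ u₂) :
    HasDens Ω u₁ u₂ where
  intervalIntegrable x y hxy hs := by
    rw [intervalIntegrable_iff_integrableOn_Icc_of_le hxy]
    exact (h.memLp x y hxy hs).integrable (by norm_num)
  integral_eq := h.integral_eq

end Densities

/-! ### Bounded integral operators on `L²`, and a growing solution with exponential control. -/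

section IntegralOperators

/-! ### The Schur test -/

section Schur

open scoped ENNReal

variable {μ : Measure ℝ} {κ : ℝ → ℝ → ℝ≥0∞} {C : ℝ≥0∞}

/-- Cauchy–Schwarz for the splitting `k φ = k^{1/2} · (k^{1/2} φ)`. -/
theorem sq_lintegral_mul_le (k φ : ℝ → ℝ≥0∞) (hk : AEMeasurable k μ) (hφ : AEMeasurable φ μ) :
    (∫⁻ s, k s * φ s ∂μ) ^ (2 : ℝ) ≤ (∫⁻ s, k s ∂μ) * ∫⁻ s, k s * φ s ^ (2 : ℝ) ∂μ := by
  have hpq : (2 : ℝ).HolderConjugate 2 := by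
    rw [Real.holderConjugate_iff]; norm_num
  have h := ENNReal.lintegral_mul_le_Lp_mul_Lq μ hpq (f := fun s => k s ^ (1 / 2 : ℝ))
    (g := fun s => k s ^ (1 / 2 : ℝ) * φ s) (hk.pow_const _) ((hk.pow_const _).mul hφ)
  have e1 : ∀ s, (k s ^ (1 / 2 : ℝ)) ^ (2 : ℝ) = k s := fun s => by
    rw [← ENNReal.rpow_mul]; norm_num
  have e2 : ∀ s, k s ^ (1 / 2 : ℝ) * (k s ^ (1 / 2 : ℝ) * φ s) = k s * φ s := fun s => by
    rw [← mul_assoc, ← ENNReal.rpow_add_of_nonneg _ _ (by norm_num) (by norm_num)]; norm_num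
  simp only [Pi.mul_apply, e2, ENNReal.mul_rpow_of_nonneg _ _ (zero_le_two (α := ℝ)), e1] at h
  refine (ENNReal.rpow_le_rpow h zero_le_two).trans_eq ?_
  rw [ENNReal.mul_rpow_of_nonneg _ _ zero_le_two, ← ENNReal.rpow_mul, ← ENNReal.rpow_mul]
  norm_num

/-- Schur test: the row bound controls the first factor of Cauchy–Schwarz, and after Tonelli the
column bound controls the second. -/
theorem lintegral_sq_kernel_le [SFinite μ] (hκ : Measurable (Function.uncurry κ))
    (h1 : ∀ᵐ t ∂μ, ∫⁻ s, κ t s ∂μ ≤ C) (h2 : ∀ᵐ s ∂μ, ∫⁻ t, κ t s ∂μ ≤ C)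
    {φ : ℝ → ℝ≥0∞} (hφ : AEMeasurable φ μ) :
    ∫⁻ t, (∫⁻ s, κ t s * φ s ∂μ) ^ (2 : ℝ) ∂μ ≤ C * (C * ∫⁻ s, φ s ^ (2 : ℝ) ∂μ) := by
  have hm : AEMeasurable (Function.uncurry fun t s => κ t s * φ s ^ (2 : ℝ)) (μ.prod μ) :=
    hκ.aemeasurable.mul ((hφ.pow_const (2 : ℝ)).comp_snd)
  calc ∫⁻ t, (∫⁻ s, κ t s * φ s ∂μ) ^ (2 : ℝ) ∂μ
      ≤ ∫⁻ t, C * ∫⁻ s, κ t s * φ s ^ (2 : ℝ) ∂μ ∂μ := by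
        refine lintegral_mono_ae ?_
        filter_upwards [h1] with t ht
        refine (sq_lintegral_mul_le _ _ (hκ.of_uncurry_left.aemeasurable) hφ).trans ?_
        gcongr
    _ = C * ∫⁻ t, ∫⁻ s, κ t s * φ s ^ (2 : ℝ) ∂μ ∂μ :=
        lintegral_const_mul'' _ (hm.lintegral_prod_right')
    _ = C * ∫⁻ s, ∫⁻ t, κ t s * φ s ^ (2 : ℝ) ∂μ ∂μ := by
        rw [lintegral_lintegral_swap hm]
    _ ≤ C * ∫⁻ s, C * φ s ^ (2 : ℝ) ∂μ := by
        gcongr 1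
        refine lintegral_mono_ae ?_
        filter_upwards [h2] with s hs
        rw [lintegral_mul_const _ hκ.of_uncurry_right]
        gcongr
    _ = C * (C * ∫⁻ s, φ s ^ (2 : ℝ) ∂μ) := by
        rw [lintegral_const_mul'' _ (hφ.pow_const _)]

theorem memLp_two_iff_lintegral_lt_top {f : ℝ → ℂ} (hf : AEStronglyMeasurable f μ) :
    MemLp f 2 μ ↔ ∫⁻ t, ‖f t‖ₑ ^ (2 : ℝ) ∂μ < ⊤ := by
  rw [MemLp, and_iff_right hf, eLpNorm_lt_top_iff_lintegral_rpow_enorm_lt_top (by norm_num)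
    (by norm_num)]
  simp

/-- A kernel satisfying the conditions of the Schur test. -/
structure SchurKernel (μ : Measure ℝ) (K : ℝ → ℝ → ℝ) : Prop where
  measurable : Measurable (Function.uncurry K)
  bound : ∃ C : ℝ≥0∞, C ≠ ⊤ ∧ (∀ᵐ t ∂μ, ∫⁻ s, ‖(K t s : ℂ)‖ₑ ∂μ ≤ C) ∧
    ∀ᵐ s ∂μ, ∫⁻ t, ‖(K t s : ℂ)‖ₑ ∂μ ≤ C

variable {K : ℝ → ℝ → ℝ} {f h : ℝ → ℂ}

theorem SchurKernel.swap (hK : SchurKernel μ K) : SchurKernel μ fun t s => K s t := by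
  obtain ⟨C, hC, h1, h2⟩ := hK.bound
  exact ⟨hK.measurable.comp measurable_swap, C, hC, h2, h1⟩

theorem SchurKernel.memLp [SFinite μ] (hK : SchurKernel μ K) (hf : MemLp f 2 μ) :
    MemLp (fun t => ∫ s, K t s * f s ∂μ) 2 μ := by
  obtain ⟨C, hC, h1, h2⟩ := hK.bound
  have hKm : Measurable (Function.uncurry fun t s => (K t s : ℂ)) :=
    Complex.measurable_ofReal.comp hK.measurable
  have hm : AEStronglyMeasurable (fun t => ∫ s, K t s * f s ∂μ) μ :=
    AEStronglyMeasurable.integral_prod_right'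
      (f := fun p : ℝ × ℝ => (K p.1 p.2 : ℂ) * f p.2)
      (hKm.aestronglyMeasurable.mul hf.1.comp_snd)
  rw [memLp_two_iff_lintegral_lt_top hm]
  have hκ : Measurable (Function.uncurry fun t s => ‖(K t s : ℂ)‖ₑ) := hKm.enorm
  refine lt_of_le_of_lt ?_ (b := C * (C * ∫⁻ s, ‖f s‖ₑ ^ (2 : ℝ) ∂μ)) ?_
  · refine le_trans ?_ (lintegral_sq_kernel_le hκ h1 h2 hf.1.enorm)
    refine lintegral_mono fun t => ENNReal.rpow_le_rpow ?_ zero_le_two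
    refine (enorm_integral_le_lintegral_enorm _).trans_eq ?_
    simp only [enorm_mul]
  · exact ENNReal.mul_lt_top hC.lt_top (ENNReal.mul_lt_top hC.lt_top
      ((memLp_two_iff_lintegral_lt_top hf.1).1 hf))

/-- Fubini. The double integral converges absolutely by Hölder, because `t ↦ ∫ |K(t,s)| |f(s)| ds`
is itself square integrable by the Schur estimate. -/
theorem SchurKernel.integral_mul_comm [SFinite μ] (hK : SchurKernel μ K) (hf : MemLp f 2 μ)
    (hh : MemLp h 2 μ) :
    ∫ t, h t * ∫ s, K t s * f s ∂μ ∂μ = ∫ s, (∫ t, K t s * h t ∂μ) * f s ∂μ := by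
  obtain ⟨C, hC, h1, h2⟩ := hK.bound
  have hKm : Measurable (Function.uncurry fun t s => (K t s : ℂ)) :=
    Complex.measurable_ofReal.comp hK.measurable
  have hκ : Measurable (Function.uncurry fun t s => ‖(K t s : ℂ)‖ₑ) := hKm.enorm
  have hint : Integrable (Function.uncurry fun t s => h t * (K t s * f s)) (μ.prod μ) := by
    have hm : AEStronglyMeasurable (Function.uncurry fun t s => h t * (K t s * f s))
        (μ.prod μ) := hh.1.comp_fst.mul (hKm.aestronglyMeasurable.mul hf.1.comp_snd)
    refine ⟨hm, ?_⟩
    rw [HasFiniteIntegral, lintegral_prod _ hm.enorm]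
    have e : ∀ t, ∫⁻ s, ‖Function.uncurry (fun t s => h t * (K t s * f s)) (t, s)‖ₑ ∂μ =
        ‖h t‖ₑ * ∫⁻ s, ‖(K t s : ℂ)‖ₑ * ‖f s‖ₑ ∂μ := fun t => by
      rw [← lintegral_const_mul'' (f := fun s => ‖(K t s : ℂ)‖ₑ * ‖f s‖ₑ) _
        (hκ.of_uncurry_left.aemeasurable.mul hf.1.enorm)]
      simp [Function.uncurry, enorm_mul]
    simp only [e]
    have hpq : (2 : ℝ).HolderConjugate 2 := by
      rw [Real.holderConjugate_iff]; norm_num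
    refine (ENNReal.lintegral_mul_le_Lp_mul_Lq μ hpq hh.1.enorm ?_).trans_lt ?_
    · exact AEMeasurable.lintegral_prod_right'
        (f := fun p : ℝ × ℝ => ‖(K p.1 p.2 : ℂ)‖ₑ * ‖f p.2‖ₑ)
        (hκ.aemeasurable.mul hf.1.comp_snd.enorm)
    · refine ENNReal.mul_lt_top ?_ ?_
      · exact ENNReal.rpow_lt_top_of_nonneg (by norm_num)
          ((memLp_two_iff_lintegral_lt_top hh.1).1 hh).ne
      · refine ENNReal.rpow_lt_top_of_nonneg (by norm_num) (ne_of_lt ?_)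
        refine (lintegral_sq_kernel_le hκ h1 h2 hf.1.enorm).trans_lt ?_
        exact ENNReal.mul_lt_top hC.lt_top (ENNReal.mul_lt_top hC.lt_top
          ((memLp_two_iff_lintegral_lt_top hf.1).1 hf))
  simp only [← integral_const_mul, ← integral_mul_const]
  rw [integral_integral_swap hint]
  refine integral_congr_ae (ae_of_all _ fun s => integral_congr_ae (ae_of_all _ fun t => ?_))
  dsimp only
  ring

end Schur

/-! ### An explicit positive solution growing at infinity -/

/-- `r^ν e^{Br²/4}`. -/
def growingSol (B ν r : ℝ) : ℝ := r ^ ν * Real.exp (B * r ^ 2 / 4)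

variable {B ν : ℝ}

theorem growingSol_pos {r : ℝ} (hr : 0 < r) : 0 < growingSol B ν r :=
  mul_pos (Real.rpow_pos_of_pos hr _) (Real.exp_pos _)

theorem measurable_growingSol : Measurable (growingSol B ν) := by
  unfold growingSol
  fun_prop

theorem hasDerivAt_growingSol {r : ℝ} (hr : 0 < r) :
    HasDerivAt (growingSol B ν) ((ν / r + B / 2 * r) * growingSol B ν r) r := by
  have h1 := Real.hasDerivAt_rpow_const (x := r) (p := ν) (Or.inl hr.ne')
  have h2 : HasDerivAt (fun r : ℝ => Real.exp (B * r ^ 2 / 4))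
      (Real.exp (B * r ^ 2 / 4) * (B / 2 * r)) r := by
    have : HasDerivAt (fun r : ℝ => B * r ^ 2 / 4) (B / 2 * r) r := by
      refine (((hasDerivAt_pow 2 r).const_mul B).div_const 4).congr_deriv ?_
      norm_num; ring
    exact this.exp
  refine (h1.mul h2).congr_deriv ?_
  rw [growingSol, Real.rpow_sub_one hr.ne']
  field_simp

theorem continuousOn_growingSol : ContinuousOn (growingSol B ν) (Ioi 0) := fun _ hr =>
  (hasDerivAt_growingSol hr).continuousAt.continuousWithinAt

/-- The function `F(r) e^{-√B r}` is nondecreasing: its logarithmic derivative is `(ν + Br²/2 - √B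
r)/r`, and `√B r ≤ 1/2 + Br²/2`, which is why `ν ≥ 1/2` is needed. -/
theorem growingSol_le (hB : 0 < B) (hν : 1 / 2 ≤ ν) {s t : ℝ} (hs : 0 < s) (hst : s ≤ t) :
    growingSol B ν s ≤ growingSol B ν t * Real.exp (-√B * (t - s)) := by
  have hmono : MonotoneOn (fun r => growingSol B ν r * Real.exp (-√B * r)) (Ioi 0) := by
    have hd : ∀ r ∈ Ioi (0 : ℝ), HasDerivAt (fun r => growingSol B ν r * Real.exp (-√B * r))
        ((ν / r + B / 2 * r - √B) * (growingSol B ν r * Real.exp (-√B * r))) r := fun r hr => by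
      have h2 : HasDerivAt (fun r : ℝ => Real.exp (-√B * r))
          (Real.exp (-√B * r) * (-√B * 1)) r := ((hasDerivAt_id r).const_mul (-√B)).exp
      exact ((hasDerivAt_growingSol hr).mul h2).congr_deriv (by ring)
    refine monotoneOn_of_deriv_nonneg (convex_Ioi 0)
      (fun r hr => (hd r hr).continuousAt.continuousWithinAt) ?_ ?_
    · rw [interior_Ioi]
      exact fun r hr => (hd r hr).differentiableAt.differentiableWithinAt
    · rw [interior_Ioi]
      intro r hr
      have hr' : 0 < r := hr
      rw [(hd r hr).deriv]
      refine mul_nonneg ?_ (mul_pos (growingSol_pos hr) (Real.exp_pos _)).le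
      have h1 : √B * r ≤ 1 / 2 + B / 2 * r ^ 2 := by
        nlinarith [sq_nonneg (√B * r - 1), Real.sq_sqrt hB.le]
      have h3 : ν / r + B / 2 * r - √B = (ν + B / 2 * r ^ 2 - √B * r) / r := by
        field_simp
      rw [h3]
      exact div_nonneg (by linarith) hr'.le
  have h := hmono hs (hs.trans_le hst : t ∈ Ioi 0) hst
  have e : Real.exp (-√B * (t - s)) = Real.exp (-√B * t) * Real.exp (√B * s) := by
    rw [← Real.exp_add]; ring_nf
  rw [e, ← mul_assoc]
  have h5 := mul_le_mul_of_nonneg_right h (Real.exp_pos (√B * s)).le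
  simp only [mul_assoc, ← Real.exp_add] at h5
  rw [neg_mul, neg_add_cancel, Real.exp_zero, mul_one] at h5
  refine h5.trans_eq ?_
  rw [mul_assoc, ← Real.exp_add, neg_mul]

theorem growingSol_mono (hB : 0 < B) (hν : 1 / 2 ≤ ν) {s t : ℝ} (hs : 0 < s) (hst : s ≤ t) :
    growingSol B ν s ≤ growingSol B ν t := by
  refine (growingSol_le hB hν hs hst).trans ?_
  have : Real.exp (-√B * (t - s)) ≤ 1 := Real.exp_le_one_iff.2 (by
    have := Real.sqrt_nonneg B
    nlinarith)
  exact mul_le_of_le_one_right (growingSol_pos (hs.trans_le hst)).le this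

/-- The kernel of the operator `g ↦ F(t)⁻¹ ∫₀ᵗ F g`. -/
def lowerKernel (B ν t s : ℝ) : ℝ := if s < t then growingSol B ν s / growingSol B ν t else 0

/-- The kernel is dominated by `e^{-√B (t - s)}` on `s < t`, whose integral in either variable over
the full ray is `1/√B`. -/
theorem schurKernel_lowerKernel (hB : 0 < B) (hν : 1 / 2 ≤ ν) :
    SchurKernel (volume.restrict (Ioi 0)) (lowerKernel B ν) := by
  have hc : 0 < √B := Real.sqrt_pos.2 hB
  have hle : ∀ t ∈ Ioi (0 : ℝ), ∀ s ∈ Ioi (0 : ℝ), ‖(lowerKernel B ν t s : ℂ)‖ₑ ≤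
      if s < t then ENNReal.ofReal (Real.exp (-√B * (t - s))) else 0 := by
    intro t ht s hs
    rw [lowerKernel]
    split_ifs with h
    · rw [← ofReal_norm, Complex.norm_real, Real.norm_of_nonneg
        (div_pos (growingSol_pos hs) (growingSol_pos ht)).le]
      refine ENNReal.ofReal_le_ofReal ?_
      rw [div_le_iff₀ (growingSol_pos ht), mul_comm]
      exact growingSol_le hB hν hs h.le
    · simp
  refine ⟨?_, ENNReal.ofReal (1 / √B), ENNReal.ofReal_ne_top, ?_, ?_⟩
  · refine Measurable.ite (measurableSet_lt measurable_snd measurable_fst) ?_ measurable_const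
    exact (measurable_growingSol.comp measurable_snd).div
      (measurable_growingSol.comp measurable_fst)
  · filter_upwards [ae_restrict_mem measurableSet_Ioi] with t ht
    calc ∫⁻ s in Ioi 0, ‖(lowerKernel B ν t s : ℂ)‖ₑ
        ≤ ∫⁻ s in Ioi 0, (Iio t).indicator
            (fun s => ENNReal.ofReal (Real.exp (-√B * (t - s)))) s := by
          refine setLIntegral_mono_ae (Measurable.aemeasurable (Measurable.indicator
            (by fun_prop) measurableSet_Iio)) (ae_of_all _ fun s hs => ?_)
          refine (hle t ht s hs).trans_eq ?_
          simp [indicator]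
      _ ≤ ∫⁻ s, (Iio t).indicator (fun s => ENNReal.ofReal (Real.exp (-√B * (t - s)))) s :=
          setLIntegral_le_lintegral _ _
      _ = ∫⁻ s in Iio t, ENNReal.ofReal (Real.exp (-√B * (t - s))) :=
          lintegral_indicator measurableSet_Iio _
      _ = ∫⁻ s in Iic t, ENNReal.ofReal (Real.exp (√B * s) * Real.exp (-√B * t)) := by
          rw [setLIntegral_congr Iio_ae_eq_Iic]
          refine lintegral_congr fun s => ?_
          rw [← Real.exp_add]; ring_nf
      _ = ENNReal.ofReal (1 / √B) := by
          rw [← ofReal_integral_eq_lintegral_ofReal ((integrableOn_exp_mul_Iic hc t).mul_const _)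
            (ae_of_all _ fun s => (mul_pos (Real.exp_pos _) (Real.exp_pos _)).le),
            integral_mul_const, integral_exp_mul_Iic hc, div_mul_eq_mul_div, ← Real.exp_add]
          ring_nf
          simp
      _ ≤ _ := le_rfl
  · filter_upwards [ae_restrict_mem measurableSet_Ioi] with s hs
    calc ∫⁻ t in Ioi 0, ‖(lowerKernel B ν t s : ℂ)‖ₑ
        ≤ ∫⁻ t in Ioi 0, (Ioi s).indicator
            (fun t => ENNReal.ofReal (Real.exp (-√B * (t - s)))) t := by
          refine setLIntegral_mono_ae (Measurable.aemeasurable (Measurable.indicator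
            (by fun_prop) measurableSet_Ioi)) (ae_of_all _ fun t ht => ?_)
          refine (hle t ht s hs).trans_eq ?_
          simp [indicator]
      _ ≤ ∫⁻ t, (Ioi s).indicator (fun t => ENNReal.ofReal (Real.exp (-√B * (t - s)))) t :=
          setLIntegral_le_lintegral _ _
      _ = ∫⁻ t in Ioi s, ENNReal.ofReal (Real.exp (-√B * (t - s))) :=
          lintegral_indicator measurableSet_Ioi _
      _ = ∫⁻ t in Ioi s, ENNReal.ofReal (Real.exp (-√B * t) * Real.exp (√B * s)) := by
          refine lintegral_congr fun t => ?_
          rw [← Real.exp_add]; ring_nf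
      _ = ENNReal.ofReal (1 / √B) := by
          rw [← ofReal_integral_eq_lintegral_ofReal
            ((integrableOn_exp_mul_Ioi (neg_lt_zero.2 hc) s).mul_const _)
            (ae_of_all _ fun s => (mul_pos (Real.exp_pos _) (Real.exp_pos _)).le),
            integral_mul_const, integral_exp_mul_Ioi (neg_lt_zero.2 hc), div_mul_eq_mul_div,
            neg_mul, ← Real.exp_add]
          ring_nf
          simp
      _ ≤ _ := le_rfl

end IntegralOperators

/-! ### First-order factorization of the radial operator at the reference energy and its inverse. -/

section ReferenceOperators

/-- Lebesgue measure on `(0, ∞)`. -/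
notation "μ₊" => Measure.restrict (volume : Measure ℝ) (Ioi (0 : ℝ))

variable {B ν : ℝ}

/-! ### The two factors of the reference resolvent -/

/-- `g ↦ F(t)⁻¹ ∫₀ᵗ F g`. -/
def lowerOp (B ν : ℝ) (g : ℝ → ℂ) (t : ℝ) : ℂ := ∫ s, (lowerKernel B ν t s : ℂ) * g s ∂μ₊

/-- `h ↦ F(r) ∫ᵣ^∞ F⁻¹ h`. -/
def upperOp (B ν : ℝ) (h : ℝ → ℂ) (r : ℝ) : ℂ := ∫ t, (lowerKernel B ν t r : ℂ) * h t ∂μ₊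

theorem memLp_lowerOp (hB : 0 < B) (hν : 1 / 2 ≤ ν) {g : ℝ → ℂ} (hg : MemLp g 2 μ₊) :
    MemLp (lowerOp B ν g) 2 μ₊ := (schurKernel_lowerKernel hB hν).memLp hg

theorem memLp_upperOp (hB : 0 < B) (hν : 1 / 2 ≤ ν) {g : ℝ → ℂ} (hg : MemLp g 2 μ₊) :
    MemLp (upperOp B ν g) 2 μ₊ := (schurKernel_lowerKernel hB hν).swap.memLp hg

/-- The two factors are transposes of each other; this is the source of the symmetry of `refGreen`.
-/
theorem integral_mul_lowerOp (hB : 0 < B) (hν : 1 / 2 ≤ ν) {g h : ℝ → ℂ} (hg : MemLp g 2 μ₊)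
    (hh : MemLp h 2 μ₊) :
    ∫ t, h t * lowerOp B ν g t ∂μ₊ = ∫ s, upperOp B ν h s * g s ∂μ₊ :=
  (schurKernel_lowerKernel hB hν).integral_mul_comm hg hh

theorem conj_lowerOp (g : ℝ → ℂ) (t : ℝ) :
    conj (lowerOp B ν g t) = lowerOp B ν (fun s => conj (g s)) t := by
  simp only [lowerOp, ← integral_conj, map_mul, Complex.conj_ofReal]

theorem conj_upperOp (g : ℝ → ℂ) (t : ℝ) :
    conj (upperOp B ν g t) = upperOp B ν (fun s => conj (g s)) t := by
  simp only [upperOp, ← integral_conj, map_mul, Complex.conj_ofReal]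

theorem lowerOp_eq {t : ℝ} (ht : 0 < t) (g : ℝ → ℂ) :
    lowerOp B ν g t = ((growingSol B ν t)⁻¹ : ℝ) * ∫ s in (0 : ℝ)..t, growingSol B ν s * g s := by
  rw [intervalIntegral.integral_of_le ht.le, ← integral_const_mul, lowerOp,
    ← integral_indicator measurableSet_Ioi, ← integral_indicator measurableSet_Ioc]
  refine integral_congr_ae ?_
  have : ∀ᵐ s : ℝ, s ≠ t := by simp [ae_iff, measure_singleton]
  filter_upwards [this] with s hs
  by_cases h0 : 0 < s
  · rcases lt_or_gt_of_ne hs with h | h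
    · rw [indicator_of_mem (show s ∈ Ioi 0 from h0),
      indicator_of_mem (show s ∈ Ioc 0 t from ⟨h0, h.le⟩),
        lowerKernel, if_pos h]
      push_cast
      ring
    · rw [indicator_of_mem (show s ∈ Ioi 0 from h0), indicator_of_notMem (fun hm => hm.2.not_gt h),
        lowerKernel, if_neg h.not_gt]
      simp
  · rw [indicator_of_notMem (show s ∉ Ioi 0 from h0), indicator_of_notMem (fun hm => h0 hm.1)]

theorem upperOp_eq {r : ℝ} (hr : 0 < r) (h : ℝ → ℂ) :
    upperOp B ν h r = growingSol B ν r * ∫ t in Ioi r, ((growingSol B ν t)⁻¹ : ℝ) * h t := by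
  rw [← integral_const_mul, upperOp, ← integral_indicator measurableSet_Ioi,
    ← integral_indicator measurableSet_Ioi]
  congr 1
  ext t
  by_cases h1 : r < t
  · rw [indicator_of_mem (show t ∈ Ioi 0 from hr.trans h1),
      indicator_of_mem (show t ∈ Ioi r from h1),
      lowerKernel, if_pos h1]
    push_cast
    ring
  · rw [indicator_of_notMem (show t ∉ Ioi r from h1), indicator]
    simp [lowerKernel, h1]

theorem memLp_inv_growingSol (hB : 0 < B) (hν : 1 / 2 ≤ ν) {r : ℝ} (hr : 0 < r) :
    MemLp (fun t => (((growingSol B ν t)⁻¹ : ℝ) : ℂ)) 2 (volume.restrict (Ioi r)) := by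
  have hc : 0 < √B := Real.sqrt_pos.2 hB
  have hm : Measurable fun t => (((growingSol B ν t)⁻¹ : ℝ) : ℂ) :=
    Complex.measurable_ofReal.comp measurable_growingSol.inv
  have h1 : MemLp (fun t => (growingSol B ν r)⁻¹ * Real.exp (√B * r) * Real.exp (-√B * t)) 2
      (volume.restrict (Ioi r)) := by
    refine MemLp.const_mul ?_ _
    rw [memLp_two_iff_integrable_sq_norm (by fun_prop)]
    have : ∀ t : ℝ, ‖Real.exp (-√B * t)‖ ^ 2 = Real.exp (-(2 * √B) * t) := fun t => by
      rw [Real.norm_of_nonneg (Real.exp_pos _).le, ← Real.exp_nat_mul]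
      push_cast
      ring_nf
    simp only [this]
    exact integrableOn_exp_mul_Ioi (by linarith) r
  refine h1.of_le hm.aestronglyMeasurable ?_
  filter_upwards [ae_restrict_mem measurableSet_Ioi] with t ht
  have ht' : r < t := ht
  have hp := growingSol_pos (B := B) (ν := ν) hr
  have hpt := growingSol_pos (B := B) (ν := ν) (hr.trans ht')
  rw [Complex.norm_real, Real.norm_of_nonneg (by positivity), Real.norm_of_nonneg (by positivity),
    mul_assoc, ← Real.exp_add, inv_mul_eq_div, le_div_iff₀ hp, inv_mul_le_iff₀ hpt]
  refine (growingSol_le hB hν hr ht'.le).trans_eq ?_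
  ring_nf

theorem integrableOn_inv_mul (hB : 0 < B) (hν : 1 / 2 ≤ ν) {r : ℝ} (hr : 0 < r) {h : ℝ → ℂ}
    (hh : MemLp h 2 μ₊) :
    IntegrableOn (fun t => ((growingSol B ν t)⁻¹ : ℝ) * h t) (Ioi r) :=
  (memLp_inv_growingSol hB hν hr).integrable_mul
    (hh.mono_measure (Measure.restrict_mono (Ioi_subset_Ioi hr.le) le_rfl))

theorem intervalIntegrable_mul_growingSol (hB : 0 < B) (hν : 1 / 2 ≤ ν) {t : ℝ} (ht : 0 < t)
    {g : ℝ → ℂ} (hg : MemLp g 2 μ₊) :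
    IntervalIntegrable (fun s => (growingSol B ν s : ℂ) * g s) volume 0 t := by
  rw [intervalIntegrable_iff_integrableOn_Ioc_of_le ht.le]
  have hg' : IntegrableOn g (Ioc 0 t) :=
    (hg.mono_measure (Measure.restrict_mono Ioc_subset_Ioi_self le_rfl)).integrable (by norm_num)
  refine Integrable.bdd_mul (c := growingSol B ν t) hg'
    (Complex.measurable_ofReal.comp measurable_growingSol).aestronglyMeasurable ?_
  filter_upwards [ae_restrict_mem measurableSet_Ioc] with s hs
  rw [Complex.norm_real, Real.norm_of_nonneg (growingSol_pos hs.1).le]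
  exact growingSol_mono hB hν hs.1 hs.2

theorem hasDerivAt_growingSol_ofReal {r : ℝ} (hr : 0 < r) :
    HasDerivAt (fun r => (growingSol B ν r : ℂ))
      (((ν / r + B / 2 * r : ℝ) : ℂ) * growingSol B ν r) r := by
  have := (hasDerivAt_growingSol (B := B) (ν := ν) hr).ofReal_comp
  push_cast at this ⊢
  exact this

theorem hasDerivAt_inv_growingSol {r : ℝ} (hr : 0 < r) :
    HasDerivAt (fun r => (((growingSol B ν r)⁻¹ : ℝ) : ℂ))
      (-((ν / r + B / 2 * r : ℝ) : ℂ) * ((growingSol B ν r)⁻¹ : ℝ)) r := by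
  have hp := (growingSol_pos (B := B) (ν := ν) hr).ne'
  have := ((hasDerivAt_growingSol (B := B) (ν := ν) hr).inv hp).ofReal_comp
  refine this.congr_deriv ?_
  rw [← Complex.ofReal_neg, ← Complex.ofReal_mul]
  congr 1
  field_simp

theorem continuousOn_logDeriv :
    ContinuousOn (fun r : ℝ => ((ν / r + B / 2 * r : ℝ) : ℂ)) (Ioi 0) := by
  refine Complex.continuous_ofReal.comp_continuousOn ?_
  refine ContinuousOn.add (continuousOn_const.div continuousOn_id fun r hr => (ne_of_gt hr)) ?_
  fun_prop

theorem continuousOn_growingSol_ofReal :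
    ContinuousOn (fun r => (growingSol B ν r : ℂ)) (Ioi 0) := fun _ hr =>
  (hasDerivAt_growingSol_ofReal hr).continuousAt.continuousWithinAt

theorem continuousOn_inv_growingSol :
    ContinuousOn (fun r => (((growingSol B ν r)⁻¹ : ℝ) : ℂ)) (Ioi 0) := fun _ hr =>
  (hasDerivAt_inv_growingSol hr).continuousAt.continuousWithinAt

/-- Product rule for `F⁻¹ · ∫₀ᵗ F g`. The resulting equation `v' + w v = g` inverts one first-order
factor; the equation `u' = w u - v` of `hasDens_upperOp` inverts the other. -/
theorem hasDens_lowerOp (hB : 0 < B) (hν : 1 / 2 ≤ ν) {g : ℝ → ℂ} (hg : MemLp g 2 μ₊) :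
    HasDens (Ioi 0) (lowerOp B ν g)
      (fun t => g t - ((ν / t + B / 2 * t : ℝ) : ℂ) * lowerOp B ν g t) := by
  have h1 : HasDens (Ioi 0) (fun t => ∫ s in (0 : ℝ)..t, (growingSol B ν s : ℂ) * g s)
      (fun s => growingSol B ν s * g s) :=
    HasDens.primitive fun t ht => intervalIntegrable_mul_growingSol hB hν ht hg
  have h2 : HasDens (Ioi 0) (fun r => (((growingSol B ν r)⁻¹ : ℝ) : ℂ)) _ :=
    HasDens.of_hasDerivAt (fun r hr => hasDerivAt_inv_growingSol hr)
      (continuousOn_logDeriv.neg.mul continuousOn_inv_growingSol)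
  refine ((h2.mul h1).congr_fun fun t ht => (lowerOp_eq ht g).symm).congr_dens fun t ht => ?_
  have hp : (growingSol B ν t : ℂ) ≠ 0 := by exact_mod_cast (growingSol_pos ht).ne'
  rw [lowerOp_eq ht]
  push_cast
  field_simp
  ring

theorem hasDens_upperOp (hB : 0 < B) (hν : 1 / 2 ≤ ν) {h : ℝ → ℂ} (hh : MemLp h 2 μ₊) :
    HasDens (Ioi 0) (upperOp B ν h)
      (fun t => ((ν / t + B / 2 * t : ℝ) : ℂ) * upperOp B ν h t - h t) := by
  set k : ℝ → ℂ := fun t => ((growingSol B ν t)⁻¹ : ℝ) * h t with hk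
  have hi : ∀ r ∈ Ioi (0 : ℝ), IntegrableOn k (Ioi r) := fun r hr =>
    integrableOn_inv_mul hB hν hr hh
  have hii : ∀ x ∈ Ioi (0 : ℝ), ∀ y ∈ Ioi (0 : ℝ), IntervalIntegrable k volume x y := by
    intro x hx y hy
    rw [intervalIntegrable_iff]
    exact (hi (min x y) (mem_Ioi.2 (lt_min hx hy))).mono_set Ioc_subset_Ioi_self
  have h1 : HasDens (Ioi 0) (fun r => ∫ t in Ioi r, k t) (fun r => -k r) := by
    have h0 := (HasDens.primitive (f' := k) (c := 1) (Ω := Ioi 0) fun x hx =>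
      hii 1 (mem_Ioi.2 one_pos) x hx).const_mul (-1)
    have hc : HasDens (Ioi 0) (fun _ : ℝ => ∫ t in Ioi (1 : ℝ), k t) (fun _ => 0) :=
      HasDens.of_hasDerivAt (fun _ _ => hasDerivAt_const _ _) continuousOn_const
    refine ((hc.add h0).congr_fun fun r hr => ?_).congr_dens fun r hr => by ring
    have := intervalIntegral.integral_interval_add_Ioi (hi 1 (mem_Ioi.2 one_pos))
      (hi r hr)
    rw [← this]
    ring
  have h2 : HasDens (Ioi 0) (fun r => (growingSol B ν r : ℂ)) _ :=
    HasDens.of_hasDerivAt (fun r hr => hasDerivAt_growingSol_ofReal hr)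
      (continuousOn_logDeriv.mul continuousOn_growingSol_ofReal)
  refine ((h2.mul h1).congr_fun fun t ht => (upperOp_eq ht h).symm).congr_dens fun t ht => ?_
  have hp : (growingSol B ν t : ℂ) ≠ 0 := by exact_mod_cast (growingSol_pos ht).ne'
  rw [upperOp_eq ht]
  simp only [hk]
  push_cast
  field_simp
  ring

theorem hasDerivAt_logDeriv {r : ℝ} (hr : 0 < r) :
    HasDerivAt (fun r : ℝ => ((ν / r + B / 2 * r : ℝ) : ℂ)) ((-ν / r ^ 2 + B / 2 : ℝ) : ℂ) r := by
  refine HasDerivAt.ofReal_comp ?_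
  have h1 := ((hasDerivAt_id r).inv hr.ne').const_mul ν
  have h2 := (hasDerivAt_id r).const_mul (B / 2)
  simp only [id] at h1 h2
  refine (h1.add h2).congr_deriv ?_
  ring

theorem hasDens_logDeriv : HasDens (Ioi 0) (fun r : ℝ => ((ν / r + B / 2 * r : ℝ) : ℂ))
    (fun r => ((-ν / r ^ 2 + B / 2 : ℝ) : ℂ)) := by
  refine HasDens.of_hasDerivAt (fun r hr => hasDerivAt_logDeriv hr) ?_
  refine Complex.continuous_ofReal.comp_continuousOn ?_
  refine ContinuousOn.add (continuousOn_const.div (by fun_prop) fun r hr => ?_) continuousOn_const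
  have hr' : (0 : ℝ) < r := hr
  positivity

/-- The exponent `1/2 + |m|`. -/
def radialExponent (m : ℤ) : ℝ := 1 / 2 + (|m| : ℤ)

/-- The energy at which `r^ν e^{Br²/4}` solves the radial equation. -/
def refEnergy (B : ℝ) (i : Fin 2) (m : ℤ) : ℝ := B * (m + spinSign i - (|m| : ℤ) - 1)

theorem half_le_radialExponent (m : ℤ) : 1 / 2 ≤ radialExponent m := by
  have : (0 : ℝ) ≤ (|m| : ℤ) := by exact_mod_cast abs_nonneg m
  rw [radialExponent]
  linarith

/-- The `1/r²` terms match because `ν² - ν = m² - 1/4` for `ν = 1/2 + |m|`; comparing the constant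
terms is what determines `refEnergy`. -/
theorem riccati (i : Fin 2) (m : ℤ) {r : ℝ} (hr : 0 < r) :
    (-radialExponent m / r ^ 2 + B / 2) + (radialExponent m / r + B / 2 * r) ^ 2 =
      radialPotential B i m r - refEnergy B i m := by
  have h : ((|m| : ℤ) : ℝ) ^ 2 = (m : ℝ) ^ 2 := by
    push_cast
    exact sq_abs _
  simp only [radialExponent, radialPotential, refEnergy]
  field_simp
  linear_combination (16 : ℝ) * h

theorem continuousOn_radialPotential (i : Fin 2) (m : ℤ) :
    ContinuousOn (fun r => (radialPotential B i m r : ℂ)) (Ioi 0) := by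
  refine Complex.continuous_ofReal.comp_continuousOn ?_
  unfold radialPotential
  have h0 : ∀ r ∈ Ioi (0 : ℝ), r ≠ 0 := fun r hr => ne_of_gt hr
  refine ContinuousOn.add (ContinuousOn.sub (ContinuousOn.pow (ContinuousOn.add
    (continuousOn_const.div continuousOn_id h0) (by fun_prop)) 2)
    (continuousOn_const.div (by fun_prop) fun r hr => ?_)) continuousOn_const
  have hr' : (0 : ℝ) < r := hr
  positivity

/-- A bound `C √r` leaves a factor `1/|log r|`, which tends to zero. -/
theorem originCondition_of_bound {m : ℤ} {u : ℝ → ℂ}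
    (h : m = 0 → ∃ C : ℝ, ∀ᶠ r in 𝓝[>] (0 : ℝ), ‖u r‖ ≤ C * √r) : OriginCondition m u := by
  intro hm
  obtain ⟨C, hC⟩ := h hm
  have hlog : Tendsto (fun r : ℝ => C / |Real.log r|) (𝓝[>] 0) (𝓝 0) :=
    (tendsto_abs_atBot_atTop.comp Real.tendsto_log_nhdsGT_zero).const_div_atTop C
  refine squeeze_zero_norm' ?_ hlog
  filter_upwards [hC, self_mem_nhdsWithin] with r hr h0
  have h0' : 0 < √r := Real.sqrt_pos.2 h0
  rw [norm_div, Complex.norm_real, norm_mul, Real.norm_of_nonneg h0'.le, Real.norm_eq_abs,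
    ← div_div]
  gcongr
  rwa [div_le_iff₀ h0']

/-- The resolvent at `refEnergy` of the operator without point interaction. -/
def refGreen (B ν : ℝ) (g : ℝ → ℂ) : ℝ → ℂ := upperOp B ν (lowerOp B ν g)

theorem memLp_of_continuousOn_Icc {x y : ℝ} {f : ℝ → ℂ} (hf : ContinuousOn f (Icc x y)) :
    MemLp f 2 (volume.restrict (Icc x y)) := by
  obtain ⟨C, hC⟩ := isCompact_Icc.exists_bound_of_continuousOn hf
  exact MemLp.of_bound (hf.aestronglyMeasurable measurableSet_Icc) C
    ((ae_restrict_mem measurableSet_Icc).mono hC)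

/-- With `u' = w u - v` and `v' = g - w v` one gets `u'' = (w' + w²) u - g`, and `riccati`
identifies the coefficient. The set `Ω` is left free because for `refChi` the input `v` jumps at
`R`. -/
theorem isH2Loc_upperOp (hB : 0 < B) (i : Fin 2) (m : ℤ) {Ω : Set ℝ} (hΩ : IsOpen Ω)
    (hΩ0 : Ω ⊆ Ioi 0) {v g : ℝ → ℂ}
    (hv2 : MemLp v 2 μ₊) (hg : MemLp g 2 μ₊)
    (hv : HasDens Ω v fun t => g t - ((radialExponent m / t + B / 2 * t : ℝ) : ℂ) * v t) :
    IsH2Loc Ω (upperOp B (radialExponent m) v)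
      (fun r => ((radialExponent m / r + B / 2 * r : ℝ) : ℂ) * upperOp B (radialExponent m) v r
        - v r)
      (fun r => ((radialPotential B i m r : ℂ) - refEnergy B i m) *
        upperOp B (radialExponent m) v r - g r) := by
  have hν := half_le_radialExponent m
  have hu := (hasDens_upperOp hB hν hv2).mono hΩ0
  have hcu := hu.continuousOn hΩ
  have hd := (hasDens_logDeriv (B := B) (ν := radialExponent m)).mono hΩ0
  refine ⟨fun r hr => hu.hasDerivAt hΩ
    (((continuousOn_logDeriv.mono hΩ0).mul hcu).sub (hv.continuousOn hΩ)) hr, ?_, ?_⟩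
  · intro x y hxy hs
    refine MemLp.sub ?_ (hg.mono_measure (Measure.restrict_mono (hs.trans hΩ0) le_rfl))
    have hc : ContinuousOn (fun r => ((radialPotential B i m r : ℂ) - refEnergy B i m) *
        upperOp B (radialExponent m) v r) (Icc x y) :=
      ((((continuousOn_radialPotential i m).mono hΩ0).sub continuousOn_const).mul hcu).mono hs
    exact memLp_of_continuousOn_Icc hc
  · refine HasDens.integral_eq (HasDens.congr_dens ((hd.mul hu).sub hv) fun r hr => ?_)
    have := congrArg (fun x : ℝ => (x : ℂ)) (riccati (B := B) i m (hΩ0 hr))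
    push_cast at this ⊢
    linear_combination (upperOp B (radialExponent m) v r) * this

end ReferenceOperators

/-! ### Behaviour of homogeneous solutions near the origin. -/

section HomogeneousSolutions

variable {B ν : ℝ}

/-! ### Solutions of the homogeneous equation at the reference energy -/

theorem eq_of_hasDerivAt_zero {s : Set ℝ} (hs : IsOpen s) (hs' : IsPreconnected s) {w : ℝ → ℂ}
    (h : ∀ r ∈ s, HasDerivAt w 0 r) {x y : ℝ} (hx : x ∈ s) (hy : y ∈ s) : w x = w y :=
  hs.is_const_of_deriv_eq_zero hs'
    (fun r hr => (h r hr).differentiableAt.differentiableWithinAt)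
    (fun r hr => (h r hr).deriv) hx hy

theorem continuousOn_inv_sq_growingSol :
    ContinuousOn (fun t => ((growingSol B ν t)⁻¹) ^ 2) (Ioi 0) :=
  (continuousOn_growingSol.inv₀ fun _ hr => (growingSol_pos hr).ne').pow 2

/-- Reduction of order: the constant `b` is the Wronskian `d' F - d F'`, and `(d/F)' = b/F²`. -/
theorem hasDerivAt_div_growingSol (i : Fin 2) (m : ℤ) {s : Set ℝ} (hs : IsOpen s)
    (hs' : IsPreconnected s) (hs0 : s ⊆ Ioi 0) {d d₁ : ℝ → ℂ}
    (hd : ∀ r ∈ s, HasDerivAt d (d₁ r) r)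
    (hd₁ : ∀ r ∈ s, HasDerivAt d₁ (((radialPotential B i m r : ℂ) - refEnergy B i m) * d r) r) :
    ∃ b : ℂ, ∀ r ∈ s, HasDerivAt (fun r => d r * ((growingSol B (radialExponent m) r)⁻¹ : ℝ))
      (b * (((growingSol B (radialExponent m) r)⁻¹) ^ 2 : ℝ)) r := by
  set F := growingSol B (radialExponent m) with hF
  rcases s.eq_empty_or_nonempty with rfl | ⟨x, hx⟩
  · exact ⟨0, fun r hr => hr.elim⟩
  set w : ℝ → ℂ := fun r =>
    d₁ r * F r - ((radialExponent m / r + B / 2 * r : ℝ) : ℂ) * F r * d r with hw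
  have hwd : ∀ r ∈ s, HasDerivAt w 0 r := fun r hr => by
    have h1 := hasDerivAt_growingSol_ofReal (B := B) (ν := radialExponent m) (hs0 hr)
    have h2 := hasDerivAt_logDeriv (B := B) (ν := radialExponent m) (hs0 hr)
    refine (((hd₁ r hr).mul h1).sub ((h2.mul h1).mul (hd r hr))).congr_deriv ?_
    have := congrArg (fun x : ℝ => (x : ℂ)) (riccati (B := B) i m (hs0 hr))
    simp only [Pi.mul_apply]
    push_cast at this ⊢
    linear_combination (-(d r) * growingSol B (radialExponent m) r) * this
  refine ⟨w x, fun r hr => ?_⟩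
  rw [eq_of_hasDerivAt_zero hs hs' hwd hx hr]
  refine ((hd r hr).mul (hasDerivAt_inv_growingSol (B := B) (ν := radialExponent m)
    (hs0 hr))).congr_deriv ?_
  have hp : (F r : ℂ) ≠ 0 := by exact_mod_cast (growingSol_pos (hs0 hr)).ne'
  simp only [hw, ← hF]
  push_cast
  field_simp
  ring

theorem rpow_le_growingSol (hB : 0 < B) {r : ℝ} (hr : 0 < r) : r ^ ν ≤ growingSol B ν r :=
  le_mul_of_one_le_right (Real.rpow_nonneg hr.le _) (Real.one_le_exp (by positivity))

theorem growingSol_le_rpow (hB : 0 < B) {r R : ℝ} (hr : 0 < r) (hrR : r ≤ R) :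
    growingSol B ν r ≤ Real.exp (B * R ^ 2 / 4) * r ^ ν := by
  rw [mul_comm, growingSol]
  refine mul_le_mul_of_nonneg_left (Real.exp_le_exp.2 ?_) (Real.rpow_nonneg hr.le _)
  gcongr

theorem not_memLp_inv_sqrt {ε : ℝ} (hε : 0 < ε) :
    ¬ MemLp (fun r : ℝ => ((r ^ (-(1 / 2) : ℝ) : ℝ) : ℂ)) 2 (volume.restrict (Ioo 0 ε)) := by
  intro h
  have h1 := h.integrable_norm_pow (by norm_num)
  have h2 : IntegrableOn (fun r : ℝ => r ^ (-1 : ℝ)) (Ioo 0 ε) := by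
    refine (integrable_congr ?_).1 h1
    filter_upwards [ae_restrict_mem measurableSet_Ioo] with r hr
    rw [Complex.norm_real, Real.norm_of_nonneg (Real.rpow_nonneg hr.1.le _)]
    rw [← Real.rpow_natCast, ← Real.rpow_mul hr.1.le]
    norm_num
  rw [intervalIntegral.integrableOn_Ioo_rpow_iff hε] at h2
  exact lt_irrefl _ h2

/-- A homogeneous solution which is square integrable and regular at the origin is a multiple of
`r^ν e^{Br²/4}`. -/
theorem eq_mul_growingSol_of_left (hB : 0 < B) (i : Fin 2) (m : ℤ) {R : ℝ} (hR : 0 < R)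
    {d d₁ : ℝ → ℂ} (hd : ∀ r ∈ Ioo 0 R, HasDerivAt d (d₁ r) r)
    (hd₁ : ∀ r ∈ Ioo 0 R,
      HasDerivAt d₁ (((radialPotential B i m r : ℂ) - refEnergy B i m) * d r) r)
    (hL : MemLp d 2 (volume.restrict (Ioo 0 R))) (ho : OriginCondition m d) :
    ∃ a : ℂ, ∀ r ∈ Ioo 0 R, d r = a * growingSol B (radialExponent m) r := by
  obtain ⟨b, hb⟩ := hasDerivAt_div_growingSol i m isOpen_Ioo isPreconnected_Ioo
    Ioo_subset_Ioi_self hd hd₁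
  have hν := half_le_radialExponent m
  set ν := radialExponent m with hνdef
  set F := growingSol B ν with hF
  have hFp : ∀ r, 0 < r → 0 < F r := fun r hr => growingSol_pos hr
  set y := R / 2 with hy
  have hy0 : 0 < y := by positivity
  have hyR : y < R := by linarith
  -- The second solution enters only through `b`; once `b = 0` the quotient `d/F` is constant.
  suffices hb0 : b = 0 by
    refine ⟨d y * ((F y)⁻¹ : ℝ), fun r hr => ?_⟩
    have := eq_of_hasDerivAt_zero isOpen_Ioo isPreconnected_Ioo
      (fun r hr => (hb r hr).congr_deriv (by rw [hb0, zero_mul])) ⟨hy0, hyR⟩ hr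
    have hp : (F r : ℂ) ≠ 0 := by exact_mod_cast (hFp r hr.1).ne'
    rw [this]
    push_cast
    field_simp
  by_contra hb0
  have hbp : 0 < ‖b‖ := norm_pos_iff.2 hb0
  set I : ℝ → ℝ := fun r => ∫ t in r..y, ((F t)⁻¹) ^ 2 with hI
  have hint : ∀ r s, 0 < r → r ≤ s → IntervalIntegrable (fun t => ((F t)⁻¹) ^ 2) volume r s :=
    fun r s hr hrs => by
      refine ContinuousOn.intervalIntegrable (continuousOn_inv_sq_growingSol.mono ?_)
      rw [uIcc_of_le hrs]
      exact fun t ht => hr.trans_le ht.1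
  obtain ⟨a, ha⟩ : ∃ a : ℂ, a = d y * ((F y)⁻¹ : ℝ) := ⟨_, rfl⟩
  have hform : ∀ r, 0 < r → r ≤ y → d r * ((F r)⁻¹ : ℝ) = a - b * I r := by
    intro r hr hry
    have h1 := intervalIntegral.integral_eq_sub_of_hasDerivAt
      (f := fun r => d r * ((F r)⁻¹ : ℝ)) (a := r) (b := y)
      (fun t ht => by
        rw [uIcc_of_le hry] at ht
        exact hb t ⟨hr.trans_le ht.1, ht.2.trans_lt hyR⟩)
      ((show IntervalIntegrable (fun t => ((((F t)⁻¹) ^ 2 : ℝ) : ℂ)) volume r y from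
        ⟨(hint r y hr hry).1.ofReal, (hint r y hr hry).2.ofReal⟩).const_mul b)
    rw [intervalIntegral.integral_const_mul] at h1
    have h2 : ∫ t in r..y, ((((F t)⁻¹) ^ 2 : ℝ) : ℂ) = I r := intervalIntegral.integral_ofReal
    rw [h2] at h1
    rw [h1, ha]
    ring
  -- Since `b ≠ 0`, growth of `∫ᵣ^y F⁻²` as `r → 0` forces growth of `d/F`.
  have hnorm : ∀ r, 0 < r → r ≤ y → ‖b‖ * I r ≤ ‖a‖ + ‖d r‖ * (F r)⁻¹ := by
    intro r hr hry
    have hI0 : 0 ≤ I r := intervalIntegral.integral_nonneg hry fun t _ => by positivity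
    have e : b * I r = a - d r * ((F r)⁻¹ : ℝ) := by rw [hform r hr hry]; ring
    calc ‖b‖ * I r = ‖b * I r‖ := by rw [norm_mul, Complex.norm_real, Real.norm_of_nonneg hI0]
      _ ≤ ‖a‖ + ‖d r * ((F r)⁻¹ : ℝ)‖ := by rw [e]; exact norm_sub_le _ _
      _ = ‖a‖ + ‖d r‖ * (F r)⁻¹ := by
        rw [norm_mul, Complex.norm_real, Real.norm_of_nonneg (inv_pos.2 (hFp r hr)).le]
  set C := Real.exp (B * R ^ 2 / 4) with hC
  have hCp : 0 < C := Real.exp_pos _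
  have hFle : ∀ r, 0 < r → r ≤ R → F r ≤ C * r ^ ν := fun r hr hrR =>
    growingSol_le_rpow hB hr hrR
  have hFge : ∀ r, 0 < r → r ^ ν ≤ F r := fun r hr => rpow_le_growingSol hB hr
  -- For `m = 0`, `F²` is comparable to `t`, so `d` is at least of order `√r |log r|`, against the
  -- origin condition. For `m ≠ 0`, `d` is at least of order `r^{1-ν}` with `ν ≥ 3/2`, so it is not
  -- square integrable at the origin.
  by_cases hm : m = 0
  · have hν0 : ν = 1 / 2 := by simp [hνdef, radialExponent, hm]
    have hIlog : ∀ r, 0 < r → r ≤ y → C⁻¹ ^ 2 * (Real.log y - Real.log r) ≤ I r := by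
      intro r hr hry
      have h1 : ∫ t in r..y, C⁻¹ ^ 2 * t⁻¹ = C⁻¹ ^ 2 * (Real.log y - Real.log r) := by
        rw [intervalIntegral.integral_const_mul, integral_inv_of_pos hr hy0,
          Real.log_div hy0.ne' hr.ne']
      rw [← h1]
      refine intervalIntegral.integral_mono_on hry ?_ (hint r y hr hry) fun t ht => ?_
      · refine ContinuousOn.intervalIntegrable ?_
        rw [uIcc_of_le hry]
        exact continuousOn_const.mul (continuousOn_id.inv₀ fun t ht => (hr.trans_le ht.1).ne')
      · have ht0 : 0 < t := hr.trans_le ht.1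
        have h2 := hFle t ht0 (ht.2.trans hyR.le)
        rw [hν0, ← Real.sqrt_eq_rpow] at h2
        have h3 : C⁻¹ ^ 2 * t⁻¹ = ((C * √t)⁻¹) ^ 2 := by
          rw [mul_inv, mul_pow, inv_pow (√t), Real.sq_sqrt ht0.le]
        rw [h3]
        exact pow_le_pow_left₀ (by positivity) (inv_anti₀ (hFp t ht0) h2) 2
    set c := ‖b‖ * C⁻¹ ^ 2 with hc
    have hcp : 0 < c := by positivity
    have hlim := (ho hm).norm
    rw [norm_zero] at hlim
    -- The bound on `log r` is chosen so that `(c/2)(-log r)` exceeds `‖a‖ + c |log y|`, while the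
    -- inequalities for `d` give the opposite. An eventually false statement contradicts
    -- nontriviality of the filter.
    have hev : ∀ᶠ r in 𝓝[>] (0 : ℝ), False := by
      filter_upwards [hlim.eventually_lt_const (half_pos hcp),
        Ioo_mem_nhdsGT (lt_min hy0 one_pos),
        Real.tendsto_log_nhdsGT_zero.eventually_lt_atBot
          (-(2 * (‖a‖ + c * |Real.log y|) / c))] with r h1 h2 h3
      have hr : 0 < r := h2.1
      have hry : r ≤ y := (h2.2.trans_le (min_le_left _ _)).le
      have hr1 : r < 1 := h2.2.trans_le (min_le_right _ _)
      have hlogneg : Real.log r < 0 := Real.log_neg hr hr1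
      have hsq : 0 < √r := Real.sqrt_pos.2 hr
      rw [norm_div, Complex.norm_real, norm_mul, Real.norm_of_nonneg hsq.le, Real.norm_eq_abs,
        abs_of_neg hlogneg, div_lt_iff₀ (mul_pos hsq (neg_pos.2 hlogneg))] at h1
      have h4 := hnorm r hr hry
      have h5 : ‖d r‖ * (F r)⁻¹ ≤ c / 2 * (-Real.log r) := by
        rw [← div_eq_mul_inv, div_le_iff₀ (hFp r hr)]
        have h6 := hFge r hr
        rw [hν0, ← Real.sqrt_eq_rpow] at h6
        have h7 : c / 2 * (√r * -Real.log r) ≤ c / 2 * -Real.log r * F r := by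
          have : 0 ≤ c / 2 * -Real.log r := by
            have := neg_pos.2 hlogneg
            positivity
          nlinarith
        linarith
      have h8 : c * (Real.log y - Real.log r) ≤ ‖b‖ * I r := by
        rw [hc, mul_assoc]
        exact mul_le_mul_of_nonneg_left (hIlog r hr hry) hbp.le
      rw [lt_neg, div_lt_iff₀ hcp] at h3
      have h9 : -(c * |Real.log y|) ≤ c * Real.log y := by
        have := neg_abs_le (Real.log y)
        nlinarith
      nlinarith
    exact (hev.exists).elim fun _ h => h
  · have hm1 : (1 : ℝ) ≤ (|m| : ℤ) := by exact_mod_cast Int.one_le_abs hm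
    -- The bound `y / 2` keeps `[r, 2r]` inside `(0, y]`; the bound `1` gives `r^ν ≤ 1` and
    -- `r^{-1/2} ≤ r^{1-ν}`.
    set ε := min (y / 2) 1 with hε
    have hεp : 0 < ε := lt_min (by positivity) one_pos
    -- Only the part of the integral over `[r, 2r]` is kept; there `F` is at most `F(2r)`.
    have hIge : ∀ r, 0 < r → r ≤ y / 2 → r * ((F (2 * r))⁻¹) ^ 2 ≤ I r := by
      intro r hr hry
      have h2r : 2 * r ≤ y := by linarith
      have h1 : I r = (∫ t in r..(2 * r), ((F t)⁻¹) ^ 2) + ∫ t in (2 * r)..y, ((F t)⁻¹) ^ 2 :=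
        (intervalIntegral.integral_add_adjacent_intervals (hint _ _ hr (by linarith))
          (hint _ _ (by linarith) h2r)).symm
      have h2 : 0 ≤ ∫ t in (2 * r)..y, ((F t)⁻¹) ^ 2 :=
        intervalIntegral.integral_nonneg h2r fun t _ => by positivity
      have h3 : ∫ t in r..(2 * r), ((F (2 * r))⁻¹) ^ 2 ≤ ∫ t in r..(2 * r), ((F t)⁻¹) ^ 2 := by
        refine intervalIntegral.integral_mono_on (by linarith) (by simp)
          (hint _ _ hr (by linarith)) fun t ht => ?_
        have ht0 : 0 < t := hr.trans_le ht.1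
        exact pow_le_pow_left₀ (inv_pos.2 (hFp _ (by linarith))).le
          (inv_anti₀ (hFp t ht0) (growingSol_mono hB hν ht0 ht.2)) 2
      rw [intervalIntegral.integral_const, smul_eq_mul] at h3
      linarith
    set c := ‖b‖ * (C * 2 ^ ν)⁻¹ ^ 2 with hc
    have h2ν : (0 : ℝ) < 2 ^ ν := Real.rpow_pos_of_pos two_pos _
    have hcp : 0 < c := by positivity
    have key : ∀ r ∈ Ioo 0 ε, c * r ^ (-(1 / 2) : ℝ) ≤ ‖a‖ * C + ‖d r‖ := by
      intro r hr
      have hr0 : 0 < r := hr.1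
      have hry : r ≤ y / 2 := (hr.2.trans_le (min_le_left _ _)).le
      have hr1 : r ≤ 1 := (hr.2.trans_le (min_le_right _ _)).le
      have hrν : 0 < r ^ ν := Real.rpow_pos_of_pos hr0 _
      have h1 := hnorm r hr0 (by linarith)
      have h2 := hIge r hr0 hry
      have h3 : F (2 * r) ≤ C * 2 ^ ν * r ^ ν := by
        have := hFle (2 * r) (by linarith) (by linarith)
        rwa [Real.mul_rpow two_pos.le hr0.le, ← mul_assoc] at this
      have h4 : ((C * 2 ^ ν * r ^ ν)⁻¹) ^ 2 ≤ ((F (2 * r))⁻¹) ^ 2 :=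
        pow_le_pow_left₀ (by positivity) (inv_anti₀ (hFp _ (by linarith)) h3) 2
      have h5 : c * (r * (r ^ ν)⁻¹ ^ 2) ≤ ‖b‖ * I r := by
        have e : c * (r * (r ^ ν)⁻¹ ^ 2) = ‖b‖ * (r * ((C * 2 ^ ν * r ^ ν)⁻¹) ^ 2) := by
          rw [hc, mul_inv (C * 2 ^ ν)]
          ring
        rw [e]
        refine mul_le_mul_of_nonneg_left (le_trans ?_ h2) hbp.le
        exact mul_le_mul_of_nonneg_left h4 hr0.le
      have h6 : c * (r * (r ^ ν)⁻¹ ^ 2) * F r ≤ ‖a‖ * F r + ‖d r‖ := by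
        have := mul_le_mul_of_nonneg_right (h5.trans h1) (hFp r hr0).le
        rw [add_mul, mul_assoc ‖d r‖, inv_mul_cancel₀ (hFp r hr0).ne', mul_one] at this
        exact this
      have h7 : c * (r * (r ^ ν)⁻¹) ≤ c * (r * (r ^ ν)⁻¹ ^ 2) * F r := by
        have := mul_le_mul_of_nonneg_left (hFge r hr0)
          (show 0 ≤ c * (r * (r ^ ν)⁻¹ ^ 2) by positivity)
        refine le_trans (le_of_eq ?_) this
        field_simp
      have h8 : c * r ^ (-(1 / 2) : ℝ) ≤ c * (r * (r ^ ν)⁻¹) := by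
        refine mul_le_mul_of_nonneg_left ?_ hcp.le
        have e : r * (r ^ ν)⁻¹ = r ^ (1 - ν) := by
          rw [Real.rpow_sub hr0, Real.rpow_one, div_eq_mul_inv]
        rw [e]
        refine Real.rpow_le_rpow_of_exponent_ge hr0 hr1 ?_
        rw [hνdef, radialExponent]
        linarith
      have h9 : ‖a‖ * F r ≤ ‖a‖ * C := by
        refine mul_le_mul_of_nonneg_left ((hFle r hr0 (by linarith)).trans ?_) (norm_nonneg _)
        exact mul_le_of_le_one_right hCp.le (Real.rpow_le_one hr0.le hr1 (by linarith))
      linarith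
    refine not_memLp_inv_sqrt hεp ?_
    have hεR : ε ≤ R := (min_le_left _ _).trans (by linarith)
    have hL' := (hL.mono_measure (Measure.restrict_mono (Ioo_subset_Ioo_right hεR) le_rfl)).norm
    have hL2 := ((memLp_const (‖a‖ * C) : MemLp _ 2 (volume.restrict (Ioo 0 ε))).add
      hL').const_mul c⁻¹
    refine hL2.of_le (Measurable.aestronglyMeasurable (by fun_prop)) ?_
    filter_upwards [ae_restrict_mem measurableSet_Ioo] with r hr
    rw [Complex.norm_real, Real.norm_of_nonneg (Real.rpow_nonneg hr.1.le _)]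
    refine le_trans ?_ (le_abs_self _)
    rw [inv_mul_eq_div, le_div_iff₀ hcp, mul_comm]
    exact key r hr

end HomogeneousSolutions

/-! ### The function `χ` spanning the defect at `R`, and regularity of the reference resolvent. -/

section DeficiencyElement

variable {B ν R : ℝ}

/-! ### The deficiency element at the reference energy -/

/-- `1_{t > R} / F(t)`. -/
def cutInv (B ν R t : ℝ) : ℂ := if R < t then (((growingSol B ν t)⁻¹ : ℝ) : ℂ) else 0

/-- The Green function at the reference energy, with one variable equal to `R`. -/
def refChi (B ν R r : ℝ) : ℂ := growingSol B ν R * upperOp B ν (cutInv B ν R) r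

theorem memLp_cutInv (hB : 0 < B) (hν : 1 / 2 ≤ ν) (hR : 0 < R) :
    MemLp (cutInv B ν R) 2 μ₊ := by
  have h : cutInv B ν R = (Ioi R).indicator fun t => (((growingSol B ν t)⁻¹ : ℝ) : ℂ) := by
    ext t; simp [cutInv, indicator]
  rw [h, memLp_indicator_iff_restrict measurableSet_Ioi,
    Measure.restrict_restrict measurableSet_Ioi, inter_eq_left.2 (Ioi_subset_Ioi hR.le)]
  exact memLp_inv_growingSol hB hν hR

/-- Both `0` and `1/F` solve `v' + w v = 0`. The leading `0` in the density is the vanishing source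
term `g` of `isH2Loc_upperOp`. -/
theorem hasDens_cutInv : HasDens (Ioi 0 \ {R}) (cutInv B ν R)
    (fun t => (0 : ℂ) - ((ν / t + B / 2 * t : ℝ) : ℂ) * cutInv B ν R t) := by
  have hopen : IsOpen (Ioi (0 : ℝ) \ {R}) := isOpen_Ioi.sdiff isClosed_singleton
  have hd : ∀ t ∈ Ioi (0 : ℝ) \ {R}, HasDerivAt (cutInv B ν R)
      ((0 : ℂ) - ((ν / t + B / 2 * t : ℝ) : ℂ) * cutInv B ν R t) t := by
    rintro t ⟨ht, htR⟩
    rcases lt_or_gt_of_ne htR with h | h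
    · have h1 : cutInv B ν R =ᶠ[𝓝 t] fun _ => 0 := by
        filter_upwards [Iio_mem_nhds h] with s hs
        rw [cutInv, if_neg (not_lt.2 (le_of_lt hs))]
      refine ((hasDerivAt_const t (0 : ℂ)).congr_of_eventuallyEq h1).congr_deriv ?_
      rw [h1.eq_of_nhds]
      simp
    · have h1 : cutInv B ν R =ᶠ[𝓝 t] fun t => (((growingSol B ν t)⁻¹ : ℝ) : ℂ) := by
        filter_upwards [Ioi_mem_nhds h] with s hs
        rw [cutInv, if_pos (mem_Ioi.1 hs)]
      refine ((hasDerivAt_inv_growingSol ht).congr_of_eventuallyEq h1).congr_deriv ?_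
      rw [h1.eq_of_nhds]
      ring
  refine HasDens.of_hasDerivAt hd ?_
  exact continuousOn_const.sub ((continuousOn_logDeriv.mono sdiff_subset).mul
    fun t ht => (hd t ht).continuousAt.continuousWithinAt)

theorem memLp_refChi (hB : 0 < B) (hν : 1 / 2 ≤ ν) (hR : 0 < R) : MemLp (refChi B ν R) 2 μ₊ :=
  (memLp_upperOp hB hν (memLp_cutInv hB hν hR)).const_mul _

theorem conj_refChi (r : ℝ) : conj (refChi B ν R r) = refChi B ν R r := by
  rw [refChi, map_mul, Complex.conj_ofReal, conj_upperOp]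
  congr 2
  ext t
  rw [cutInv]
  split_ifs <;> simp

/-- Pairing with `χ` evaluates `S g` at `R`: transposing moves the operator onto `g`, and the
cut-off restricts the integral to `t > R`, which is `upperOp` at `R`. -/
theorem integral_refChi_mul (hB : 0 < B) (hν : 1 / 2 ≤ ν) (hR : 0 < R) {g : ℝ → ℂ}
    (hg : MemLp g 2 μ₊) : ∫ r, refChi B ν R r * g r ∂μ₊ = refGreen B ν g R := by
  have h := integral_mul_lowerOp hB hν hg (memLp_cutInv hB hν hR)
  simp only [refChi, mul_assoc]
  rw [integral_const_mul, ← h, refGreen, upperOp_eq hR]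
  congr 1
  rw [← integral_indicator measurableSet_Ioi, ← integral_indicator measurableSet_Ioi]
  congr 1
  ext t
  by_cases h1 : R < t
  · rw [indicator_of_mem (show t ∈ Ioi 0 from hR.trans h1),
      indicator_of_mem (show t ∈ Ioi R from h1),
      cutInv, if_pos h1]
  · rw [indicator_of_notMem (show t ∉ Ioi R from h1), indicator]
    simp [cutInv, h1]

/-- `refGreen` has the form `AᵀA` with a real kernel, so transposing twice gives symmetry. -/
theorem integral_conj_refGreen_mul (hB : 0 < B) (hν : 1 / 2 ≤ ν) {f g : ℝ → ℂ}
    (hf : MemLp f 2 μ₊) (hg : MemLp g 2 μ₊) :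
    ∫ r, conj (refGreen B ν f r) * g r ∂μ₊ = ∫ r, conj (f r) * refGreen B ν g r ∂μ₊ := by
  have hf' : MemLp (fun r => conj (f r)) 2 μ₊ := hf.star
  simp only [refGreen, conj_upperOp, conj_lowerOp]
  rw [← integral_mul_lowerOp hB hν hg (memLp_lowerOp hB hν hf')]
  have := integral_mul_lowerOp hB hν hf' (memLp_lowerOp hB hν hg)
  simp only [mul_comm] at this ⊢
  exact this

theorem refChi_of_le {r : ℝ} (hr : 0 < r) (hrR : r ≤ R) :
    refChi B ν R r = growingSol B ν R * (∫ t in Ioi R, (((growingSol B ν t)⁻¹ ^ 2 : ℝ) : ℂ)) *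
      growingSol B ν r := by
  rw [refChi, upperOp_eq hr]
  have : ∫ t in Ioi r, (((growingSol B ν t)⁻¹ : ℝ) : ℂ) * cutInv B ν R t =
      ∫ t in Ioi R, (((growingSol B ν t)⁻¹ ^ 2 : ℝ) : ℂ) := by
    rw [← integral_indicator measurableSet_Ioi, ← integral_indicator measurableSet_Ioi]
    congr 1
    ext t
    by_cases h1 : R < t
    · rw [indicator_of_mem (show t ∈ Ioi r from hrR.trans_lt h1),
        indicator_of_mem (show t ∈ Ioi R from h1), cutInv, if_pos h1]
      push_cast
      ring
    · rw [indicator_of_notMem (show t ∉ Ioi R from h1), indicator]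
      simp [cutInv, h1]
  rw [this]
  ring

theorem refChi_of_ge (hR : 0 < R) {r : ℝ} (hrR : R ≤ r) :
    refChi B ν R r = growingSol B ν R * (∫ t in Ioi r, (((growingSol B ν t)⁻¹ ^ 2 : ℝ) : ℂ)) *
      growingSol B ν r := by
  rw [refChi, upperOp_eq (hR.trans_le hrR)]
  have : ∫ t in Ioi r, (((growingSol B ν t)⁻¹ : ℝ) : ℂ) * cutInv B ν R t =
      ∫ t in Ioi r, (((growingSol B ν t)⁻¹ ^ 2 : ℝ) : ℂ) := by
    refine setIntegral_congr_fun measurableSet_Ioi fun t ht => ?_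
    have h1 : R < t := hrR.trans_lt ht
    simp only [cutInv, if_pos h1]
    push_cast
    ring
  rw [this]
  ring

theorem integrableOn_inv_sq (hB : 0 < B) (hν : 1 / 2 ≤ ν) {r : ℝ} (hr : 0 < r) :
    IntegrableOn (fun t => (growingSol B ν t)⁻¹ ^ 2) (Ioi r) := by
  have := (memLp_inv_growingSol (B := B) hB hν hr).integrable_norm_pow (by norm_num)
  refine (integrable_congr (ae_of_all _ fun t => ?_)).1 this
  simp [Complex.norm_real]

theorem integral_inv_sq_pos (hB : 0 < B) (hν : 1 / 2 ≤ ν) {r : ℝ} (hr : 0 < r) :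
    0 < ∫ t in Ioi r, (growingSol B ν t)⁻¹ ^ 2 := by
  rw [setIntegral_pos_iff_support_of_nonneg_ae (ae_of_all _ fun t => sq_nonneg _)
    (integrableOn_inv_sq hB hν hr)]
  have : Ioi r ⊆ Function.support fun t => (growingSol B ν t)⁻¹ ^ 2 := fun t ht =>
    pow_ne_zero 2 (inv_ne_zero (growingSol_pos (hr.trans ht)).ne')
  rw [inter_eq_right.2 this]
  simp

theorem integral_inv_sq_ofReal (r : ℝ) :
    ∫ t in Ioi r, (((growingSol B ν t)⁻¹ ^ 2 : ℝ) : ℂ) =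
      ((∫ t in Ioi r, (growingSol B ν t)⁻¹ ^ 2 : ℝ) : ℂ) := integral_ofReal

theorem refChi_self_ne_zero (hB : 0 < B) (hν : 1 / 2 ≤ ν) (hR : 0 < R) : refChi B ν R R ≠ 0 := by
  rw [refChi_of_le hR le_rfl, integral_inv_sq_ofReal]
  have h1 := (growingSol_pos (B := B) (ν := ν) hR).ne'
  have h2 := (integral_inv_sq_pos hB hν hR).ne'
  exact mul_ne_zero (mul_ne_zero (by exact_mod_cast h1) (by exact_mod_cast h2))
    (by exact_mod_cast h1)

theorem hasDerivAt_tail_inv_sq (hB : 0 < B) (hν : 1 / 2 ≤ ν) {r : ℝ} (hr : 0 < r) :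
    HasDerivAt (fun r => ((∫ t in Ioi r, (growingSol B ν t)⁻¹ ^ 2 : ℝ) : ℂ))
      (-(((growingSol B ν r)⁻¹ ^ 2 : ℝ) : ℂ)) r := by
  suffices h : HasDerivAt (fun r => ∫ t in Ioi r, (growingSol B ν t)⁻¹ ^ 2)
      (-((growingSol B ν r)⁻¹ ^ 2)) r from h.ofReal_comp.congr_deriv (by push_cast; ring)
  have hr2 : 0 < r / 2 := by positivity
  have hi : ∀ s, 0 < s → IntegrableOn (fun t => (growingSol B ν t)⁻¹ ^ 2) (Ioi s) := fun s hs =>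
    integrableOn_inv_sq hB hν hs
  have h1 : HasDerivAt (fun s => (∫ t in Ioi (r / 2), (growingSol B ν t)⁻¹ ^ 2) -
      ∫ t in (r / 2)..s, (growingSol B ν t)⁻¹ ^ 2) (-((growingSol B ν r)⁻¹ ^ 2)) r := by
    refine HasDerivAt.const_sub _ ?_
    refine intervalIntegral.integral_hasDerivAt_right ?_ ?_ ?_
    · rw [intervalIntegrable_iff_integrableOn_Ioc_of_le (by linarith)]
      exact (hi _ hr2).mono_set Ioc_subset_Ioi_self
    · exact ContinuousOn.stronglyMeasurableAtFilter isOpen_Ioi continuousOn_inv_sq_growingSol r hr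
    · exact continuousOn_inv_sq_growingSol.continuousAt (Ioi_mem_nhds hr)
  refine h1.congr_of_eventuallyEq ?_
  filter_upwards [Ioi_mem_nhds hr] with s hs
  rw [← intervalIntegral.integral_interval_add_Ioi (hi _ hr2) (hi s hs)]
  ring

/-- By monotonicity `|a| F(r) ≥ |a| F(R)`, and a nonzero constant is not square integrable on a ray.
-/
theorem not_memLp_growingSol (hB : 0 < B) (hν : 1 / 2 ≤ ν) (hR : 0 < R) {a : ℂ}
    (h : MemLp (fun r => a * growingSol B ν r) 2 (volume.restrict (Ioi R))) : a = 0 := by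
  by_contra ha
  have h1 : MemLp (fun _ : ℝ => a * growingSol B ν R) 2 (volume.restrict (Ioi R)) := by
    refine h.of_le aestronglyMeasurable_const ?_
    filter_upwards [ae_restrict_mem measurableSet_Ioi] with r hr
    have hr' : R < r := hr
    rw [norm_mul, norm_mul, Complex.norm_real, Complex.norm_real,
      Real.norm_of_nonneg (growingSol_pos hR).le,
      Real.norm_of_nonneg (growingSol_pos (hR.trans hr')).le]
    exact mul_le_mul_of_nonneg_left (growingSol_mono hB hν hR hr'.le) (norm_nonneg _)
  rw [memLp_const_iff (by norm_num) (by norm_num)] at h1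
  have h2 := (growingSol_pos (B := B) (ν := ν) hR).ne'
  simp [ha, h2] at h1

/-- A homogeneous solution which is square integrable at infinity is a multiple of `refChi`. -/
theorem eq_mul_refChi_of_right (hB : 0 < B) (i : Fin 2) (m : ℤ) (hR : 0 < R)
    {d d₁ : ℝ → ℂ} (hd : ∀ r ∈ Ioi R, HasDerivAt d (d₁ r) r)
    (hd₁ : ∀ r ∈ Ioi R,
      HasDerivAt d₁ (((radialPotential B i m r : ℂ) - refEnergy B i m) * d r) r)
    (hL : MemLp d 2 (volume.restrict (Ioi R))) :
    ∃ a : ℂ, ∀ r ∈ Ioi R, d r = a * refChi B (radialExponent m) R r := by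
  have hν := half_le_radialExponent m
  have hsub : Ioi R ⊆ Ioi 0 := Ioi_subset_Ioi hR.le
  obtain ⟨b, hb⟩ := hasDerivAt_div_growingSol i m isOpen_Ioi isPreconnected_Ioi hsub hd hd₁
  set F := growingSol B (radialExponent m) with hF
  have hFR : (F R : ℂ) ≠ 0 := by exact_mod_cast (growingSol_pos hR).ne'
  -- The derivative of the tail `∫ᵣ^∞ F⁻²` cancels `(d/F)'`. The constant so obtained is the
  -- coefficient of the growing solution, which square integrability will kill; it is read off at
  -- the arbitrary point `R + 1`.
  have hc : ∀ r ∈ Ioi R, HasDerivAt (fun r => d r * ((F r)⁻¹ : ℝ) +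
      b * ((∫ t in Ioi r, (F t)⁻¹ ^ 2 : ℝ) : ℂ)) 0 r := fun r hr =>
    ((hb r hr).add ((hasDerivAt_tail_inv_sq hB hν (hsub hr)).const_mul b)).congr_deriv (by ring)
  set a : ℂ := d (R + 1) * ((F (R + 1))⁻¹ : ℝ) +
      b * ((∫ t in Ioi (R + 1), (F t)⁻¹ ^ 2 : ℝ) : ℂ) with ha
  have h1 : ∀ r ∈ Ioi R, d r = a * F r - b * (F R : ℂ)⁻¹ * refChi B (radialExponent m) R r := by
    intro r hr
    have := eq_of_hasDerivAt_zero isOpen_Ioi isPreconnected_Ioi hc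
      (show R + 1 ∈ Ioi R from lt_add_one R) hr
    have hFr : (F r : ℂ) ≠ 0 := by exact_mod_cast (growingSol_pos (hsub hr)).ne'
    rw [refChi_of_ge hR (le_of_lt hr), integral_inv_sq_ofReal, ha, this, ← hF]
    push_cast
    field_simp
    ring
  have h2 : a = 0 := by
    refine not_memLp_growingSol (B := B) (ν := radialExponent m) hB hν hR ?_
    have h3 := ((memLp_refChi hB hν hR).mono_measure
      (Measure.restrict_mono hsub le_rfl)).const_mul (b * (F R : ℂ)⁻¹)
    refine (memLp_congr_ae ?_).1 (hL.add h3)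
    filter_upwards [ae_restrict_mem measurableSet_Ioi] with r hr
    rw [Pi.add_apply, h1 r hr]
    ring
  refine ⟨-(b * (F R : ℂ)⁻¹), fun r hr => ?_⟩
  rw [h1 r hr, h2]
  ring

/-! ### The reference resolvent maps into the domain -/

theorem bound_upperOp_of_integrable {h : ℝ → ℂ}
    (hi : IntegrableOn (fun t => (((growingSol B (1 / 2) t)⁻¹ : ℝ) : ℂ) * h t) (Ioi 0))
    (hB : 0 < B) :
    ∃ C : ℝ, ∀ᶠ r in 𝓝[>] (0 : ℝ), ‖upperOp B (1 / 2) h r‖ ≤ C * √r := by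
  refine ⟨Real.exp (B * 1 ^ 2 / 4) * ∫ t in Ioi (0 : ℝ),
    ‖(((growingSol B (1 / 2) t)⁻¹ : ℝ) : ℂ) * h t‖, ?_⟩
  filter_upwards [Ioo_mem_nhdsGT one_pos] with r hr
  rw [upperOp_eq hr.1, norm_mul, Complex.norm_real, Real.norm_of_nonneg (growingSol_pos hr.1).le]
  have h1 := growingSol_le_rpow (ν := 1 / 2) hB hr.1 hr.2.le
  rw [← Real.sqrt_eq_rpow] at h1
  have h2 : ‖∫ t in Ioi r, (((growingSol B (1 / 2) t)⁻¹ : ℝ) : ℂ) * h t‖ ≤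
      ∫ t in Ioi (0 : ℝ), ‖(((growingSol B (1 / 2) t)⁻¹ : ℝ) : ℂ) * h t‖ :=
    (norm_integral_le_integral_norm _).trans (setIntegral_mono_set hi.norm
      (ae_of_all _ fun _ => norm_nonneg _) (Ioi_subset_Ioi hr.1.le).eventuallyLE)
  calc _ ≤ (Real.exp (B * 1 ^ 2 / 4) * √r) * ∫ t in Ioi (0 : ℝ),
        ‖(((growingSol B (1 / 2) t)⁻¹ : ℝ) : ℂ) * h t‖ :=
        mul_le_mul h1 h2 (norm_nonneg _) (by positivity)
    _ = _ := by ring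

theorem originCondition_refChi (hB : 0 < B) (hR : 0 < R) (m : ℤ) :
    OriginCondition m (refChi B (radialExponent m) R) := by
  refine originCondition_of_bound fun hm => ?_
  have hν : radialExponent m = 1 / 2 := by simp [radialExponent, hm]
  rw [hν]
  obtain ⟨C, hC⟩ := bound_upperOp_of_integrable (B := B) (h := cutInv B (1 / 2) R) (by
    have h1 : (fun t => (((growingSol B (1 / 2) t)⁻¹ : ℝ) : ℂ) * cutInv B (1 / 2) R t) =
        (Ioi R).indicator fun t => (((growingSol B (1 / 2) t)⁻¹ ^ 2 : ℝ) : ℂ) := by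
      ext t
      rw [cutInv, indicator]
      simp only [mem_Ioi]
      split_ifs
      · push_cast; ring
      · simp
    rw [h1]
    have h2 : IntegrableOn (fun t => (((growingSol B (1 / 2) t)⁻¹ ^ 2 : ℝ) : ℂ)) (Ioi R) :=
      (integrableOn_inv_sq hB le_rfl hR).ofReal
    exact (h2.integrable_indicator measurableSet_Ioi).integrableOn) hB
  refine ⟨‖(growingSol B (1 / 2) R : ℂ)‖ * C, ?_⟩
  filter_upwards [hC] with r hr
  rw [refChi, norm_mul, mul_assoc]
  exact mul_le_mul_of_nonneg_left hr (norm_nonneg _)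

/-- For `m = 0`, monotonicity of `F` bounds `lowerOp g` on `(0,1]` by `∫₀¹ |g|`, and `F⁻¹ ≤
t^{-1/2}` is integrable at `0`. Hence the integral in `upperOp` stays bounded and the prefactor
`F(r)` supplies `√r`. -/
theorem originCondition_refGreen (hB : 0 < B) (m : ℤ) {g : ℝ → ℂ} (hg : MemLp g 2 μ₊) :
    OriginCondition m (refGreen B (radialExponent m) g) := by
  refine originCondition_of_bound fun hm => ?_
  have hν : radialExponent m = 1 / 2 := by simp [radialExponent, hm]
  rw [hν]
  refine bound_upperOp_of_integrable ?_ hB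
  have hv := memLp_lowerOp (B := B) (ν := 1 / 2) hB le_rfl hg
  rw [← Ioc_union_Ioi_eq_Ioi (zero_le_one (α := ℝ))]
  refine IntegrableOn.union ?_ (integrableOn_inv_mul hB le_rfl one_pos hv)
  have hg1 : IntegrableOn g (Ioc 0 1) :=
    (hg.mono_measure (Measure.restrict_mono Ioc_subset_Ioi_self le_rfl)).integrable (by norm_num)
  have hsing : IntegrableOn (fun t : ℝ => t ^ (-(1 / 2) : ℝ)) (Ioc 0 1) := by
    rw [← intervalIntegrable_iff_integrableOn_Ioc_of_le zero_le_one]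
    exact intervalIntegral.intervalIntegrable_rpow' (by norm_num)
  refine (hsing.mul_const (∫ s in Ioc (0 : ℝ) 1, ‖g s‖)).mono' ?_ ?_
  · refine (Measurable.aestronglyMeasurable ?_).mul
      (hv.1.mono_measure (Measure.restrict_mono Ioc_subset_Ioi_self le_rfl))
    exact Complex.measurable_ofReal.comp measurable_growingSol.inv
  filter_upwards [ae_restrict_mem measurableSet_Ioc] with t ht
  have hF := growingSol_pos (B := B) (ν := 1 / 2) ht.1
  rw [norm_mul, Complex.norm_real, Real.norm_of_nonneg (inv_pos.2 hF).le]
  have hF1 := rpow_le_growingSol (ν := 1 / 2) hB ht.1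
  refine mul_le_mul ?_ ?_ (norm_nonneg _) (Real.rpow_nonneg ht.1.le _)
  · rw [Real.rpow_neg ht.1.le]
    exact inv_anti₀ (Real.rpow_pos_of_pos ht.1 _) hF1
  · rw [lowerOp_eq ht.1, norm_mul, Complex.norm_real, Real.norm_of_nonneg (inv_pos.2 hF).le,
      inv_mul_le_iff₀ hF, intervalIntegral.integral_of_le ht.1.le]
    have hsub : Ioc 0 t ⊆ Ioc 0 1 := Ioc_subset_Ioc_right ht.2
    calc _ ≤ ∫ s in Ioc 0 t, growingSol B (1 / 2) t * ‖g s‖ := by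
          refine norm_integral_le_of_norm_le ((hg1.mono_set hsub).norm.const_mul _) ?_
          filter_upwards [ae_restrict_mem measurableSet_Ioc] with s hs
          rw [norm_mul, Complex.norm_real, Real.norm_of_nonneg (growingSol_pos hs.1).le]
          exact mul_le_mul_of_nonneg_right (growingSol_mono hB le_rfl hs.1 hs.2) (norm_nonneg _)
      _ = growingSol B (1 / 2) t * ∫ s in Ioc 0 t, ‖g s‖ := integral_const_mul _ _
      _ ≤ _ := mul_le_mul_of_nonneg_left (setIntegral_mono_set hg1.norm
          (ae_of_all _ fun _ => norm_nonneg _) hsub.eventuallyLE) hF.le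

end DeficiencyElement

/-! ### Krein parametrization of the channel graph, and self-adjointness. -/

section SelfAdjointness

variable {B ν R : ℝ}

/-! ### The channel graph in terms of the reference resolvent -/

theorem IsH2Loc.mono {Ω Ω' : Set ℝ} {u u₁ u₂ : ℝ → ℂ} (h : IsH2Loc Ω u u₁ u₂) (hs : Ω' ⊆ Ω) :
    IsH2Loc Ω' u u₁ u₂ :=
  ⟨fun r hr => h.hasDerivAt r (hs hr), fun x y hxy hi => h.memLp x y hxy (hi.trans hs),
    fun x y hxy hi => h.integral_eq x y hxy (hi.trans hs)⟩

theorem isOpen_punctured : IsOpen (Ioi (0 : ℝ) \ {R}) := isOpen_Ioi.sdiff isClosed_singleton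

theorem ae_mem_punctured : ∀ᵐ r ∂μ₊, r ∈ Ioi (0 : ℝ) \ {R} := by
  have hR : ∀ᵐ r : ℝ, r ≠ R := by simp [ae_iff, measure_singleton]
  rw [ae_restrict_iff' measurableSet_Ioi]
  filter_upwards [hR] with r hr h using ⟨h, hr⟩

theorem punctured_mem_nhdsLT (hR : 0 < R) : Ioi (0 : ℝ) \ {R} ∈ 𝓝[<] R := by
  filter_upwards [Ioo_mem_nhdsLT hR] with r hr using ⟨hr.1, hr.2.ne⟩

theorem punctured_mem_nhdsGT (hR : 0 < R) : Ioi (0 : ℝ) \ {R} ∈ 𝓝[>] R := by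
  filter_upwards [self_mem_nhdsWithin] with r hr using ⟨hR.trans hr, ne_of_gt hr⟩

/-- The derivative of `refGreen B ν g`. -/
def refGreenDeriv (B ν : ℝ) (g : ℝ → ℂ) (r : ℝ) : ℂ :=
  ((ν / r + B / 2 * r : ℝ) : ℂ) * refGreen B ν g r - lowerOp B ν g r

/-- The derivative of `refChi B ν R`. -/
def refChiDeriv (B ν R r : ℝ) : ℂ :=
  ((ν / r + B / 2 * r : ℝ) : ℂ) * refChi B ν R r - growingSol B ν R * cutInv B ν R r

theorem isH2Loc_refGreen (hB : 0 < B) (i : Fin 2) (m : ℤ) {g : ℝ → ℂ} (hg : MemLp g 2 μ₊) :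
    IsH2Loc (Ioi 0) (refGreen B (radialExponent m) g) (refGreenDeriv B (radialExponent m) g)
      (fun r => ((radialPotential B i m r : ℂ) - refEnergy B i m) *
        refGreen B (radialExponent m) g r - g r) :=
  isH2Loc_upperOp hB i m isOpen_Ioi le_rfl
    (memLp_lowerOp hB (half_le_radialExponent m) hg) hg
    (hasDens_lowerOp hB (half_le_radialExponent m) hg)

theorem isH2Loc_refChi (hB : 0 < B) (hR : 0 < R) (i : Fin 2) (m : ℤ) :
    IsH2Loc (Ioi 0 \ {R}) (refChi B (radialExponent m) R) (refChiDeriv B (radialExponent m) R)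
      (fun r => ((radialPotential B i m r : ℂ) - refEnergy B i m) *
        refChi B (radialExponent m) R r) := by
  have h := (isH2Loc_upperOp (g := fun _ => 0) hB i m isOpen_punctured sdiff_subset
    (memLp_cutInv hB (half_le_radialExponent m) hR) MemLp.zero' hasDens_cutInv).smul
      (growingSol B (radialExponent m) R : ℂ)
  convert! h using 1
  · ext r
    simp only [refChiDeriv, refChi, Pi.smul_apply, smul_eq_mul]
    ring
  · ext r
    simp only [refChi, Pi.smul_apply, smul_eq_mul]
    ring

theorem continuousOn_refChi (hB : 0 < B) (hν : 1 / 2 ≤ ν) (hR : 0 < R) :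
    ContinuousOn (refChi B ν R) (Ioi 0) :=
  continuousOn_const.mul ((hasDens_upperOp hB hν (memLp_cutInv hB hν hR)).continuousOn isOpen_Ioi)

theorem tendsto_refChiDeriv_left (hB : 0 < B) (hν : 1 / 2 ≤ ν) (hR : 0 < R) :
    Tendsto (refChiDeriv B ν R) (𝓝[<] R)
      (𝓝 (((ν / R + B / 2 * R : ℝ) : ℂ) * refChi B ν R R)) := by
  have h1 : Tendsto (fun r => ((ν / r + B / 2 * r : ℝ) : ℂ) * refChi B ν R r) (𝓝[<] R)
      (𝓝 (((ν / R + B / 2 * R : ℝ) : ℂ) * refChi B ν R R)) :=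
    ((continuousOn_logDeriv.mul (continuousOn_refChi hB hν hR)).continuousAt
      (Ioi_mem_nhds hR)).tendsto.mono_left nhdsWithin_le_nhds
  refine h1.congr' ?_
  filter_upwards [self_mem_nhdsWithin] with r hr
  rw [refChiDeriv, cutInv, if_neg (not_lt.2 (le_of_lt hr))]
  simp

/-- Crossing `R` switches on the term `F(R)/F(r)` of the cut-off, whose limit is `1`; compared with
the left limit the derivative drops by exactly `1`. -/
theorem tendsto_refChiDeriv_right (hB : 0 < B) (hν : 1 / 2 ≤ ν) (hR : 0 < R) :
    Tendsto (refChiDeriv B ν R) (𝓝[>] R)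
      (𝓝 (((ν / R + B / 2 * R : ℝ) : ℂ) * refChi B ν R R - 1)) := by
  have h1 : Tendsto (fun r => ((ν / r + B / 2 * r : ℝ) : ℂ) * refChi B ν R r -
      growingSol B ν R * (((growingSol B ν r)⁻¹ : ℝ) : ℂ)) (𝓝[>] R)
      (𝓝 (((ν / R + B / 2 * R : ℝ) : ℂ) * refChi B ν R R -
        growingSol B ν R * (((growingSol B ν R)⁻¹ : ℝ) : ℂ))) :=
    (((continuousOn_logDeriv.mul (continuousOn_refChi hB hν hR)).sub
      (continuousOn_const.mul continuousOn_inv_growingSol)).continuousAt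
      (Ioi_mem_nhds hR)).tendsto.mono_left nhdsWithin_le_nhds
  have h2 : (growingSol B ν R : ℂ) * (((growingSol B ν R)⁻¹ : ℝ) : ℂ) = 1 := by
    rw [← Complex.ofReal_mul, mul_inv_cancel₀ (growingSol_pos hR).ne', Complex.ofReal_one]
  rw [h2] at h1
  refine h1.congr' ?_
  filter_upwards [self_mem_nhdsWithin] with r hr
  rw [refChiDeriv, cutInv, if_pos (mem_Ioi.1 hr)]

theorem tendsto_refGreenDeriv (hB : 0 < B) (hν : 1 / 2 ≤ ν) (hR : 0 < R) {g : ℝ → ℂ}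
    (hg : MemLp g 2 μ₊) :
    Tendsto (refGreenDeriv B ν g) (𝓝 R) (𝓝 (refGreenDeriv B ν g R)) :=
  ((continuousOn_logDeriv.mul ((hasDens_upperOp hB hν (memLp_lowerOp hB hν hg)).continuousOn
    isOpen_Ioi)).sub ((hasDens_lowerOp hB hν hg).continuousOn isOpen_Ioi)).continuousAt
      (Ioi_mem_nhds hR)

theorem tendsto_refGreen (hB : 0 < B) (hν : 1 / 2 ≤ ν) (hR : 0 < R) {g : ℝ → ℂ}
    (hg : MemLp g 2 μ₊) : Tendsto (refGreen B ν g) (𝓝 R) (𝓝 (refGreen B ν g R)) :=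
  ((hasDens_upperOp hB hν (memLp_lowerOp hB hν hg)).continuousOn isOpen_Ioi).continuousAt
      (Ioi_mem_nhds hR)

theorem tendsto_refChi (hB : 0 < B) (hν : 1 / 2 ≤ ν) (hR : 0 < R) :
    Tendsto (refChi B ν R) (𝓝 R) (𝓝 (refChi B ν R R)) :=
  (continuousOn_refChi hB hν hR).continuousAt (Ioi_mem_nhds hR)

/-- On `(0,∞) ∖ {R}`, a homogeneous solution, square integrable, regular at the origin and
continuous at `R`, is a multiple of `refChi`. -/
theorem eq_mul_refChi (hB : 0 < B) (hR : 0 < R) (i : Fin 2) (m : ℤ) {d d₁ d₂ : ℝ → ℂ}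
    (hd : IsH2Loc (Ioi 0 \ {R}) d d₁ d₂)
    (hd₂ : ∀ᵐ r ∂μ₊, d₂ r = ((radialPotential B i m r : ℂ) - refEnergy B i m) * d r)
    (hL : MemLp d 2 μ₊) (ho : OriginCondition m d) {c : ℂ}
    (h1 : Tendsto d (𝓝[<] R) (𝓝 c)) (h2 : Tendsto d (𝓝[>] R) (𝓝 c)) :
    ∃ a : ℂ, ∀ r ∈ Ioi (0 : ℝ) \ {R}, d r = a * refChi B (radialExponent m) R r := by
  have hν := half_le_radialExponent m
  have hdc : ContinuousOn d (Ioi 0 \ {R}) := fun r hr =>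
    (hd.hasDerivAt r hr).continuousAt.continuousWithinAt
  -- The equation for `d₂` holds only almost everywhere, but its right-hand side is continuous, so
  -- `d` becomes a classical solution.
  have hdens := hd.hasDens.congr_ae (isOpen_punctured.measurableSet)
    (ae_restrict_of_ae_restrict_of_subset sdiff_subset hd₂)
  have hder : ∀ r ∈ Ioi (0 : ℝ) \ {R}, HasDerivAt d₁
      (((radialPotential B i m r : ℂ) - refEnergy B i m) * d r) r := fun r hr =>
    hdens.hasDerivAt isOpen_punctured ((((continuousOn_radialPotential i m).mono
      sdiff_subset).sub continuousOn_const).mul hdc) hr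
  have hsl : Ioo 0 R ⊆ Ioi (0 : ℝ) \ {R} := fun r hr => ⟨hr.1, hr.2.ne⟩
  have hsr : Ioi R ⊆ Ioi (0 : ℝ) \ {R} := fun r hr => ⟨hR.trans hr, ne_of_gt hr⟩
  obtain ⟨a, ha⟩ := eq_mul_growingSol_of_left hB i m hR (fun r hr => hd.hasDerivAt r (hsl hr))
    (fun r hr => hder r (hsl hr))
    (hL.mono_measure (Measure.restrict_mono (hsl.trans sdiff_subset) le_rfl)) ho
  obtain ⟨b, hb⟩ := eq_mul_refChi_of_right hB i m hR (fun r hr => hd.hasDerivAt r (hsr hr))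
    (fun r hr => hder r (hsr hr))
    (hL.mono_measure (Measure.restrict_mono (hsr.trans sdiff_subset) le_rfl))
  have hχ := refChi_self_ne_zero (B := B) hB hν hR
  -- On `(0, R]` the function `χ` is itself a nonzero multiple of `F`, so the left piece of `d` is
  -- also a multiple of `χ`.
  obtain ⟨J, hJ, hJle⟩ : ∃ J : ℂ, J ≠ 0 ∧ ∀ r, 0 < r → r ≤ R →
      refChi B (radialExponent m) R r = J * growingSol B (radialExponent m) r := by
    refine ⟨_, ?_, fun r hr hrR => refChi_of_le hr hrR⟩
    intro h
    rw [refChi_of_le hR le_rfl, h, zero_mul] at hχ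
    exact hχ rfl
  have ha' : ∀ r ∈ Ioo 0 R, d r = a / J * refChi B (radialExponent m) R r := fun r hr => by
    rw [ha r hr, hJle r hr.1 hr.2.le]
    field_simp
  have l1 : Tendsto d (𝓝[<] R) (𝓝 (a / J * refChi B (radialExponent m) R R)) := by
    refine (((tendsto_refChi hB hν hR).mono_left nhdsWithin_le_nhds).const_mul (a / J)).congr' ?_
    filter_upwards [Ioo_mem_nhdsLT hR] with r hr using (ha' r hr).symm
  have l2 : Tendsto d (𝓝[>] R) (𝓝 (b * refChi B (radialExponent m) R R)) := by
    refine (((tendsto_refChi hB hν hR).mono_left nhdsWithin_le_nhds).const_mul b).congr' ?_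
    filter_upwards [self_mem_nhdsWithin] with r hr using (hb r hr).symm
  -- Continuity at `R` together with `χ(R) ≠ 0` forces the two multiples to agree.
  have hab : a / J = b := mul_right_cancel₀ hχ
    ((tendsto_nhds_unique l1 h1).trans (tendsto_nhds_unique h2 l2))
  refine ⟨b, fun r hr => ?_⟩
  rcases lt_or_gt_of_ne hr.2 with h | h
  · rw [ha' r ⟨hr.1, h⟩, hab]
  · exact hb r h

/-- The difference `u - S g` is a homogeneous solution, hence `c χ`. Since `S g` is `C¹` at `R` and
`χ'` jumps by `-1`, the condition at `R` reads `-c = α (S g(R) + c χ(R))`. -/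
theorem mem_channelGraph_iff (hB : 0 < B) (hR : 0 < R) (i : Fin 2) (m : ℤ) (α : ℝ)
    (p : HalfLineL2 × HalfLineL2) {g : HalfLineL2} (hg : p.2 - (refEnergy B i m : ℂ) • p.1 = g) :
    p ∈ channelGraph B R i m α ↔ ∃ c : ℂ,
      (p.1 =ᵐ[μ₊] fun r => refGreen B (radialExponent m) g r + c * refChi B (radialExponent m) R r)
      ∧ (1 + α * refChi B (radialExponent m) R R) * c = -α * refGreen B (radialExponent m) g R := by
  have hν := half_le_radialExponent m
  set ν := radialExponent m with hνdef
  have hgL : MemLp g 2 μ₊ := Lp.memLp g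
  have hS := isH2Loc_refGreen hB i m hgL
  have hχ := isH2Loc_refChi hB hR i m
  rw [← hνdef] at hS hχ
  have hgae : ∀ᵐ r ∂μ₊, g r = p.2 r - refEnergy B i m * p.1 r := by
    rw [← hg]
    filter_upwards [Lp.coeFn_sub p.2 ((refEnergy B i m : ℂ) • p.1),
      Lp.coeFn_smul (refEnergy B i m : ℂ) p.1] with r h1 h2
    rw [h1, Pi.sub_apply, h2, Pi.smul_apply, smul_eq_mul]
  constructor
  · rintro ⟨u, u₁, u₂, hu, ⟨c₀, d₁, d₂, hc₁, hc₂, hd₁, hd₂, hd⟩, ho, hp1, hp2⟩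
    have hD := hu.add ((hS.mono sdiff_subset).smul (-1))
    have hgS := tendsto_refGreen hB hν hR hgL
    have hlim : ∀ l ≤ 𝓝 R, Tendsto u l (𝓝 c₀) →
        Tendsto (u + (-1 : ℂ) • refGreen B ν g) l (𝓝 (c₀ + (-1 : ℂ) • refGreen B ν g R)) :=
      fun l hl h => h.add ((hgS.mono_left hl).const_smul (-1 : ℂ))
    obtain ⟨c, hc⟩ := eq_mul_refChi hB hR i m hD (by
        filter_upwards [hp1, hp2, hgae] with r h1 h2 h3
        rw [h1, h2] at h3
        simp only [Pi.add_apply, Pi.smul_apply, smul_eq_mul, h3]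
        ring)
      (((memLp_congr_ae hp1).1 (Lp.memLp p.1)).add
        ((memLp_upperOp hB hν (memLp_lowerOp hB hν hgL)).const_smul (-1 : ℂ)))
      (fun hm => by
        have h1 := (ho hm).add ((originCondition_refGreen hB m hgL hm).const_mul (-1 : ℂ))
        simp only [mul_zero, add_zero] at h1
        refine h1.congr fun r => ?_
        simp only [Pi.add_apply, Pi.smul_apply, smul_eq_mul]
        ring)
      (hlim _ nhdsWithin_le_nhds hc₁) (hlim _ nhdsWithin_le_nhds hc₂)
    rw [← hνdef] at hc
    have hu_eq : ∀ r ∈ Ioi (0 : ℝ) \ {R}, u r = refGreen B ν g r + c * refChi B ν R r :=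
      fun r hr => by
        have := hc r hr
        simp only [Pi.add_apply, Pi.smul_apply, smul_eq_mul] at this
        linear_combination this
    have hu1_eq : ∀ r ∈ Ioi (0 : ℝ) \ {R}, u₁ r = refGreenDeriv B ν g r + c * refChiDeriv B ν R r :=
      fun r hr => (hu.hasDerivAt r hr).unique
        (((hS.hasDerivAt r hr.1).add ((hχ.hasDerivAt r hr).const_mul c)).congr_of_eventuallyEq
          (eventually_of_mem (isOpen_punctured.mem_nhds hr) hu_eq))
    refine ⟨c, ?_, ?_⟩
    · filter_upwards [hp1, ae_mem_punctured (R := R)] with r h1 h2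
      rw [h1, hu_eq r h2]
    · have e0 : c₀ = refGreen B ν g R + c * refChi B ν R R := by
        refine tendsto_nhds_unique hc₁ (((hgS.add
          ((tendsto_refChi hB hν hR).const_mul c)).mono_left nhdsWithin_le_nhds).congr' ?_)
        filter_upwards [punctured_mem_nhdsLT hR] with r hr using (hu_eq r hr).symm
      have e1 : d₁ = refGreenDeriv B ν g R +
          c * (((ν / R + B / 2 * R : ℝ) : ℂ) * refChi B ν R R) := by
        refine tendsto_nhds_unique hd₁ ((((tendsto_refGreenDeriv hB hν hR hgL).mono_left
          nhdsWithin_le_nhds).add ((tendsto_refChiDeriv_left hB hν hR).const_mul c)).congr' ?_)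
        filter_upwards [punctured_mem_nhdsLT hR] with r hr using (hu1_eq r hr).symm
      have e2 : d₂ = refGreenDeriv B ν g R +
          c * (((ν / R + B / 2 * R : ℝ) : ℂ) * refChi B ν R R - 1) := by
        refine tendsto_nhds_unique hd₂ ((((tendsto_refGreenDeriv hB hν hR hgL).mono_left
          nhdsWithin_le_nhds).add ((tendsto_refChiDeriv_right hB hν hR).const_mul c)).congr' ?_)
        filter_upwards [punctured_mem_nhdsGT hR] with r hr using (hu1_eq r hr).symm
      rw [e0, e1, e2] at hd
      linear_combination -hd
  · rintro ⟨c, hp1, hcR⟩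
    refine ⟨_, _, _, (hS.mono sdiff_subset).add (hχ.smul c), ?_, ?_, ?_, ?_⟩
    · have hl : Tendsto (refGreen B ν g + c • refChi B ν R) (𝓝 R)
          (𝓝 (refGreen B ν g R + c * refChi B ν R R)) :=
        (tendsto_refGreen hB hν hR hgL).add ((tendsto_refChi hB hν hR).const_mul c)
      refine ⟨_, _, _, hl.mono_left nhdsWithin_le_nhds, hl.mono_left nhdsWithin_le_nhds,
        ((tendsto_refGreenDeriv hB hν hR hgL).mono_left nhdsWithin_le_nhds).add
          ((tendsto_refChiDeriv_left hB hν hR).const_mul c),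
        ((tendsto_refGreenDeriv hB hν hR hgL).mono_left nhdsWithin_le_nhds).add
          ((tendsto_refChiDeriv_right hB hν hR).const_mul c), ?_⟩
      linear_combination -hcR
    · intro hm
      have h1 := (originCondition_refGreen hB m hgL hm).add
        ((originCondition_refChi hB hR m hm).const_mul c)
      simp only [mul_zero, add_zero] at h1
      refine h1.congr fun r => ?_
      simp only [Pi.add_apply, Pi.smul_apply, smul_eq_mul]
      ring
    · exact hp1
    · filter_upwards [hp1, hgae] with r h1 h2
      simp only [Pi.add_apply, Pi.smul_apply, smul_eq_mul]
      have : p.2 r = g r + refEnergy B i m * p.1 r := by rw [h2]; ring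
      rw [this, h1]
      ring

/-! ### Self-adjointness -/

section Abstract

variable {E : Type*} [NormedAddCommGroup E] [InnerProductSpace ℂ E]

/-- Write `l = 1 + α x₀`. The boundary condition `l c = -α (χ, g)` has real coefficients, so the two
`χ` terms in the Green identity cancel; this gives symmetry. Conversely, testing against every
admissible `(g, c)` determines `p.1 - S y`. The hypothesis `hα` says that `α` and `l` do not both
vanish; otherwise the condition would be empty. -/
theorem self_adjoint_relation (S : E → E) (hS : ∀ f g, inner ℂ (S f) g = inner ℂ f (S g))
    (χ : E) (k α x₀ : ℝ) (hα : α = 0 → 1 + α * x₀ ≠ 0) (p : E × E) :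
    (∃ c : ℂ, p.1 = S (p.2 - (k : ℂ) • p.1) + c • χ ∧
      (1 + α * x₀ : ℂ) * c = -α * inner ℂ χ (p.2 - (k : ℂ) • p.1)) ↔
    ∀ q : E × E, (∃ c : ℂ, q.1 = S (q.2 - (k : ℂ) • q.1) + c • χ ∧
      (1 + α * x₀ : ℂ) * c = -α * inner ℂ χ (q.2 - (k : ℂ) • q.1)) →
      inner ℂ q.2 p.1 = inner ℂ q.1 p.2 := by
  obtain ⟨l, hl⟩ : ∃ l : ℝ, l = 1 + α * x₀ := ⟨_, rfl⟩
  have hlc : (1 + α * x₀ : ℂ) = l := by rw [hl]; push_cast; ring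
  rw [hlc]
  rw [← hl] at hα
  set y := p.2 - (k : ℂ) • p.1 with hy
  have hp2 : p.2 = y + (k : ℂ) • p.1 := by rw [hy]; abel
  constructor
  · rintro ⟨c, hp, hc⟩ q ⟨c', hq, hc'⟩
    set z := q.2 - (k : ℂ) • q.1 with hz
    have hq2 : q.2 = z + (k : ℂ) • q.1 := by rw [hz]; abel
    have key : inner ℂ z p.1 = inner ℂ q.1 y := by
      rw [hp, hq, inner_add_right, inner_add_left, inner_smul_right, inner_smul_left, hS]
      have hzc : inner ℂ z χ = conj (inner ℂ χ z) := (inner_conj_symm _ _).symm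
      have hcc : (l : ℂ) * conj c' = -α * inner ℂ z χ := by
        have := congrArg conj hc'
        rw [map_mul, map_mul, map_neg, Complex.conj_ofReal, Complex.conj_ofReal] at this
        rw [hzc]
        exact this
      -- After multiplication by `-α` both sides equal `l c conj c'`. If `α = 0` this says nothing,
      -- but then `l ≠ 0` and both coefficients vanish.
      have hfin : c * inner ℂ z χ = conj c' * inner ℂ χ y := by
        by_cases hα0 : α = 0
        · have hl0 : (l : ℂ) ≠ 0 := by exact_mod_cast hα hα0
          rw [hα0] at hc hcc
          have h1 : c = 0 := by
            have : (l : ℂ) * c = 0 := by rw [hc]; simp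
            exact (mul_eq_zero.1 this).resolve_left hl0
          have h2 : conj c' = 0 := by
            have : (l : ℂ) * conj c' = 0 := by rw [hcc]; simp
            exact (mul_eq_zero.1 this).resolve_left hl0
          rw [h1, h2]
          simp
        · have hαc : (-α : ℂ) ≠ 0 := by exact_mod_cast neg_ne_zero.2 hα0
          refine mul_left_cancel₀ hαc ?_
          linear_combination (-c) * hcc + conj c' * hc
      rw [hfin]
    rw [hq2, hp2, inner_add_left, inner_add_right, inner_smul_left, inner_smul_right,
      Complex.conj_ofReal, key]
  · intro H
    -- Test with the element of the relation built from `g` and `c`, and remove the parts involving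
    -- `k` and `S` by symmetry.
    have H' : ∀ (g : E) (c : ℂ), (l : ℂ) * c = -α * inner ℂ χ g →
        inner ℂ g (p.1 - S y) = conj c * inner ℂ χ y := by
      intro g c hc
      have h1 := H (S g + c • χ, g + (k : ℂ) • (S g + c • χ)) ⟨c, by simp, by simpa using hc⟩
      simp only at h1
      rw [hp2, inner_add_left, inner_add_right, inner_smul_left, inner_smul_right,
        Complex.conj_ofReal] at h1
      have h2 := add_right_cancel h1
      rw [inner_add_left, hS, inner_smul_left] at h2
      rw [inner_sub_right, h2]
      ring
    set w := p.1 - S y with hw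
    have hp1 : p.1 = S y + w := by rw [hw]; abel
    by_cases hl0 : l = 0
    · have hα0 : α ≠ 0 := fun h => hα h hl0
      have h1 : inner ℂ χ y = 0 := by
        have := H' 0 1 (by simp [hl0])
        simpa using this.symm
      -- Coefficient of the orthogonal projection of `w` on `χ`. For `χ = 0` both sides of `haχ`
      -- vanish, so the division by zero is harmless.
      set a := inner ℂ χ w / inner ℂ χ χ with ha
      have haχ : a * inner ℂ χ χ = inner ℂ χ w := by
        by_cases hχ : χ = 0
        · simp [hχ]
        · rw [ha, div_mul_cancel₀ _ (inner_self_ne_zero.2 hχ)]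
      have hperp : inner ℂ χ (w - a • χ) = 0 := by
        rw [inner_sub_right, inner_smul_right, haχ, sub_self]
      -- With `l = 0` every vector orthogonal to `χ` is admissible with `c = 0`. Thus `w - a χ` is
      -- orthogonal to `w`, hence to itself.
      have h2 := H' (w - a • χ) 0 (by simp [hperp])
      have h3 : inner ℂ (w - a • χ) (w - a • χ) = 0 := by
        rw [inner_sub_right (w - a • χ) w, h2, inner_smul_right,
          ← inner_conj_symm (w - a • χ) χ, hperp]
        simp
      have h4 : w = a • χ := sub_eq_zero.1 (inner_self_eq_zero.1 h3)
      exact ⟨a, by rw [← h4]; exact hp1, by simp [hl0, h1]⟩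
    · have hlc0 : (l : ℂ) ≠ 0 := by exact_mod_cast hl0
      set c := -α / l * inner ℂ χ y with hc
      have h1 : ∀ g, inner ℂ g (w - c • χ) = 0 := by
        intro g
        have h2 := H' g (-α / l * inner ℂ χ g) (by field_simp)
        rw [inner_sub_right, h2, inner_smul_right, hc, map_mul, inner_conj_symm]
        simp
        ring
      have h4 : w = c • χ := sub_eq_zero.1 (inner_self_eq_zero.1 (h1 _))
      refine ⟨c, by rw [← h4]; exact hp1, ?_⟩
      rw [hc]
      field_simp

end Abstract

/-- `g ↦ refGreen g` on `L²`. -/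
def refGreenLp (B ν : ℝ) (g : HalfLineL2) : HalfLineL2 := toHalfLineL2 (refGreen B ν g)

theorem coeFn_toHalfLineL2 {f : ℝ → ℂ} (h : MemLp f 2 μ₊) : toHalfLineL2 f =ᵐ[μ₊] f := by
  rw [toHalfLineL2, dif_pos h]
  exact h.coeFn_toLp

theorem memLp_refGreen (hB : 0 < B) (hν : 1 / 2 ≤ ν) {g : ℝ → ℂ} (hg : MemLp g 2 μ₊) :
    MemLp (refGreen B ν g) 2 μ₊ := memLp_upperOp hB hν (memLp_lowerOp hB hν hg)

theorem inner_toHalfLineL2_left {f : ℝ → ℂ} (h : MemLp f 2 μ₊) (g : HalfLineL2) :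
    inner ℂ (toHalfLineL2 f) g = ∫ r, conj (f r) * g r ∂μ₊ := by
  rw [L2.inner_def]
  refine integral_congr_ae ?_
  filter_upwards [coeFn_toHalfLineL2 h] with r hr
  rw [hr, RCLike.inner_apply']

theorem inner_toHalfLineL2_right {f : ℝ → ℂ} (h : MemLp f 2 μ₊) (g : HalfLineL2) :
    inner ℂ g (toHalfLineL2 f) = ∫ r, conj (g r) * f r ∂μ₊ := by
  rw [L2.inner_def]
  refine integral_congr_ae ?_
  filter_upwards [coeFn_toHalfLineL2 h] with r hr
  rw [hr, RCLike.inner_apply']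

/-- Translation of `mem_channelGraph_iff` into Hilbert space terms: `χ(R)` is real and `S g(R) = (χ,
g)`, so `self_adjoint_relation` applies. -/
theorem mem_channelGraph_iff_forall (hB : 0 < B) (hR : 0 < R) (i : Fin 2) (m : ℤ) (α : ℝ)
    (p : HalfLineL2 × HalfLineL2) :
    p ∈ channelGraph B R i m α ↔
      ∀ q ∈ channelGraph B R i m α, inner ℂ q.2 p.1 = inner ℂ q.1 p.2 := by
  have hν := half_le_radialExponent m
  set ν := radialExponent m with hνdef
  have hχ := memLp_refChi (R := R) hB hν hR
  obtain ⟨x₀, hx₀⟩ : ∃ x₀ : ℝ, (x₀ : ℂ) = refChi B ν R R :=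
    Complex.conj_eq_iff_real.1 (conj_refChi R) |>.imp fun _ h => h.symm
  have hiff : ∀ q : HalfLineL2 × HalfLineL2, q ∈ channelGraph B R i m α ↔
      ∃ c : ℂ, q.1 = refGreenLp B ν (q.2 - (refEnergy B i m : ℂ) • q.1) +
        c • toHalfLineL2 (refChi B ν R) ∧ (1 + α * x₀ : ℂ) * c =
          -α * inner ℂ (toHalfLineL2 (refChi B ν R)) (q.2 - (refEnergy B i m : ℂ) • q.1) := by
    intro q
    rw [mem_channelGraph_iff hB hR i m α q rfl]
    set g := q.2 - (refEnergy B i m : ℂ) • q.1 with hg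
    have hgL := Lp.memLp g
    refine exists_congr fun c => ?_
    rw [← hνdef, hx₀, inner_toHalfLineL2_left hχ]
    simp only [conj_refChi]
    rw [integral_refChi_mul hB hν hR hgL]
    refine and_congr_left fun _ => ?_
    have hae : (refGreenLp B ν g + c • toHalfLineL2 (refChi B ν R) : HalfLineL2) =ᵐ[μ₊]
        fun r => refGreen B ν g r + c * refChi B ν R r := by
      filter_upwards [Lp.coeFn_add (refGreenLp B ν g) (c • toHalfLineL2 (refChi B ν R)),
        Lp.coeFn_smul c (toHalfLineL2 (refChi B ν R)), coeFn_toHalfLineL2 hχ,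
        coeFn_toHalfLineL2 (memLp_refGreen hB hν hgL)] with r h1 h2 h3 h4
      rw [h1, Pi.add_apply, h2, Pi.smul_apply, h3, refGreenLp, h4, smul_eq_mul]
    exact ⟨fun h => Lp.ext (h.trans hae.symm), fun h => h ▸ hae⟩
  simp only [hiff]
  refine self_adjoint_relation (refGreenLp B ν) (fun f g => ?_) _ _ _ _ (fun h => by simp [h]) p
  rw [refGreenLp, inner_toHalfLineL2_left (memLp_refGreen hB hν (Lp.memLp f)), refGreenLp,
    inner_toHalfLineL2_right (memLp_refGreen hB hν (Lp.memLp g)),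
    integral_conj_refGreen_mul hB hν (Lp.memLp f) (Lp.memLp g)]

theorem inner_single_left (i : Fin 2) (f : HalfLineL2) (g : RadialSpace) :
    inner ℂ (PiLp.single 2 i f : RadialSpace) g = inner ℂ f (g i) := by
  rw [PiLp.inner_apply, Finset.sum_eq_single i]
  · simp
  · intro j _ hj
    simp [hj]
  · simp

theorem mem_radialGraph_iff_forall (hB : 0 < B) (hR : 0 < R) (M : Fin 2 → ℤ) (g : Fin 2 → ℝ)
    (p : RadialSpace × RadialSpace) :
    p ∈ radialGraph B R M g ↔
      ∀ q ∈ radialGraph B R M g, inner ℂ q.2 p.1 = inner ℂ q.1 p.2 := by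
  constructor
  · intro hp q hq
    rw [PiLp.inner_apply, PiLp.inner_apply]
    exact Finset.sum_congr rfl fun i _ =>
      (mem_channelGraph_iff_forall hB hR i (M i) (g i) _).1 (hp i) _ (hq i)
  · intro H i
    rw [mem_channelGraph_iff_forall hB hR]
    intro q hq
    have h1 := H (PiLp.single 2 i q.1, PiLp.single 2 i q.2) (fun j => by
      by_cases hj : j = i
      · subst hj
        simpa using hq
      · simp [hj]
        exact (channelGraph B R j (M j) (g j)).zero_mem)
    rwa [inner_single_left, inner_single_left] at h1

/-- A self-adjoint relation which is the graph of an operator is the graph of a self-adjoint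
operator. -/
theorem isSelfAdjoint_toLinearPMap {E : Type*} [NormedAddCommGroup E] [InnerProductSpace ℂ E]
    [CompleteSpace E] (Γ : Submodule ℂ (E × E)) (hfun : ∀ p ∈ Γ, p.1 = 0 → p.2 = 0)
    (hΓ : ∀ p, p ∈ Γ ↔ ∀ q ∈ Γ, inner ℂ q.2 p.1 = inner ℂ q.1 p.2) :
    IsSelfAdjoint Γ.toLinearPMap := by
  have hgraph := Submodule.toLinearPMap_graph_eq Γ hfun
  set T := Γ.toLinearPMap with hT
  have hdense : Dense (T.domain : Set E) := by
    rw [Submodule.dense_iff_topologicalClosure_eq_top, Submodule.topologicalClosure_eq_top_iff,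
      Submodule.eq_bot_iff]
    intro x hx
    -- A vector `x` orthogonal to the domain makes `(0, x)` satisfy the adjoint condition, hence lie
    -- in `Γ`; since `Γ` is a graph, `x = 0`. Density of the domain is thus automatic.
    refine hfun (0, x) ((hΓ _).2 fun q hq => ?_) rfl
    rw [← hgraph, LinearPMap.mem_graph_iff] at hq
    obtain ⟨y, hy, -⟩ := hq
    rw [Submodule.mem_orthogonal] at hx
    simp only [inner_zero_right]
    rw [← hy, hx y y.2]
  rw [LinearPMap.isSelfAdjoint_def]
  refine LinearPMap.eq_of_eq_graph ?_
  rw [LinearPMap.adjoint_graph_eq_graph_adjoint hdense, hgraph]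
  ext p
  rw [Submodule.mem_adjoint_iff, hΓ]
  constructor
  · intro h q hq
    exact sub_eq_zero.1 (h q.1 q.2 hq)
  · intro h a b hab
    exact sub_eq_zero.2 (h (a, b) hab)

theorem isSelfAdjoint_radialHamiltonian (hB : 0 < B) (hR : 0 < R) (M : Fin 2 → ℤ)
    (g : Fin 2 → ℝ) : IsSelfAdjoint (radialHamiltonian B R M g) :=
  isSelfAdjoint_toLinearPMap _ (radialGraph_functional B R M g)
    (mem_radialGraph_iff_forall hB hR M g)

end SelfAdjointness

/-! ### Kummer's series and Tricomi's integral. -/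

section ConfluentFunctions

/-! ### Kummer's function -/

/-- The coefficients of the series of Kummer's function. -/
def kummerCoeff (a b : ℂ) (n : ℕ) : ℂ :=
  (ascPochhammer ℂ n).eval a / ((ascPochhammer ℂ n).eval b * (n.factorial : ℂ))

theorem ascPochhammer_eval_ne_zero {b : ℂ} (hb : ∀ n : ℕ, b ≠ -n) (n : ℕ) :
    (ascPochhammer ℂ n).eval b ≠ 0 := by
  induction n with
  | zero => simp
  | succ n ih =>
    rw [ascPochhammer_succ_eval]
    exact mul_ne_zero ih fun h => hb n (by linear_combination h)

theorem kummerCoeff_eq (a b : ℂ) (hb : ∀ n : ℕ, b ≠ -n) (n : ℕ) :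
    kummerCoeff a b n = Complex.Gamma b * Complex.regularizedHGFunCoeff {a} {b} n := by
  have hG := Complex.Gamma_ne_zero hb
  have hP : ∀ n : ℕ, Complex.Gamma (b + n) = (ascPochhammer ℂ n).eval b * Complex.Gamma b := by
    intro n
    induction n with
    | zero => simp
    | succ n ih =>
      have h : b + n ≠ 0 := fun h => hb n (by linear_combination h)
      rw [ascPochhammer_succ_eval, Nat.cast_succ, ← add_assoc, Complex.Gamma_add_one _ h, ih]
      ring
  rw [Complex.regularizedHGFunCoeff, kummerCoeff]
  simp only [Multiset.map_singleton, Multiset.prod_singleton, hP]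
  have := ascPochhammer_eval_ne_zero hb n
  field_simp

theorem kummerM_eq_tsum_coeff (a b z : ℂ) (hb : ∀ n : ℕ, b ≠ -n) :
    kummerM a b z = ∑' n : ℕ, kummerCoeff a b n * z ^ n := by
  rw [kummerM_eq_tsum a b z hb]
  congr 1
  ext n
  rw [kummerCoeff]
  field_simp

theorem summable_kummer (a b z : ℂ) (hb : ∀ n : ℕ, b ≠ -n) :
    Summable fun n : ℕ => ‖kummerCoeff a b n * z ^ n‖ := by
  have hr : (Complex.regularizedHGFunSeries {a} {b}).radius = ⊤ :=
    Complex.radius_regularizedHGFunSeries_eq_top (by simp)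
  have h := (Complex.regularizedHGFunSeries {a} {b}).summable_norm_apply (x := z) (by
    rw [hr, Metric.mem_eball]; exact edist_lt_top _ _)
  refine (h.mul_left ‖Complex.Gamma b‖).congr fun n => ?_
  rw [FormalMultilinearSeries.apply_eq_pow_smul_coeff, Complex.regularizedHGFunSeries_coeff,
    kummerCoeff_eq a b hb, ← norm_mul]
  congr 1
  rw [smul_eq_mul]
  ring

theorem hasSum_kummer (a b z : ℂ) (hb : ∀ n : ℕ, b ≠ -n) :
    HasSum (fun n : ℕ => kummerCoeff a b n * z ^ n) (kummerM a b z) := by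
  rw [kummerM_eq_tsum_coeff a b z hb]
  exact (summable_kummer a b z hb).of_norm.hasSum

theorem kummerCoeff_succ (a b : ℂ) (hb : ∀ n : ℕ, b ≠ -n) (n : ℕ) :
    (n + 1 : ℂ) * (b + n) * kummerCoeff a b (n + 1) = (a + n) * kummerCoeff a b n := by
  have h1 := ascPochhammer_eval_ne_zero hb n
  have h2 : b + n ≠ 0 := fun h => hb n (by linear_combination h)
  have h3 : (n + 1 : ℂ) ≠ 0 := by exact_mod_cast Nat.succ_ne_zero n
  rw [kummerCoeff, kummerCoeff, ascPochhammer_succ_eval, ascPochhammer_succ_eval,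
    Nat.factorial_succ]
  push_cast
  field_simp

theorem kummerCoeff_shift (a b : ℂ) (hb : ∀ n : ℕ, b ≠ -n) (n : ℕ) :
    (n + 1 : ℂ) * kummerCoeff a b (n + 1) = a / b * kummerCoeff (a + 1) (b + 1) n := by
  have hb1 : ∀ n : ℕ, b + 1 ≠ -n := fun n h => hb (n + 1) (by push_cast; linear_combination h)
  have hl : ∀ x : ℂ, (ascPochhammer ℂ (n + 1)).eval x = x * (ascPochhammer ℂ n).eval (x + 1) := by
    intro x
    rw [ascPochhammer_succ_left]
    simp
  have h0 : b ≠ 0 := by simpa using hb 0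
  have h1 := ascPochhammer_eval_ne_zero hb1 n
  have h3 : (n + 1 : ℂ) ≠ 0 := by exact_mod_cast Nat.succ_ne_zero n
  rw [kummerCoeff, kummerCoeff, hl, hl, Nat.factorial_succ]
  push_cast
  field_simp

/-- Termwise differentiation on a disc of radius `ρ > ‖z‖`. The majorant is the differentiated
series at `ρ`, which by `kummerCoeff_shift` is a multiple of an absolutely convergent Kummer series.
-/
theorem hasDerivAt_kummerM (a b z : ℂ) (hb : ∀ n : ℕ, b ≠ -n) :
    HasDerivAt (kummerM a b) (a / b * kummerM (a + 1) (b + 1) z) z := by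
  have hb1 : ∀ n : ℕ, b + 1 ≠ -n := fun n h => hb (n + 1) (by push_cast; linear_combination h)
  obtain ⟨ρ, hρ0, hρ⟩ : ∃ ρ : ℝ, 0 < ρ ∧ ‖z‖ < ρ := ⟨‖z‖ + 1, by positivity, by linarith⟩
  have hsum := summable_kummer (a + 1) (b + 1) ρ hb1
  set u : ℕ → ℝ := fun n => ‖kummerCoeff a b n * (n * (ρ : ℂ) ^ (n - 1))‖ with hu
  have hus : Summable u := by
    rw [← summable_nat_add_iff 1]
    refine (hsum.mul_left ‖a / b‖).congr fun n => ?_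
    simp only [hu]
    rw [← norm_mul, ← mul_assoc, ← kummerCoeff_shift a b hb n]
    congr 1
    push_cast
    ring
  have hd := hasDerivAt_tsum_of_isPreconnected (𝕜 := ℂ) (t := Metric.ball 0 ρ) (y₀ := 0) (y := z)
    (g := fun n z => kummerCoeff a b n * z ^ n)
    (g' := fun n z => kummerCoeff a b n * (n * z ^ (n - 1))) hus Metric.isOpen_ball
    (convex_ball 0 ρ).isPreconnected (fun n y _ => (hasDerivAt_pow n y).const_mul _)
    (fun n y hy => by
      rw [mem_ball_zero_iff] at hy
      simp only [hu, norm_mul, norm_pow, Complex.norm_real, Real.norm_of_nonneg hρ0.le]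
      gcongr) (Metric.mem_ball_self hρ0) (summable_kummer a b 0 hb).of_norm
    (by rwa [mem_ball_zero_iff])
  have e1 : (fun z => ∑' n : ℕ, kummerCoeff a b n * z ^ n) = kummerM a b := by
    ext z
    rw [kummerM_eq_tsum_coeff a b z hb]
  rw [e1] at hd
  refine hd.congr_deriv (HasSum.tsum_eq ?_)
  rw [← hasSum_nat_add_iff' 1]
  simp only [Finset.range_one, Finset.sum_singleton, Nat.cast_zero, zero_mul, mul_zero, sub_zero]
  refine ((hasSum_kummer (a + 1) (b + 1) z hb1).mul_left (a / b)).congr_fun fun n => ?_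
  rw [← mul_assoc (a / b), ← kummerCoeff_shift a b hb n, Nat.add_sub_cancel]
  push_cast
  ring

/-- Kummer's equation with both derivatives inserted as shifted functions; the coefficient of each
power of `z` vanishes by the recursion `kummerCoeff_succ`. -/
theorem kummerM_ode (a b z : ℂ) (hb : ∀ n : ℕ, b ≠ -n) :
    z * (a / b * ((a + 1) / (b + 1) * kummerM (a + 1 + 1) (b + 1 + 1) z)) +
      (b - z) * (a / b * kummerM (a + 1) (b + 1) z) - a * kummerM a b z = 0 := by
  have hb1 : ∀ n : ℕ, b + 1 ≠ -n := fun n h => hb (n + 1) (by push_cast; linear_combination h)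
  have hb2 : ∀ n : ℕ, b + 1 + 1 ≠ -n := fun n h => hb1 (n + 1) (by push_cast; linear_combination h)
  set t := kummerCoeff a b with ht
  have h0 := hasSum_kummer a b z hb
  have h1 : HasSum (fun n : ℕ => (n + 1 : ℂ) * t (n + 1) * z ^ n)
      (a / b * kummerM (a + 1) (b + 1) z) := by
    refine ((hasSum_kummer (a + 1) (b + 1) z hb1).mul_left (a / b)).congr_fun fun n => ?_
    rw [kummerCoeff_shift a b hb n]
    ring
  have h2 : HasSum (fun n : ℕ => (n + 1 : ℂ) * ((n + 2 : ℂ) * t (n + 2)) * z ^ n)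
      (a / b * ((a + 1) / (b + 1) * kummerM (a + 1 + 1) (b + 1 + 1) z)) := by
    refine (((hasSum_kummer (a + 1 + 1) (b + 1 + 1) z hb2).mul_left
      ((a + 1) / (b + 1))).mul_left (a / b)).congr_fun fun n => ?_
    have e1 := kummerCoeff_shift a b hb (n + 1)
    have e2 := kummerCoeff_shift (a + 1) (b + 1) hb1 n
    push_cast at e1
    rw [ht]
    linear_combination (n + 1 : ℂ) * z ^ n * e1 + a / b * z ^ n * e2
  have h3 : HasSum (fun n : ℕ => (n : ℂ) * ((n + 1 : ℂ) * t (n + 1)) * z ^ n)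
      (z * (a / b * ((a + 1) / (b + 1) * kummerM (a + 1 + 1) (b + 1 + 1) z))) := by
    rw [← hasSum_nat_add_iff' 1]
    simp only [Finset.range_one, Finset.sum_singleton, Nat.cast_zero, zero_mul, sub_zero]
    refine (h2.mul_left z).congr_fun fun n => ?_
    push_cast
    ring
  have h4 : HasSum (fun n : ℕ => (n : ℂ) * t n * z ^ n)
      (z * (a / b * kummerM (a + 1) (b + 1) z)) := by
    rw [← hasSum_nat_add_iff' 1]
    simp only [Finset.range_one, Finset.sum_singleton, Nat.cast_zero, zero_mul, sub_zero]
    refine (h1.mul_left z).congr_fun fun n => ?_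
    push_cast
    ring
  have h5 := ((h3.add (h1.mul_left b)).sub h4).sub (h0.mul_left a)
  have h6 : HasSum (fun _ : ℕ => (0 : ℂ)) _ := h5.congr_fun fun n => by
    have := kummerCoeff_succ a b hb n
    rw [ht]
    linear_combination (-z ^ n) * this
  have h7 := hasSum_zero.unique h6
  linear_combination -h7

theorem kummerM_zero (a b : ℂ) (hb : ∀ n : ℕ, b ≠ -n) : kummerM a b 0 = 1 := by
  rw [kummerM_eq_tsum_coeff a b 0 hb, tsum_eq_single 0]
  · simp [kummerCoeff]
  · intro n hn
    simp [hn]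

theorem ascPochhammer_eval_conj (n : ℕ) (a : ℂ) :
    (ascPochhammer ℂ n).eval (conj a) = conj ((ascPochhammer ℂ n).eval a) := by
  induction n with
  | zero => simp
  | succ n ih => simp [ascPochhammer_succ_eval, ih]

theorem conj_kummerM (a b z : ℂ) (hb : ∀ n : ℕ, b ≠ -n) :
    conj (kummerM a b z) = kummerM (conj a) (conj b) (conj z) := by
  have hb' : ∀ n : ℕ, conj b ≠ -n := fun n h => hb n (by
    have := congrArg conj h
    simpa using this)
  rw [kummerM_eq_tsum_coeff _ _ _ hb', kummerM_eq_tsum_coeff a b z hb, Complex.conj_tsum]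
  congr 1
  ext n
  simp only [kummerCoeff, ascPochhammer_eval_conj, map_mul, map_div₀, map_pow, map_natCast]

/-! ### Tricomi's function -/

/-- `∫₀^∞ e^{-xt} t^{a-1} (1+t)^c dt`. -/
def tricomiInt (a c : ℂ) (x : ℝ) : ℂ :=
  ∫ t in Ioi (0 : ℝ), Complex.exp (-x * t) * (t : ℂ) ^ (a - 1) * (1 + t : ℂ) ^ c

theorem tricomiUAux_zero (a b : ℂ) (x : ℝ) :
    tricomiUAux 0 a b x = (Complex.Gamma a)⁻¹ * tricomiInt a (b - a - 1) x := rfl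

theorem norm_tricomi_integrand {a c : ℂ} {x t : ℝ} (ht : 0 < t) :
    ‖Complex.exp (-x * t) * (t : ℂ) ^ (a - 1) * (1 + t : ℂ) ^ c‖ =
      Real.exp (-x * t) * t ^ (a.re - 1) * (1 + t) ^ c.re := by
  have h1 : (1 + t : ℂ) = ((1 + t : ℝ) : ℂ) := by push_cast; rfl
  rw [norm_mul, norm_mul, h1, Complex.norm_cpow_eq_rpow_re_of_pos ht,
    Complex.norm_cpow_eq_rpow_re_of_pos (by linarith), Complex.norm_exp]
  simp

theorem exists_rpow_le_exp (c : ℝ) {ε : ℝ} (hε : 0 < ε) :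
    ∃ C : ℝ, 0 < C ∧ ∀ t : ℝ, 0 < t → (1 + t) ^ c ≤ C * Real.exp (ε * t) := by
  obtain ⟨N, hN⟩ := exists_nat_ge c
  -- Chosen so that `δ (1 + t) ≤ 1 + ε t / (N + 1)`, which is at most an exponential; its `N`-th
  -- power stays below `e^{ε t}`.
  set δ := min 1 (ε / (N + 1)) with hδ
  have hδ0 : 0 < δ := lt_min one_pos (by positivity)
  refine ⟨(δ⁻¹) ^ N, by positivity, fun t ht => ?_⟩
  have h1 : (1 + t) ^ c ≤ (1 + t) ^ N := by
    rw [← Real.rpow_natCast]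
    exact Real.rpow_le_rpow_of_exponent_le (by linarith) hN
  have h2 : δ * (1 + t) ≤ Real.exp (ε / (N + 1) * t) := by
    have := Real.add_one_le_exp (ε / (N + 1) * t)
    have h3 : δ ≤ 1 := min_le_left _ _
    have h4 : δ * t ≤ ε / (N + 1) * t := mul_le_mul_of_nonneg_right (min_le_right _ _) ht.le
    linarith
  have h5 : (1 + t) ^ N ≤ (δ⁻¹) ^ N * Real.exp (ε / (N + 1) * t) ^ N := by
    rw [← mul_pow]
    refine pow_le_pow_left₀ (by linarith) ?_ N
    rw [inv_mul_eq_div, le_div_iff₀ hδ0, mul_comm]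
    exact h2
  refine (h1.trans h5).trans (mul_le_mul_of_nonneg_left ?_ (by positivity))
  rw [← Real.exp_nat_mul]
  refine Real.exp_le_exp.2 ?_
  have : (N : ℝ) * (ε / (N + 1) * t) = (N / (N + 1)) * (ε * t) := by ring
  rw [this]
  refine mul_le_of_le_one_left (by positivity) ?_
  rw [div_le_one (by positivity)]
  linarith

theorem integrableOn_rpow_mul_exp {s x : ℝ} (hs : -1 < s) (hx : 0 < x) :
    IntegrableOn (fun t : ℝ => t ^ s * Real.exp (-x * t)) (Ioi 0) := by
  have := integrableOn_rpow_mul_exp_neg_mul_rpow hs one_pos hx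
  simpa using this

theorem integrableOn_tricomi_majorant {s x : ℝ} (hs : -1 < s) (hx : 0 < x) (c : ℝ) :
    IntegrableOn (fun t : ℝ => Real.exp (-x * t) * t ^ s * (1 + t) ^ c) (Ioi 0) := by
  obtain ⟨C, hC, h⟩ := exists_rpow_le_exp c (half_pos hx)
  refine ((integrableOn_rpow_mul_exp hs (half_pos hx)).const_mul C).mono'
    (Measurable.aestronglyMeasurable (by fun_prop)) ?_
  filter_upwards [ae_restrict_mem measurableSet_Ioi] with t ht
  have ht' : 0 < t := ht
  have h1 := Real.rpow_nonneg ht'.le s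
  rw [Real.norm_of_nonneg (mul_nonneg (mul_nonneg (Real.exp_pos _).le h1)
    (Real.rpow_nonneg (by linarith) _))]
  calc Real.exp (-x * t) * t ^ s * (1 + t) ^ c
      ≤ Real.exp (-x * t) * t ^ s * (C * Real.exp (x / 2 * t)) :=
        mul_le_mul_of_nonneg_left (h t ht') (mul_nonneg (Real.exp_pos _).le h1)
    _ = C * (t ^ s * (Real.exp (-x * t) * Real.exp (x / 2 * t))) := by ring
    _ = C * (t ^ s * Real.exp (-(x / 2) * t)) := by
        rw [← Real.exp_add]
        ring_nf

theorem continuousOn_tricomi_integrand (a c : ℂ) (x : ℝ) :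
    ContinuousOn (fun t : ℝ => Complex.exp (-x * t) * (t : ℂ) ^ (a - 1) * (1 + t : ℂ) ^ c)
      (Ioi 0) := by
  intro t ht
  have ht' : 0 < t := ht
  refine ContinuousAt.continuousWithinAt ?_
  refine ((by fun_prop : ContinuousAt (fun t : ℝ => Complex.exp (-x * t)) t).mul
    (Complex.continuousAt_ofReal_cpow_const _ _ (Or.inr ht'.ne'))).mul ?_
  refine ContinuousAt.cpow (by fun_prop) continuousAt_const ?_
  left
  simp
  linarith

theorem integrableOn_tricomi {a : ℂ} (ha : 0 < a.re) {x : ℝ} (hx : 0 < x) (c : ℂ) :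
    IntegrableOn (fun t : ℝ => Complex.exp (-x * t) * (t : ℂ) ^ (a - 1) * (1 + t : ℂ) ^ c)
      (Ioi 0) := by
  refine (integrableOn_tricomi_majorant (s := a.re - 1) (by linarith) hx c.re).mono'
    ((continuousOn_tricomi_integrand a c x).aestronglyMeasurable measurableSet_Ioi) ?_
  filter_upwards [ae_restrict_mem measurableSet_Ioi] with t ht
  rw [norm_tricomi_integrand ht]

theorem cpow_sub_one_mul {t : ℝ} (ht : 0 < t) (a : ℂ) : (t : ℂ) ^ (a - 1) * t = (t : ℂ) ^ a := by
  have : (t : ℂ) ≠ 0 := by exact_mod_cast ht.ne'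
  rw [Complex.cpow_sub _ _ this, Complex.cpow_one, div_mul_cancel₀ _ this]

theorem one_add_cpow_sub_one_mul {t : ℝ} (ht : 0 < t) (c : ℂ) :
    (1 + t : ℂ) ^ (c - 1) * (1 + t) = (1 + t : ℂ) ^ c := by
  have : (1 + t : ℂ) ≠ 0 := by
    exact_mod_cast (by linarith : (1 + t : ℝ) ≠ 0)
  rw [Complex.cpow_sub _ _ this, Complex.cpow_one, div_mul_cancel₀ _ this]

/-- Differentiation under the integral brings down `-t`, i.e. raises `a` by one. On `y > x/2` the
derivative is dominated by the integrand at `x/2`. -/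
theorem hasDerivAt_tricomiInt {a : ℂ} (ha : 0 < a.re) {x : ℝ} (hx : 0 < x) (c : ℂ) :
    HasDerivAt (tricomiInt a c) (-tricomiInt (a + 1) c x) x := by
  have h := hasDerivAt_integral_of_dominated_loc_of_deriv_le (𝕜 := ℝ) (x₀ := x)
    (s := Ioi (x / 2)) (μ := volume.restrict (Ioi (0 : ℝ)))
    (F := fun x t => Complex.exp (-x * t) * (t : ℂ) ^ (a - 1) * (1 + t : ℂ) ^ c)
    (F' := fun x t => -(Complex.exp (-x * t) * (t : ℂ) ^ (a + 1 - 1) * (1 + t : ℂ) ^ c))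
    (bound := fun t => Real.exp (-(x / 2) * t) * t ^ ((a + 1).re - 1) * (1 + t) ^ c.re)
    (Ioi_mem_nhds (by linarith))
    (Eventually.of_forall fun y =>
      (continuousOn_tricomi_integrand a c y).aestronglyMeasurable measurableSet_Ioi)
    (integrableOn_tricomi ha hx c)
    ((continuousOn_tricomi_integrand (a + 1) c x).aestronglyMeasurable measurableSet_Ioi).neg
    ?_ (integrableOn_tricomi_majorant (by simp; linarith) (half_pos hx) c.re) ?_
  · refine h.2.congr_deriv ?_
    rw [integral_neg]
    rfl
  · filter_upwards [ae_restrict_mem measurableSet_Ioi] with t ht y hy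
    have ht' : 0 < t := ht
    have hy' : x / 2 < y := hy
    rw [norm_neg, norm_tricomi_integrand ht]
    refine mul_le_mul_of_nonneg_right (mul_le_mul_of_nonneg_right ?_
      (Real.rpow_nonneg ht'.le _)) (Real.rpow_nonneg (by linarith) _)
    refine Real.exp_le_exp.2 ?_
    nlinarith
  · filter_upwards [ae_restrict_mem measurableSet_Ioi] with t ht y hy
    have h1 : HasDerivAt (fun y : ℝ => Complex.exp (-y * t)) (Complex.exp (-y * t) * (-t)) y := by
      have : HasDerivAt (fun y : ℝ => (-y * t : ℂ)) (-t) y := by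
        have := (Complex.ofRealCLM.hasDerivAt (x := y)).neg.mul_const (t : ℂ)
        simpa using this
      exact this.cexp
    refine ((h1.mul_const _).mul_const _).congr_deriv ?_
    rw [add_sub_cancel_right, ← cpow_sub_one_mul ht a]
    ring

/-- Expand `(1+t)^{c+1} = (1+t)^c + t (1+t)^c` in the integrand. -/
theorem tricomiInt_add_one {a : ℂ} (ha : 0 < a.re) {x : ℝ} (hx : 0 < x) (c : ℂ) :
    tricomiInt a (c + 1) x = tricomiInt a c x + tricomiInt (a + 1) c x := by
  rw [tricomiInt, tricomiInt, tricomiInt, ← integral_add (integrableOn_tricomi ha hx c)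
    (integrableOn_tricomi (a := a + 1) (by simp; linarith) hx c)]
  refine setIntegral_congr_fun measurableSet_Ioi fun t ht => ?_
  have h1 := one_add_cpow_sub_one_mul ht (c + 1)
  have h2 := cpow_sub_one_mul ht a
  rw [add_sub_cancel_right] at h1
  simp only [add_sub_cancel_right]
  rw [← h1, ← h2]
  ring

/-- Integral over the half-line of the derivative of `e^{-xt} t^a (1+t)^c`, which vanishes at both
ends. -/
theorem tricomiInt_by_parts {a : ℂ} (ha : 0 < a.re) {x : ℝ} (hx : 0 < x) (c : ℂ) :
    -x * tricomiInt (a + 1) c x + a * tricomiInt a c x + c * tricomiInt (a + 1) (c - 1) x = 0 := by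
  have ha1 : 0 < (a + 1).re := by simp; linarith
  have ha0 : a ≠ 0 := fun h => by simp [h] at ha
  have i1 := integrableOn_tricomi ha1 hx c
  have i2 := integrableOn_tricomi ha hx c
  have i3 := integrableOn_tricomi ha1 hx (c - 1)
  have i12 : IntegrableOn (fun t : ℝ =>
      (-x : ℂ) * (Complex.exp (-x * t) * (t : ℂ) ^ (a + 1 - 1) * (1 + t : ℂ) ^ c) +
      a * (Complex.exp (-x * t) * (t : ℂ) ^ (a - 1) * (1 + t : ℂ) ^ c)) (Ioi 0) :=
    (i1.const_mul (-x : ℂ)).add (i2.const_mul a)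
  have hint : IntegrableOn (fun t : ℝ =>
      (-x : ℂ) * (Complex.exp (-x * t) * (t : ℂ) ^ (a + 1 - 1) * (1 + t : ℂ) ^ c) +
      a * (Complex.exp (-x * t) * (t : ℂ) ^ (a - 1) * (1 + t : ℂ) ^ c) +
      c * (Complex.exp (-x * t) * (t : ℂ) ^ (a + 1 - 1) * (1 + t : ℂ) ^ (c - 1))) (Ioi 0) :=
    i12.add (i3.const_mul c)
  have hcont : ContinuousWithinAt
      (fun t : ℝ => Complex.exp (-x * t) * (t : ℂ) ^ a * (1 + t : ℂ) ^ c) (Ici 0) 0 := by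
    refine ContinuousAt.continuousWithinAt ?_
    refine ((by fun_prop : ContinuousAt (fun t : ℝ => Complex.exp (-x * t)) 0).mul
      (Complex.continuous_ofReal_cpow_const ha).continuousAt).mul ?_
    refine ContinuousAt.cpow (by fun_prop) continuousAt_const ?_
    simp
  have htend : Tendsto (fun t : ℝ => Complex.exp (-x * t) * (t : ℂ) ^ a * (1 + t : ℂ) ^ c) atTop
      (𝓝 0) := by
    obtain ⟨C, hC, h⟩ := exists_rpow_le_exp c.re (half_pos hx)
    have h1 := (tendsto_rpow_mul_exp_neg_mul_atTop_nhds_zero a.re (x / 2) (half_pos hx)).const_mul C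
    rw [mul_zero] at h1
    refine squeeze_zero_norm' ?_ h1
    filter_upwards [eventually_gt_atTop 0] with t ht
    have := norm_tricomi_integrand (a := a + 1) (c := c) (x := x) ht
    simp only [add_sub_cancel_right] at this
    rw [this, Complex.add_re, Complex.one_re, add_sub_cancel_right]
    have hr := Real.rpow_nonneg ht.le a.re
    calc Real.exp (-x * t) * t ^ a.re * (1 + t) ^ c.re
        ≤ Real.exp (-x * t) * t ^ a.re * (C * Real.exp (x / 2 * t)) :=
          mul_le_mul_of_nonneg_left (h t ht) (mul_nonneg (Real.exp_pos _).le hr)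
      _ = C * (t ^ a.re * (Real.exp (-x * t) * Real.exp (x / 2 * t))) := by ring
      _ = C * (t ^ a.re * Real.exp (-(x / 2) * t)) := by
          rw [← Real.exp_add]
          ring_nf
  have key := integral_Ioi_of_hasDerivAt_of_tendsto hcont (fun t ht => ?_) hint htend
  · rw [integral_add i12 (i3.const_mul c),
      integral_add (i1.const_mul (-x : ℂ)) (i2.const_mul a), integral_const_mul,
      integral_const_mul, integral_const_mul] at key
    simp only [Complex.ofReal_zero, Complex.zero_cpow ha0, mul_zero, zero_mul, sub_zero] at key
    exact key
  · have ht' : (0 : ℝ) < t := ht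
    have h1 : HasDerivAt (fun t : ℝ => Complex.exp (-x * t)) (Complex.exp (-x * t) * (-x)) t := by
      have : HasDerivAt (fun t : ℝ => (-x * t : ℂ)) (-x) t := by
        have := (Complex.ofRealCLM.hasDerivAt (x := t)).const_mul (-x : ℂ)
        simpa using this
      exact this.cexp
    have h2 := hasDerivAt_ofReal_cpow_const ht'.ne' ha0
    have h3 : HasDerivAt (fun t : ℝ => (1 + t : ℂ) ^ c) (c * (1 + t : ℂ) ^ (c - 1)) t := by
      have h5 : (1 + t : ℂ) ∈ Complex.slitPlane := by
        left
        simp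
        linarith
      have h4 : HasDerivAt (fun z : ℂ => (1 + z) ^ c) (c * (1 + t : ℂ) ^ (c - 1)) (t : ℂ) := by
        simpa using ((hasDerivAt_id (t : ℂ)).const_add 1).cpow_const h5
      exact h4.comp_ofReal
    refine ((h1.mul h2).mul h3).congr_deriv ?_
    simp only [add_sub_cancel_right, Pi.mul_apply]
    ring

end ConfluentFunctions

/-! ### Tricomi's function for arbitrary parameters: consistency, equation, asymptotics. -/

section TricomiFunction

theorem tricomiUAux_one (a b : ℂ) (ha : 0 < a.re) {x : ℝ} (hx : 0 < x) :
    tricomiUAux 1 a b x = tricomiUAux 0 a b x := by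
  have ha0 : a ≠ 0 := fun h => by simp [h] at ha
  have hG := Complex.Gamma_ne_zero_of_re_pos ha
  have h := tricomiInt_by_parts ha hx (b - a - 1)
  change x * tricomiUAux 0 (a + 1) (b + 1) x + (a + 1 - b) * tricomiUAux 0 (a + 1) b x = _
  rw [tricomiUAux_zero, tricomiUAux_zero, tricomiUAux_zero, Complex.Gamma_add_one a ha0]
  have e1 : b + 1 - (a + 1) - 1 = b - a - 1 := by ring
  have e2 : b - (a + 1) - 1 = b - a - 1 - 1 := by ring
  rw [e1, e2]
  field_simp
  linear_combination (-1 : ℂ) * h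

/-- Raising steps beyond those needed do not change the value: for one step this is integration by
parts, and the rest is induction. So functions with shifted parameters can all be computed with the
same `n`. -/
theorem tricomiUAux_succ (n : ℕ) (a b : ℂ) {x : ℝ} (hx : 0 < x) (ha : 0 < a.re + n) :
    tricomiUAux (n + 1) a b x = tricomiUAux n a b x := by
  induction n generalizing a b with
  | zero => exact tricomiUAux_one a b (by simpa using ha) hx
  | succ n ih =>
    have ha' : 0 < (a + 1).re + n := by
      push_cast at ha
      simp only [Complex.add_re, Complex.one_re]
      linarith
    rw [tricomiUAux, ih _ _ ha', ih _ _ ha', tricomiUAux]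

theorem tricomiUAux_contiguous (n : ℕ) (a b : ℂ) {x : ℝ} (hx : 0 < x) (ha : 0 < a.re + n) :
    tricomiUAux n a b x =
      x * tricomiUAux n (a + 1) (b + 1) x + (a + 1 - b) * tricomiUAux n (a + 1) b x := by
  rw [← tricomiUAux_succ n a b hx ha, tricomiUAux]

theorem re_add_one_add_pos {a : ℂ} {n : ℕ} (ha : 0 < a.re + (n + 1 : ℕ)) :
    0 < (a + 1).re + n := by
  push_cast at ha
  simp only [Complex.add_re, Complex.one_re]
  linarith

theorem re_add_one_add_pos' {a : ℂ} {n : ℕ} (ha : 0 < a.re + n) : 0 < (a + 1).re + n := by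
  simp only [Complex.add_re, Complex.one_re]
  linarith

/-- The base case is differentiation of the integral. In the inductive step, the derivative of the
factor `x` in the recursion is absorbed by the contiguous relation. -/
theorem hasDerivAt_tricomiUAux (n : ℕ) (a b : ℂ) {x : ℝ} (hx : 0 < x) (ha : 0 < a.re + n) :
    HasDerivAt (fun x : ℝ => tricomiUAux n a b x) (-a * tricomiUAux n (a + 1) (b + 1) x) x := by
  induction n generalizing a b with
  | zero =>
    have ha : 0 < a.re := by simpa using ha
    have ha0 : a ≠ 0 := fun h => by simp [h] at ha
    have hG := Complex.Gamma_ne_zero_of_re_pos ha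
    simp only [tricomiUAux_zero]
    refine ((hasDerivAt_tricomiInt ha hx (b - a - 1)).const_mul _).congr_deriv ?_
    rw [Complex.Gamma_add_one a ha0, show b + 1 - (a + 1) - 1 = b - a - 1 by ring]
    field_simp
  | succ n ih =>
    have ha' := re_add_one_add_pos ha
    have h1 := (Complex.ofRealCLM.hasDerivAt (x := x)).mul (ih (a + 1) (b + 1) ha')
    have h2 := (ih (a + 1) b ha').const_mul (a + 1 - b)
    refine (h1.add h2).congr_deriv ?_
    have h3 := tricomiUAux_contiguous n (a + 1) (b + 1) hx ha'
    rw [tricomiUAux_succ n (a + 1) (b + 1) hx ha']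
    simp only [Complex.ofRealCLM_apply, Complex.ofReal_one, one_mul]
    linear_combination (a + 1) * h3

/-- Kummer's equation with `U' = -a U(a+1, b+1)` and `U'' = a (a+1) U(a+2, b+2)` inserted and the
common factor `a` removed. For `Re a > 0` it is a combination of integration by parts and the
splitting of `(1+t)^{c+1}`; the recursion then carries it to smaller `Re a`. -/
theorem tricomiUAux_ode (n : ℕ) (a b : ℂ) {x : ℝ} (hx : 0 < x) (ha : 0 < a.re + n) :
    x * (a + 1) * tricomiUAux n (a + 1 + 1) (b + 1 + 1) x -
      (b - x) * tricomiUAux n (a + 1) (b + 1) x - tricomiUAux n a b x = 0 := by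
  induction n generalizing a b with
  | zero =>
    have ha : 0 < a.re := by simpa using ha
    have ha1 : 0 < (a + 1).re := by simp; linarith
    have ha0 : a ≠ 0 := fun h => by simp [h] at ha
    have ha10 : a + 1 ≠ 0 := fun h => by simp [h] at ha1
    have hG := Complex.Gamma_ne_zero_of_re_pos ha
    have j1 := tricomiInt_add_one ha1 hx (b - a - 1)
    have j2 := tricomiInt_by_parts ha hx (b - a - 1 + 1)
    have j3 := tricomiInt_add_one ha hx (b - a - 1)
    simp only [tricomiUAux_zero]
    rw [Complex.Gamma_add_one _ ha10, Complex.Gamma_add_one a ha0,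
      show b + 1 - (a + 1) - 1 = b - a - 1 by ring,
      show b + 1 + 1 - (a + 1 + 1) - 1 = b - a - 1 by ring]
    rw [add_sub_cancel_right (b - a - 1)] at j2
    field_simp
    linear_combination (-x : ℂ) * j1 - j2 + a * j3
  | succ n ih =>
    have ha' := re_add_one_add_pos ha
    have q1 := ih (a + 1) (b + 1) ha'
    have q2 := ih (a + 1) b ha'
    have h3 := tricomiUAux_contiguous n (a + 1 + 1) (b + 1 + 1) hx (re_add_one_add_pos' ha')
    simp only [tricomiUAux]
    linear_combination (x : ℂ) * q1 + (a + 1 - b) * q2 + (x : ℂ) * h3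

/-- The substitution `s = x t` gives `∫ e^{-s} s^{a-1} (1 + s/x)^c ds`, which tends to the Gamma
integral; for `x ≥ 1` the last factor is dominated by `(1+s)^{|Re c|}`. -/
theorem tendsto_cpow_mul_tricomiInt {a : ℂ} (ha : 0 < a.re) (c : ℂ) :
    Tendsto (fun x : ℝ => (x : ℂ) ^ a * tricomiInt a c x) atTop (𝓝 (Complex.Gamma a)) := by
  have key : ∀ x : ℝ, 0 < x → (x : ℂ) ^ a * tricomiInt a c x =
      ∫ s in Ioi (0 : ℝ), Complex.exp (-s) * (s : ℂ) ^ (a - 1) * (1 + s / x : ℂ) ^ c := by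
    intro x hx
    have hx0 : (x : ℂ) ≠ 0 := by exact_mod_cast hx.ne'
    have h := integral_comp_mul_left_Ioi
      (fun s : ℝ => Complex.exp (-s) * (s : ℂ) ^ (a - 1) * (1 + s / x : ℂ) ^ c) 0 hx
    rw [mul_zero] at h
    have h2 : ∫ s in Ioi (0 : ℝ), Complex.exp (-s) * (s : ℂ) ^ (a - 1) * (1 + s / x : ℂ) ^ c =
        x * ∫ t in Ioi (0 : ℝ), Complex.exp (-(x * t : ℝ)) * ((x * t : ℝ) : ℂ) ^ (a - 1) *
          (1 + (x * t : ℝ) / x : ℂ) ^ c := by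
      rw [h, Complex.real_smul, Complex.ofReal_inv, mul_inv_cancel_left₀ hx0]
    rw [h2, tricomiInt, ← integral_const_mul, ← integral_const_mul]
    refine setIntegral_congr_fun measurableSet_Ioi fun t ht => ?_
    have ht' : (0 : ℝ) < t := ht
    have e1 := cpow_sub_one_mul hx a
    have e2 : ((x * t : ℝ) : ℂ) / x = t := by
      push_cast
      field_simp
    simp only [e2]
    rw [← e1, Complex.ofReal_mul, Complex.mul_cpow_ofReal_nonneg hx.le ht'.le, neg_mul]
    ring
  have hG : Complex.Gamma a = ∫ s in Ioi (0 : ℝ), Complex.exp (-s) * (s : ℂ) ^ (a - 1) := by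
    rw [Complex.Gamma_eq_integral ha, Complex.GammaIntegral]
    refine setIntegral_congr_fun measurableSet_Ioi fun t _ => ?_
    simp
  rw [hG]
  refine Tendsto.congr' (f₁ := fun x : ℝ =>
    ∫ s in Ioi (0 : ℝ), Complex.exp (-s) * (s : ℂ) ^ (a - 1) * (1 + s / x : ℂ) ^ c) ?_ ?_
  · filter_upwards [eventually_gt_atTop 0] with x hx
    exact (key x hx).symm
  refine tendsto_integral_filter_of_dominated_convergence
    (fun s => Real.exp (-1 * s) * s ^ (a.re - 1) * (1 + s) ^ |c.re|) ?_ ?_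
    (integrableOn_tricomi_majorant (by linarith) one_pos _) ?_
  · filter_upwards [eventually_gt_atTop 0] with x hx
    refine ContinuousOn.aestronglyMeasurable (fun s hs => ?_) measurableSet_Ioi
    have hs' : (0 : ℝ) < s := hs
    have hd : 0 < s / x := by positivity
    refine ContinuousAt.continuousWithinAt ?_
    refine ((by fun_prop : ContinuousAt (fun t : ℝ => Complex.exp (-t)) s).mul
      (Complex.continuousAt_ofReal_cpow_const _ _ (Or.inr hs'.ne'))).mul ?_
    refine ContinuousAt.cpow (by fun_prop) continuousAt_const ?_
    left
    rw [← Complex.ofReal_div, Complex.add_re, Complex.one_re, Complex.ofReal_re]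
    linarith
  · filter_upwards [eventually_ge_atTop 1] with x hx
    filter_upwards [ae_restrict_mem measurableSet_Ioi] with s hs
    have hs' : (0 : ℝ) < s := hs
    have hx0 : 0 < x := by linarith
    have hd : 0 < s / x := by positivity
    have hd1 : s / x ≤ s := div_le_self hs'.le hx
    have e : (1 + s / x : ℂ) = ((1 + s / x : ℝ) : ℂ) := by push_cast; rfl
    rw [norm_mul, norm_mul, e, Complex.norm_cpow_eq_rpow_re_of_pos hs',
      Complex.norm_cpow_eq_rpow_re_of_pos (by linarith), Complex.norm_exp]
    simp only [Complex.neg_re, Complex.ofReal_re, Complex.sub_re, Complex.one_re, neg_mul, one_mul]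
    refine mul_le_mul_of_nonneg_left ?_
      (mul_nonneg (Real.exp_pos _).le (Real.rpow_nonneg hs'.le _))
    calc (1 + s / x) ^ c.re ≤ (1 + s / x) ^ |c.re| :=
          Real.rpow_le_rpow_of_exponent_le (by linarith) (le_abs_self _)
      _ ≤ (1 + s) ^ |c.re| := Real.rpow_le_rpow (by linarith) (by linarith) (abs_nonneg _)
  · filter_upwards with s
    have h1 : Tendsto (fun x : ℝ => (1 + s / x : ℂ)) atTop (𝓝 1) := by
      have h2 : Tendsto (fun x : ℝ => 1 + s / x) atTop (𝓝 (1 + 0)) :=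
        tendsto_const_nhds.add (tendsto_const_nhds.div_atTop tendsto_id)
      have := (Complex.continuous_ofReal.tendsto _).comp h2
      simpa [Function.comp_def] using this
    have h3 := h1.cpow (tendsto_const_nhds (x := c)) (by simp)
    rw [Complex.one_cpow] at h3
    simpa using h3.const_mul (Complex.exp (-s) * (s : ℂ) ^ (a - 1))

/-- In the recursion the first term carries the leading behaviour `x^{-a}`; the second is smaller by
a factor `1/x`. -/
theorem tendsto_cpow_mul_tricomiUAux (n : ℕ) (a b : ℂ) (ha : 0 < a.re + n) :
    Tendsto (fun x : ℝ => (x : ℂ) ^ a * tricomiUAux n a b x) atTop (𝓝 1) := by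
  induction n generalizing a b with
  | zero =>
    have ha : 0 < a.re := by simpa using ha
    have hG := Complex.Gamma_ne_zero_of_re_pos ha
    have h := (tendsto_cpow_mul_tricomiInt ha (b - a - 1)).const_mul (Complex.Gamma a)⁻¹
    rw [inv_mul_cancel₀ hG] at h
    refine h.congr fun x => ?_
    rw [tricomiUAux_zero]
    ring
  | succ n ih =>
    have ha' := re_add_one_add_pos ha
    have h1 := ih (a + 1) (b + 1) ha'
    have h2 := ih (a + 1) b ha'
    have h3 : Tendsto (fun x : ℝ => (x : ℂ)⁻¹) atTop (𝓝 0) := by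
      have := (Complex.continuous_ofReal.tendsto _).comp tendsto_inv_atTop_zero
      simpa [Function.comp_def] using this
    have h4 := h1.add ((h3.mul h2).const_mul (a + 1 - b))
    simp only [zero_mul, mul_zero, add_zero] at h4
    refine h4.congr' ?_
    filter_upwards [eventually_gt_atTop 0] with x hx
    have hx0 : (x : ℂ) ≠ 0 := by exact_mod_cast hx.ne'
    have e := cpow_sub_one_mul hx (a + 1)
    rw [add_sub_cancel_right] at e
    rw [tricomiUAux, ← e]
    field_simp

/-- The bases `t` and `1 + t` of the complex powers are positive, so conjugation never meets the
branch cut. -/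
theorem conj_tricomiUAux (n : ℕ) (a b : ℂ) (x : ℝ) :
    conj (tricomiUAux n a b x) = tricomiUAux n (conj a) (conj b) x := by
  induction n generalizing a b with
  | zero =>
    rw [tricomiUAux_zero, tricomiUAux_zero, map_mul, map_inv₀, ← Complex.Gamma_conj, tricomiInt,
      tricomiInt, ← integral_conj]
    congr 1
    refine setIntegral_congr_fun measurableSet_Ioi fun t ht => ?_
    have ht' : (0 : ℝ) < t := ht
    have e1 : (t : ℂ).arg ≠ Real.pi := by
      rw [Complex.arg_ofReal_of_nonneg ht'.le]
      exact Real.pi_ne_zero.symm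
    have e2 : (1 + t : ℂ).arg ≠ Real.pi := by
      rw [show (1 + t : ℂ) = ((1 + t : ℝ) : ℂ) by push_cast; rfl,
        Complex.arg_ofReal_of_nonneg (by linarith)]
      exact Real.pi_ne_zero.symm
    simp only [map_mul, ← Complex.exp_conj, map_neg, Complex.conj_ofReal]
    have e3 := Complex.cpow_conj _ (a - 1) e1
    have e4 := Complex.cpow_conj _ (b - a - 1) e2
    simp only [map_add, map_sub, map_one, Complex.conj_ofReal] at e3 e4
    rw [e3, e4]
  | succ n ih =>
    simp only [tricomiUAux, map_add, map_mul, map_sub, map_one, ih, Complex.conj_ofReal]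

theorem re_add_floor_pos (a : ℂ) : 0 < a.re + (⌊1 - a.re⌋₊ : ℕ) := by
  have := Nat.lt_floor_add_one (1 - a.re)
  linarith

theorem conj_tricomiU (a b : ℂ) (x : ℝ) :
    conj (tricomiU a b x) = tricomiU (conj a) (conj b) x := by
  rw [tricomiU, tricomiU, conj_tricomiUAux, Complex.conj_re]

end TricomiFunction

/-! ### The radial solutions `F` and `G` at complex energy. -/

section RadialSolutions

/-! ### The radial solutions -/

/-- The prefactor `r^{1/2+|m|} e^{-Br²/4}` of the radial solutions. -/
def radialWeight (B : ℝ) (m : ℤ) (r : ℝ) : ℝ :=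
  r ^ (1 / 2 + (|m| : ℤ) : ℝ) * Real.exp (-(B * r ^ 2 / 4))

theorem hasDerivAt_radialWeight (B : ℝ) (m : ℤ) {r : ℝ} (hr : 0 < r) :
    HasDerivAt (radialWeight B m)
      (radialWeight B m r * ((1 / 2 + (|m| : ℤ)) / r - B / 2 * r)) r := by
  have h1 := Real.hasDerivAt_rpow_const (x := r) (p := 1 / 2 + (|m| : ℤ)) (Or.inl hr.ne')
  have h2 : HasDerivAt (fun r : ℝ => -(B * r ^ 2 / 4)) (-(B / 2 * r)) r := by
    refine ((((hasDerivAt_pow 2 r).const_mul B).div_const 4).neg).congr_deriv ?_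
    norm_num
    ring
  refine (h1.mul h2.exp).congr_deriv ?_
  rw [radialWeight, Real.rpow_sub_one hr.ne']
  ring

theorem kummerParam_eq {B : ℝ} (hB : B ≠ 0) (i : Fin 2) (m : ℤ) (k : ℂ) :
    2 * B * kummerParam B i m k = B * ((|m| : ℤ) + m + 1 + spinSign i) - k := by
  have : (B : ℂ) ≠ 0 := by exact_mod_cast hB
  rw [kummerParam]
  push_cast
  field_simp
  ring

/-- Change of variable `z = Br²/2` with prefactor `r^{1/2+|m|} e^{-Br²/4}`, done once for an
abstract solution of Kummer's equation so that it serves both `F` and `G`. -/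
theorem hasDerivAt_radial_of_kummer {B : ℝ} (hB : 0 < B) (i : Fin 2) (m : ℤ) (k : ℂ)
    {w w₁ w₂ : ℝ → ℂ} (hw : ∀ z, 0 < z → HasDerivAt w (w₁ z) z)
    (hw₁ : ∀ z, 0 < z → HasDerivAt w₁ (w₂ z) z)
    (hode : ∀ z : ℝ, 0 < z →
      z * w₂ z + ((|m| : ℤ) + 1 - z) * w₁ z - kummerParam B i m k * w z = 0)
    {u : ℝ → ℂ} (hu : ∀ r, u r = radialWeight B m r * w (B / 2 * r ^ 2)) {r : ℝ} (hr : 0 < r) :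
    HasDerivAt u (deriv u r) r ∧
      HasDerivAt (deriv u) ((radialPotential B i m r - k) * u r) r := by
  set ψ : ℝ → ℝ := fun r => (1 / 2 + (|m| : ℤ)) / r - B / 2 * r with hψ
  have hz : ∀ r : ℝ, 0 < r → 0 < B / 2 * r ^ 2 := fun r hr => by positivity
  have hzd : ∀ r : ℝ, HasDerivAt (fun r : ℝ => B / 2 * r ^ 2) (B * r) r := fun r => by
    refine ((hasDerivAt_pow 2 r).const_mul (B / 2)).congr_deriv ?_
    norm_num
    ring
  have hW : ∀ r : ℝ, 0 < r → HasDerivAt (fun r => (radialWeight B m r : ℂ))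
      (radialWeight B m r * ψ r : ℝ) r := fun r hr => (hasDerivAt_radialWeight B m hr).ofReal_comp
  have h0 : ∀ r : ℝ, 0 < r → HasDerivAt u (radialWeight B m r *
      (ψ r * w (B / 2 * r ^ 2) + B * r * w₁ (B / 2 * r ^ 2))) r := by
    intro r hr
    have h1 := (hw _ (hz r hr)).scomp r (hzd r)
    have h2 := (hW r hr).mul h1
    rw [show u = fun r => radialWeight B m r * w (B / 2 * r ^ 2) from funext hu]
    refine h2.congr_deriv ?_
    rw [Complex.real_smul]
    simp only [Function.comp_apply]
    push_cast
    ring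
  have hd : deriv u =ᶠ[𝓝 r] fun r => radialWeight B m r *
      (ψ r * w (B / 2 * r ^ 2) + B * r * w₁ (B / 2 * r ^ 2)) := by
    filter_upwards [Ioi_mem_nhds hr] with s hs
    exact (h0 s hs).deriv
  refine ⟨(h0 r hr).differentiableAt.hasDerivAt, HasDerivAt.congr_of_eventuallyEq ?_ hd⟩
  have hψd : HasDerivAt (fun r => (ψ r : ℂ)) (-(1 / 2 + (|m| : ℤ)) / r ^ 2 - B / 2 : ℝ) r := by
    have h1 : HasDerivAt ψ (-(1 / 2 + (|m| : ℤ)) / r ^ 2 - B / 2) r := by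
      refine (((hasDerivAt_inv hr.ne').const_mul (1 / 2 + (|m| : ℤ) : ℝ)).sub
        ((hasDerivAt_id r).const_mul (B / 2))).congr_deriv ?_
      field_simp
    exact h1.ofReal_comp
  have hrd : HasDerivAt (fun r : ℝ => (B * r : ℂ)) B r := by
    have h1 : HasDerivAt (fun r : ℝ => B * r) B r := by
      simpa using (hasDerivAt_id r).const_mul B
    simpa using h1.ofReal_comp
  have h1 := (hw _ (hz r hr)).scomp r (hzd r)
  have h2 := (hw₁ _ (hz r hr)).scomp r (hzd r)
  have h3 := (hW r hr).mul ((hψd.mul h1).add (hrd.mul h2))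
  refine h3.congr_deriv ?_
  have ho := hode _ (hz r hr)
  have hk := kummerParam_eq hB.ne' i m k
  have hm : (((|m| : ℤ) : ℂ)) ^ 2 = (m : ℂ) ^ 2 := by
    exact_mod_cast sq_abs m
  have hr1 : (r : ℂ) * (r : ℂ)⁻¹ = 1 := mul_inv_cancel₀ (by exact_mod_cast hr.ne')
  simp only [Complex.real_smul, Function.comp_apply, Pi.mul_apply, Pi.add_apply, hu r,
    radialPotential, hψ]
  push_cast [-Int.cast_abs] at ho ⊢
  -- Kummer's equation enters with factor `2B` because `(dz/dr)² = B² r² = 2 B z`; the other terms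
  -- use the value of `a`, `|m|² = m²` and `r r⁻¹ = 1`.
  linear_combination (2 * B * radialWeight B m r : ℂ) * ho +
    (radialWeight B m r * w (B / 2 * r ^ 2) : ℂ) * hk +
    (radialWeight B m r * w (B / 2 * r ^ 2) * (r : ℂ)⁻¹ ^ 2 : ℂ) * hm +
    (radialWeight B m r * (2 * (1 / 2 + (|m| : ℤ)) * B * w₁ (B / 2 * r ^ 2) -
      ((1 / 2 + (|m| : ℤ)) * B + m * B) * w (B / 2 * r ^ 2)) : ℂ) * hr1

theorem abs_add_one_ne_neg (m : ℤ) (n : ℕ) : (((|m| : ℤ) : ℂ) + 1) ≠ -n := by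
  have h : (0 : ℤ) < |m| + 1 + n := by positivity
  intro h'
  have : (((|m| + 1 + n : ℤ)) : ℂ) = 0 := by
    push_cast
    linear_combination h'
  exact h.ne' (by exact_mod_cast this)

theorem hasDerivAt_solF_aux {B : ℝ} (hB : 0 < B) (i : Fin 2) (m : ℤ) (k : ℂ) {r : ℝ}
    (hr : 0 < r) :
    HasDerivAt (solF B i m k) (deriv (solF B i m k) r) r ∧
      HasDerivAt (deriv (solF B i m k)) ((radialPotential B i m r - k) * solF B i m k r) r := by
  have hb := abs_add_one_ne_neg m
  have hb1 : ∀ n : ℕ, ((|m| : ℤ) : ℂ) + 1 + 1 ≠ -n :=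
    fun n h => hb (n + 1) (by push_cast; linear_combination h)
  set a := kummerParam B i m k
  set b : ℂ := ((|m| : ℤ) : ℂ) + 1
  refine hasDerivAt_radial_of_kummer hB i m k (w := fun z => kummerM a b z)
    (fun z _ => (hasDerivAt_kummerM a b z hb).comp_ofReal)
    (fun z _ => ((hasDerivAt_kummerM (a + 1) (b + 1) z hb1).const_mul (a / b)).comp_ofReal)
    (fun z _ => kummerM_ode a b z hb) (fun r => rfl) hr

theorem hasDerivAt_solG_aux {B : ℝ} (hB : 0 < B) (i : Fin 2) (m : ℤ) (k : ℂ) {r : ℝ}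
    (hr : 0 < r) :
    HasDerivAt (solG B i m k) (deriv (solG B i m k) r) r ∧
      HasDerivAt (deriv (solG B i m k)) ((radialPotential B i m r - k) * solG B i m k r) r := by
  set a := kummerParam B i m k
  set b : ℂ := ((|m| : ℤ) : ℂ) + 1
  have hn := re_add_floor_pos a
  refine hasDerivAt_radial_of_kummer hB i m k (w := fun z => tricomiUAux ⌊1 - a.re⌋₊ a b z)
    (fun z hz => hasDerivAt_tricomiUAux _ a b hz hn)
    (fun z hz => (hasDerivAt_tricomiUAux _ (a + 1) (b + 1) hz
      (re_add_one_add_pos' hn)).const_mul (-a))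
    (fun z hz => ?_) (fun r => rfl) hr
  linear_combination a * tricomiUAux_ode _ a b hz hn

variable {B R : ℝ}

theorem hasDerivAt_solF (hB : 0 < B) (i : Fin 2) (m : ℤ) (k : ℂ) {r : ℝ} (hr : 0 < r) :
    HasDerivAt (solF B i m k) (deriv (solF B i m k) r) r :=
  (hasDerivAt_solF_aux hB i m k hr).1

theorem hasDerivAt_deriv_solF (hB : 0 < B) (i : Fin 2) (m : ℤ) (k : ℂ) {r : ℝ} (hr : 0 < r) :
    HasDerivAt (deriv (solF B i m k)) ((radialPotential B i m r - k) * solF B i m k r) r :=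
  (hasDerivAt_solF_aux hB i m k hr).2

theorem hasDerivAt_solG (hB : 0 < B) (i : Fin 2) (m : ℤ) (k : ℂ) {r : ℝ} (hr : 0 < r) :
    HasDerivAt (solG B i m k) (deriv (solG B i m k) r) r :=
  (hasDerivAt_solG_aux hB i m k hr).1

theorem hasDerivAt_deriv_solG (hB : 0 < B) (i : Fin 2) (m : ℤ) (k : ℂ) {r : ℝ} (hr : 0 < r) :
    HasDerivAt (deriv (solG B i m k)) ((radialPotential B i m r - k) * solG B i m k r) r :=
  (hasDerivAt_solG_aux hB i m k hr).2

theorem wronskian_eq (hB : 0 < B) (hR : 0 < R) (i : Fin 2) (m : ℤ) (k : ℂ) {r : ℝ} (hr : 0 < r) :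
    solG B i m k r * deriv (solF B i m k) r - deriv (solG B i m k) r * solF B i m k r =
      wronskianGF B R i m k := by
  refine eq_of_hasDerivAt_zero isOpen_Ioi isPreconnected_Ioi
    (w := fun r => solG B i m k r * deriv (solF B i m k) r -
      deriv (solG B i m k) r * solF B i m k r) (fun s hs => ?_) hr hR
  refine (((hasDerivAt_solG hB i m k hs).mul (hasDerivAt_deriv_solF hB i m k hs)).sub
    ((hasDerivAt_deriv_solG hB i m k hs).mul (hasDerivAt_solF hB i m k hs))).congr_deriv ?_
  ring

theorem continuous_radialWeight (B : ℝ) (m : ℤ) : Continuous (radialWeight B m) := by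
  unfold radialWeight
  refine Continuous.mul (Real.continuous_rpow_const ?_) (by fun_prop)
  positivity

theorem continuous_kummerM (a b : ℂ) (hb : ∀ n : ℕ, b ≠ -n) : Continuous (kummerM a b) :=
  continuous_iff_continuousAt.2 fun z => (hasDerivAt_kummerM a b z hb).continuousAt

theorem continuous_kummerM_comp (B : ℝ) (i : Fin 2) (m : ℤ) (k : ℂ) :
    Continuous fun r : ℝ =>
      kummerM (kummerParam B i m k) ((|m| : ℤ) + 1) (B / 2 * r ^ 2 : ℝ) :=
  (continuous_kummerM _ _ (abs_add_one_ne_neg m)).comp (by fun_prop)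

theorem continuous_solF (B : ℝ) (i : Fin 2) (m : ℤ) (k : ℂ) : Continuous (solF B i m k) :=
  (Complex.continuous_ofReal.comp (continuous_radialWeight B m)).mul
    (continuous_kummerM_comp B i m k)

theorem radialWeight_pos (B : ℝ) (m : ℤ) {r : ℝ} (hr : 0 < r) : 0 < radialWeight B m r :=
  mul_pos (Real.rpow_pos_of_pos hr _) (Real.exp_pos _)

theorem eventually_solF_ne_zero (B : ℝ) (i : Fin 2) (m : ℤ) (k : ℂ) :
    ∀ᶠ r in 𝓝[>] (0 : ℝ), solF B i m k r ≠ 0 := by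
  have h := (continuous_kummerM_comp B i m k).continuousAt (x := 0)
  have h0 : kummerM (kummerParam B i m k) ((|m| : ℤ) + 1) (B / 2 * (0 : ℝ) ^ 2 : ℝ) ≠ 0 := by
    simp [kummerM_zero _ _ (abs_add_one_ne_neg m)]
  filter_upwards [(h.eventually_ne h0).filter_mono nhdsWithin_le_nhds, self_mem_nhdsWithin]
    with r hr hr0
  exact mul_ne_zero (by exact_mod_cast (radialWeight_pos B m hr0).ne') hr

theorem originCondition_solF (hB : 0 < B) (i : Fin 2) (m : ℤ) (k : ℂ) :
    OriginCondition m (solF B i m k) := by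
  refine originCondition_of_bound fun hm => ?_
  have h := ((continuous_kummerM_comp B i m k).continuousAt (x := 0)).norm
  refine ⟨‖kummerM (kummerParam B i m k) ((|m| : ℤ) + 1) (B / 2 * (0 : ℝ) ^ 2 : ℝ)‖ + 1, ?_⟩
  · filter_upwards [(h.eventually_le_const (lt_add_one _)).filter_mono nhdsWithin_le_nhds,
      self_mem_nhdsWithin] with r hr hr0
    have hr0 : 0 < r := hr0
    have h1 : radialWeight B m r ≤ √r := by
      rw [radialWeight, hm, abs_zero, Int.cast_zero, add_zero, ← Real.sqrt_eq_rpow]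
      refine mul_le_of_le_one_right (Real.sqrt_nonneg _) (Real.exp_le_one_iff.2 ?_)
      have : 0 ≤ B * r ^ 2 / 4 := by positivity
      linarith
    have h2 : ‖solF B i m k r‖ = radialWeight B m r *
        ‖kummerM (kummerParam B i m k) ((|m| : ℤ) + 1) (B / 2 * r ^ 2 : ℝ)‖ := by
      rw [← Real.norm_of_nonneg (radialWeight_pos B m hr0).le, ← Complex.norm_real, ← norm_mul]
      rfl
    rw [h2, mul_comm]
    exact mul_le_mul hr h1 (radialWeight_pos B m hr0).le ((norm_nonneg _).trans hr)

theorem memLp_solF (B : ℝ) (i : Fin 2) (m : ℤ) (k : ℂ) (x : ℝ) :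
    MemLp (solF B i m k) 2 (volume.restrict (Ioc 0 x)) :=
  (memLp_of_continuousOn_Icc (continuous_solF B i m k).continuousOn).mono_measure
    (Measure.restrict_mono Ioc_subset_Icc_self le_rfl)

theorem continuousOn_solG (hB : 0 < B) (i : Fin 2) (m : ℤ) (k : ℂ) :
    ContinuousOn (solG B i m k) (Ioi 0) := fun _ hr =>
  (hasDerivAt_solG hB i m k hr).continuousAt.continuousWithinAt

theorem tendsto_half_mul_sq (hB : 0 < B) : Tendsto (fun r : ℝ => B / 2 * r ^ 2) atTop atTop :=
  (tendsto_pow_atTop two_ne_zero).const_mul_atTop (by positivity)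

theorem tendsto_cpow_mul_tricomiU (hB : 0 < B) (a b : ℂ) :
    Tendsto (fun r : ℝ => ((B / 2 * r ^ 2 : ℝ) : ℂ) ^ a * tricomiU a b (B / 2 * r ^ 2 : ℝ)) atTop
      (𝓝 1) :=
  (tendsto_cpow_mul_tricomiUAux _ a b (re_add_floor_pos a)).comp (tendsto_half_mul_sq hB)

theorem eventually_solG_ne_zero (hB : 0 < B) (i : Fin 2) (m : ℤ) (k : ℂ) :
    ∀ᶠ r in atTop, solG B i m k r ≠ 0 := by
  filter_upwards [(tendsto_cpow_mul_tricomiU hB (kummerParam B i m k)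
    ((|m| : ℤ) + 1)).eventually_ne one_ne_zero, eventually_gt_atTop 0] with r hr hr0
  exact mul_ne_zero (by exact_mod_cast (radialWeight_pos B m hr0).ne') (right_ne_zero_of_mul hr)

/-- By `U ~ z^{-a}`, `|G|²` is eventually at most a power of `r` times `e^{-Br²/2}`, which beats an
exponential; on bounded parts continuity suffices. -/
theorem memLp_solG (hB : 0 < B) (i : Fin 2) (m : ℤ) (k : ℂ) {x : ℝ} (hx : 0 < x) :
    MemLp (solG B i m k) 2 (volume.restrict (Ioi x)) := by
  have hc : ContinuousOn (solG B i m k) (Ici x) :=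
    (continuousOn_solG hB i m k).mono fun r hr => hx.trans_le hr
  rw [memLp_two_iff_integrable_sq_norm
    ((hc.mono Ioi_subset_Ici_self).aestronglyMeasurable measurableSet_Ioi)]
  refine integrable_of_isBigO_exp_neg (b := 1 / 2) (by norm_num) (hc.norm.pow 2) ?_
  set a := kummerParam B i m k with ha
  set ν : ℝ := 1 / 2 + (|m| : ℤ) with hν
  have h1 := (tendsto_cpow_mul_tricomiU hB a ((|m| : ℤ) + 1)).norm
  rw [norm_one] at h1
  have h2 := (rpow_mul_exp_neg_mul_sq_isLittleO_exp_neg (b := B / 2) (by positivity)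
    (2 * (ν - 2 * a.re))).isBigO
  -- The `2` bounds `|z^a U|`, which tends to `1`; the power of `B / 2` comes from `z^{-a}` with `z
  -- = Br²/2`.
  refine (Asymptotics.IsBigO.of_bound ((2 * (B / 2) ^ (-a.re)) ^ 2) ?_).trans
    (h2.congr_right fun r => by ring_nf)
  filter_upwards [h1.eventually_le_const (show (1 : ℝ) < 2 by norm_num), eventually_gt_atTop 0]
    with r hr hr0
  have hz : 0 < B / 2 * r ^ 2 := by positivity
  rw [norm_mul, Complex.norm_cpow_eq_rpow_re_of_pos hz] at hr
  have h3 : ‖tricomiU a ((|m| : ℤ) + 1) (B / 2 * r ^ 2 : ℝ)‖ ≤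
      2 * ((B / 2) ^ (-a.re) * r ^ (-(2 * a.re))) := by
    have h4 : (B / 2) ^ (-a.re) * r ^ (-(2 * a.re)) = ((B / 2 * r ^ 2) ^ a.re)⁻¹ := by
      rw [← Real.rpow_neg hz.le, Real.mul_rpow (by positivity) (by positivity),
        ← Real.rpow_natCast r 2, ← Real.rpow_mul hr0.le]
      congr 2
      push_cast
      ring
    rw [h4, ← div_eq_mul_inv, le_div_iff₀ (Real.rpow_pos_of_pos hz _), mul_comm]
    exact hr
  have h5 : ‖solG B i m k r‖ = radialWeight B m r *
      ‖tricomiU a ((|m| : ℤ) + 1) (B / 2 * r ^ 2 : ℝ)‖ := by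
    rw [← Real.norm_of_nonneg (radialWeight_pos B m hr0).le, ← Complex.norm_real, ← norm_mul]
    rfl
  have h6 : ‖solG B i m k r‖ ≤
      2 * (B / 2) ^ (-a.re) * (r ^ (ν - 2 * a.re) * Real.exp (-(B * r ^ 2 / 4))) := by
    rw [h5]
    refine (mul_le_mul_of_nonneg_left h3 (radialWeight_pos B m hr0).le).trans_eq ?_
    have e : r ^ (ν - 2 * a.re) = r ^ ν * r ^ (-(2 * a.re)) := by
      rw [sub_eq_add_neg, Real.rpow_add hr0]
    rw [radialWeight, e, hν]
    ring
  rw [Real.norm_of_nonneg (by positivity), Real.norm_of_nonneg (mul_nonneg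
    (Real.rpow_nonneg hr0.le _) (Real.exp_pos _).le)]
  refine (pow_le_pow_left₀ (norm_nonneg _) h6 2).trans_eq ?_
  rw [mul_pow, mul_pow _ (Real.exp _), ← Real.rpow_natCast (r ^ _), ← Real.rpow_mul hr0.le,
    ← Real.exp_nat_mul]
  congr 3
  · push_cast
    ring
  · push_cast
    ring

theorem conj_kummerParam (B : ℝ) (i : Fin 2) (m : ℤ) (k : ℂ) :
    conj (kummerParam B i m k) = kummerParam B i m (conj k) := by
  simp [kummerParam, map_ofNat]

theorem solF_conj (B : ℝ) (i : Fin 2) (m : ℤ) (k : ℂ) :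
    solF B i m (conj k) = fun r => conj (solF B i m k r) := by
  ext r
  rw [solF, solF, map_mul, conj_kummerM _ _ _ (abs_add_one_ne_neg m), conj_kummerParam]
  simp only [Complex.conj_ofReal, map_add, map_one, map_intCast]

theorem solG_conj (B : ℝ) (i : Fin 2) (m : ℤ) (k : ℂ) :
    solG B i m (conj k) = fun r => conj (solG B i m k r) := by
  ext r
  rw [solG, solG, map_mul, conj_tricomiU, conj_kummerParam]
  simp only [Complex.conj_ofReal, map_add, map_one, map_intCast]

theorem normConst_conj (B R : ℝ) (i : Fin 2) (m : ℤ) (k : ℂ) :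
    normConst B R i m (conj k) = conj (normConst B R i m k) := by
  have hd : ∀ f : ℝ → ℂ, deriv (fun r => conj (f r)) R = conj (deriv f R) := fun f => deriv.star
  rw [normConst, normConst, wronskianGF, wronskianGF, solF_conj, solG_conj, hd, hd]
  simp

/-- Conjugation passes through `F`, `G` and their Wronskian. Consequently `(φ(k̄), f) = ∫ φ(k) f`,
which is the Green operator evaluated at `R`. -/
theorem phi_conj (B R : ℝ) (i : Fin 2) (m : ℤ) (k : ℂ) (r : ℝ) :
    phi B R i m (conj k) r = conj (phi B R i m k r) := by
  rw [phi, phi, normConst_conj, solF_conj, solG_conj]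
  split_ifs <;> simp

end RadialSolutions

/-! ### Variation of constants with `F` and `G`, and compactly supported data. -/

section GreenOperator

variable {B R : ℝ}

/-! ### The Green operator -/

/-- The operator with kernel `N G(r) F(r')`, `r' ≤ r`, and `N F(r) G(r')`, `r' ≥ r`. -/
def greenOp (B R : ℝ) (i : Fin 2) (m : ℤ) (k : ℂ) (g : ℝ → ℂ) (r : ℝ) : ℂ :=
  ∫ r', channelGreen B R i m k r r' * g r' ∂μ₊

/-- The derivative of `greenOp B R i m k g`. -/
def greenOpDeriv (B R : ℝ) (i : Fin 2) (m : ℤ) (k : ℂ) (g : ℝ → ℂ) (r : ℝ) : ℂ :=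
  normConst B R i m k * (deriv (solG B i m k) r * ∫ t in (0 : ℝ)..r, solF B i m k t * g t) +
    normConst B R i m k * (deriv (solF B i m k) r * ∫ t in Ioi r, solG B i m k t * g t)

theorem memLp_of_Ioc_of_Ioi {f : ℝ → ℂ} {y x : ℝ} (hx : y ≤ x)
    (h₁ : MemLp f 2 (volume.restrict (Ioc y x))) (h₂ : MemLp f 2 (volume.restrict (Ioi x))) :
    MemLp f 2 (volume.restrict (Ioi y)) := by
  rw [← Ioc_union_Ioi_eq_Ioi hx]
  have h := (memLp_indicator_iff_restrict measurableSet_Ioc).2 h₁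
  have h' := (memLp_indicator_iff_restrict measurableSet_Ioi).2 h₂
  have hms : MeasurableSet (Ioc y x ∪ Ioi x) := measurableSet_Ioc.union measurableSet_Ioi
  rw [← memLp_indicator_iff_restrict hms, indicator_union_of_disjoint]
  · exact h.add h'
  · exact Set.disjoint_left.2 fun z hz hz' => not_lt.2 hz.2 hz'

theorem memLp_channelGreen (hB : 0 < B) (R : ℝ) (i : Fin 2) (m : ℤ) (k : ℂ) {r : ℝ} (hr : 0 < r) :
    MemLp (channelGreen B R i m k r) 2 μ₊ := by
  refine memLp_of_Ioc_of_Ioi hr.le ?_ ?_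
  · refine (memLp_congr_ae ?_).1 ((memLp_solF B i m k r).const_mul
      (normConst B R i m k * solG B i m k r))
    filter_upwards [ae_restrict_mem measurableSet_Ioc] with t ht
    rw [channelGreen, if_pos ht.2]
  · refine (memLp_congr_ae ?_).1 ((memLp_solG hB i m k hr).const_mul
      (normConst B R i m k * solF B i m k r))
    filter_upwards [ae_restrict_mem measurableSet_Ioi] with t ht
    rw [channelGreen, if_neg (not_le.2 ht)]

theorem channelGreen_self (B R : ℝ) (i : Fin 2) (m : ℤ) (k : ℂ) (r : ℝ) :
    channelGreen B R i m k R r = phi B R i m k r := rfl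

theorem memLp_phi (hB : 0 < B) (hR : 0 < R) (i : Fin 2) (m : ℤ) (k : ℂ) :
    MemLp (phi B R i m k) 2 μ₊ := memLp_channelGreen hB R i m k hR

theorem integrable_channelGreen_mul (hB : 0 < B) (R : ℝ) (i : Fin 2) (m : ℤ) (k : ℂ) {r : ℝ}
    (hr : 0 < r) {g : ℝ → ℂ} (hg : MemLp g 2 μ₊) :
    Integrable (fun t => channelGreen B R i m k r t * g t) μ₊ :=
  (memLp_channelGreen hB R i m k hr).integrable_mul hg

/-- For fixed `r` the kernel is square integrable, so evaluating the Green operator at `r` is a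
bounded functional; this is what permits passing to limits pointwise. -/
theorem greenOp_eq_inner (hB : 0 < B) (R : ℝ) (i : Fin 2) (m : ℤ) (k : ℂ) {r : ℝ} (hr : 0 < r)
    (g : HalfLineL2) :
    greenOp B R i m k g r =
      inner ℂ (toHalfLineL2 fun t => conj (channelGreen B R i m k r t)) g := by
  have h : MemLp (fun t => conj (channelGreen B R i m k r t)) 2 μ₊ :=
    (memLp_channelGreen hB R i m k hr).star
  rw [inner_toHalfLineL2_left h, greenOp]
  simp

theorem integrableOn_solF_mul (i : Fin 2) (m : ℤ) (k : ℂ) (r : ℝ)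
    {g : ℝ → ℂ} (hg : MemLp g 2 μ₊) :
    IntegrableOn (fun t => solF B i m k t * g t) (Ioc 0 r) :=
  (memLp_solF B i m k r).integrable_mul
    (hg.mono_measure (Measure.restrict_mono Ioc_subset_Ioi_self le_rfl))

theorem integrableOn_solG_mul (hB : 0 < B) (i : Fin 2) (m : ℤ) (k : ℂ) {r : ℝ} (hr : 0 < r)
    {g : ℝ → ℂ} (hg : MemLp g 2 μ₊) :
    IntegrableOn (fun t => solG B i m k t * g t) (Ioi r) :=
  (memLp_solG hB i m k hr).integrable_mul
    (hg.mono_measure (Measure.restrict_mono (Ioi_subset_Ioi hr.le) le_rfl))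

theorem greenOp_eq (hB : 0 < B) (R : ℝ) (i : Fin 2) (m : ℤ) (k : ℂ) {r : ℝ} (hr : 0 < r)
    {g : ℝ → ℂ} (hg : MemLp g 2 μ₊) :
    greenOp B R i m k g r =
      normConst B R i m k * (solG B i m k r * ∫ t in (0 : ℝ)..r, solF B i m k t * g t) +
        normConst B R i m k * (solF B i m k r * ∫ t in Ioi r, solG B i m k t * g t) := by
  have hi := integrable_channelGreen_mul hB R i m k hr hg
  have hd : Disjoint (Ioc 0 r) (Ioi r) :=
    Set.disjoint_left.2 fun y hy hy' => not_lt.2 hy.2 hy'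
  rw [greenOp, ← Ioc_union_Ioi_eq_Ioi hr.le, setIntegral_union hd measurableSet_Ioi
    (hi.mono_measure (Measure.restrict_mono Ioc_subset_Ioi_self le_rfl))
    (hi.mono_measure (Measure.restrict_mono (Ioi_subset_Ioi hr.le) le_rfl)),
    intervalIntegral.integral_of_le hr.le, ← integral_const_mul, ← integral_const_mul,
    ← integral_const_mul, ← integral_const_mul]
  congr 1
  · refine setIntegral_congr_fun measurableSet_Ioc fun t ht => ?_
    simp only [channelGreen, if_pos ht.2]
    ring
  · refine setIntegral_congr_fun measurableSet_Ioi fun t ht => ?_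
    simp only [channelGreen, if_neg (not_le.2 (mem_Ioi.1 ht))]
    ring

theorem hasDens_integral_solF_mul (i : Fin 2) (m : ℤ) (k : ℂ) {g : ℝ → ℂ}
    (hg : MemLp g 2 μ₊) :
    HasDens (Ioi 0) (fun r => ∫ t in (0 : ℝ)..r, solF B i m k t * g t)
      (fun t => solF B i m k t * g t) :=
  HasDens.primitive fun x hx => (intervalIntegrable_iff_integrableOn_Ioc_of_le
    (le_of_lt hx)).2 (integrableOn_solF_mul i m k x hg)

theorem hasDens_integral_Ioi {h : ℝ → ℂ} (hi : ∀ r ∈ Ioi (0 : ℝ), IntegrableOn h (Ioi r)) :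
    HasDens (Ioi 0) (fun r => ∫ t in Ioi r, h t) (fun r => -h r) := by
  have hii : ∀ x ∈ Ioi (0 : ℝ), IntervalIntegrable h volume 1 x := by
    intro x hx
    rw [intervalIntegrable_iff]
    exact (hi (min 1 x) (mem_Ioi.2 (lt_min one_pos hx))).mono_set Ioc_subset_Ioi_self
  have h0 := (HasDens.primitive (f' := h) (c := 1) (Ω := Ioi 0) hii).const_mul (-1)
  have hc : HasDens (Ioi 0) (fun _ : ℝ => ∫ t in Ioi (1 : ℝ), h t) (fun _ => 0) :=
    HasDens.of_hasDerivAt (fun _ _ => hasDerivAt_const _ _) continuousOn_const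
  refine ((hc.add h0).congr_fun fun r hr => ?_).congr_dens fun r hr => by ring
  have := intervalIntegral.integral_interval_add_Ioi (hi 1 (mem_Ioi.2 one_pos)) (hi r hr)
  rw [← this]
  ring

theorem continuousOn_of_hasDerivAt {f f' : ℝ → ℂ} {s : Set ℝ}
    (h : ∀ r ∈ s, HasDerivAt f (f' r) r) : ContinuousOn f s := fun r hr =>
  (h r hr).continuousAt.continuousWithinAt

theorem continuousOn_deriv_solF (hB : 0 < B) (i : Fin 2) (m : ℤ) (k : ℂ) :
    ContinuousOn (deriv (solF B i m k)) (Ioi 0) :=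
  continuousOn_of_hasDerivAt fun _ hr => hasDerivAt_deriv_solF hB i m k hr

theorem continuousOn_deriv_solG (hB : 0 < B) (i : Fin 2) (m : ℤ) (k : ℂ) :
    ContinuousOn (deriv (solG B i m k)) (Ioi 0) :=
  continuousOn_of_hasDerivAt fun _ hr => hasDerivAt_deriv_solG hB i m k hr

theorem hasDens_solF (hB : 0 < B) (i : Fin 2) (m : ℤ) (k : ℂ) :
    HasDens (Ioi 0) (solF B i m k) (deriv (solF B i m k)) :=
  HasDens.of_hasDerivAt (fun _ hr => hasDerivAt_solF hB i m k hr) (continuousOn_deriv_solF hB i m k)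

theorem hasDens_solG (hB : 0 < B) (i : Fin 2) (m : ℤ) (k : ℂ) :
    HasDens (Ioi 0) (solG B i m k) (deriv (solG B i m k)) :=
  HasDens.of_hasDerivAt (fun _ hr => hasDerivAt_solG hB i m k hr) (continuousOn_deriv_solG hB i m k)

theorem hasDens_deriv_solF (hB : 0 < B) (i : Fin 2) (m : ℤ) (k : ℂ) :
    HasDens (Ioi 0) (deriv (solF B i m k))
      (fun r => (radialPotential B i m r - k) * solF B i m k r) :=
  HasDens.of_hasDerivAt (fun _ hr => hasDerivAt_deriv_solF hB i m k hr)
    (((continuousOn_radialPotential i m).sub continuousOn_const).mul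
      (continuous_solF B i m k).continuousOn)

theorem hasDens_deriv_solG (hB : 0 < B) (i : Fin 2) (m : ℤ) (k : ℂ) :
    HasDens (Ioi 0) (deriv (solG B i m k))
      (fun r => (radialPotential B i m r - k) * solG B i m k r) :=
  HasDens.of_hasDerivAt (fun _ hr => hasDerivAt_deriv_solG hB i m k hr)
    (((continuousOn_radialPotential i m).sub continuousOn_const).mul (continuousOn_solG hB i m k))

/-- Variation of constants: the terms from differentiating the two integrals cancel in the first
derivative and combine to `-N W g = -g` in the second. -/
theorem isH2Loc_greenOp (hB : 0 < B) (hR : 0 < R) (i : Fin 2) (m : ℤ) {k : ℂ}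
    (hW : wronskianGF B R i m k ≠ 0) {g : ℝ → ℂ} (hg : MemLp g 2 μ₊) :
    IsH2Loc (Ioi 0) (greenOp B R i m k g) (greenOpDeriv B R i m k g)
      (fun r => (radialPotential B i m r - k) * greenOp B R i m k g r - g r) := by
  set N := normConst B R i m k with hN
  have hP := hasDens_integral_solF_mul (B := B) i m k hg
  have hQ := hasDens_integral_Ioi (h := fun t => solG B i m k t * g t)
    fun r hr => integrableOn_solG_mul hB i m k hr hg
  have hu : HasDens (Ioi 0) (greenOp B R i m k g) (greenOpDeriv B R i m k g) := by
    refine (((((hasDens_solG hB i m k).mul hP).const_mul N).add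
      (((hasDens_solF hB i m k).mul hQ).const_mul N)).congr_fun fun r hr =>
        (greenOp_eq hB R i m k hr hg).symm).congr_dens fun r hr => ?_
    simp only [greenOpDeriv, ← hN]
    ring
  have hu1 : HasDens (Ioi 0) (greenOpDeriv B R i m k g)
      (fun r => (radialPotential B i m r - k) * greenOp B R i m k g r - g r) := by
    refine ((((hasDens_deriv_solG hB i m k).mul hP).const_mul N).add
      (((hasDens_deriv_solF hB i m k).mul hQ).const_mul N)).congr_dens fun r hr => ?_
    have hNW : N * (solG B i m k r * deriv (solF B i m k) r -
        deriv (solG B i m k) r * solF B i m k r) = 1 := by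
      rw [wronskian_eq hB hR i m k hr, hN, normConst, inv_mul_cancel₀ hW]
    rw [greenOp_eq hB R i m k hr hg, ← hN]
    linear_combination (-g r) * hNW
  have hc1 := hu1.continuousOn isOpen_Ioi
  have hc := hu.continuousOn isOpen_Ioi
  refine ⟨fun r hr => hu.hasDerivAt isOpen_Ioi hc1 hr, fun x y hxy hs => ?_, hu1.integral_eq⟩
  refine MemLp.sub (memLp_of_continuousOn_Icc ?_)
    (hg.mono_measure (Measure.restrict_mono hs le_rfl))
  exact (((continuousOn_radialPotential i m).sub continuousOn_const).mul hc).mono hs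

theorem continuousOn_greenOp (hB : 0 < B) (hR : 0 < R) (i : Fin 2) (m : ℤ) {k : ℂ}
    (hW : wronskianGF B R i m k ≠ 0) {g : ℝ → ℂ} (hg : MemLp g 2 μ₊) :
    ContinuousOn (greenOp B R i m k g) (Ioi 0) :=
  continuousOn_of_hasDerivAt (isH2Loc_greenOp hB hR i m hW hg).hasDerivAt

theorem OriginCondition.congr {m : ℤ} {u v : ℝ → ℂ} (h : OriginCondition m u)
    (huv : u =ᶠ[𝓝[>] 0] v) : OriginCondition m v := fun hm =>
  (h hm).congr' (by filter_upwards [huv] with r hr; rw [hr])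

theorem OriginCondition.const_mul {m : ℤ} {u : ℝ → ℂ} (h : OriginCondition m u) (c : ℂ) :
    OriginCondition m (fun r => c * u r) := fun hm => by
  simpa [mul_div_assoc] using (h hm).const_mul c

theorem OriginCondition.add {m : ℤ} {u v : ℝ → ℂ} (hu : OriginCondition m u)
    (hv : OriginCondition m v) : OriginCondition m (u + v) := fun hm => by
  simpa [add_div] using (hu hm).add (hv hm)

theorem deltaCondition_zero (hR : 0 < R) {u u₁ : ℝ → ℂ} (hu : ContinuousOn u (Ioi 0))
    (hu₁ : ContinuousOn u₁ (Ioi 0)) : DeltaCondition R 0 u u₁ := by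
  have h := (hu.continuousAt (Ioi_mem_nhds hR)).tendsto
  have h₁ := (hu₁.continuousAt (Ioi_mem_nhds hR)).tendsto
  exact ⟨u R, u₁ R, u₁ R, h.mono_left nhdsWithin_le_nhds, h.mono_left nhdsWithin_le_nhds,
    h₁.mono_left nhdsWithin_le_nhds, h₁.mono_left nhdsWithin_le_nhds, by simp⟩

/-- To the left of the support the integral of `F g` vanishes and that of `G g` no longer depends on
`r`, leaving a multiple of `F`, which is regular at the origin. -/
theorem greenOp_of_le (hB : 0 < B) (R : ℝ) (i : Fin 2) (m : ℤ) (k : ℂ) {g : ℝ → ℂ}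
    (hg : MemLp g 2 μ₊) {c : ℝ} (hc : 0 < c) (h0 : ∀ᵐ r ∂μ₊, r < c → g r = 0) {r : ℝ}
    (hr : 0 < r) (hrc : r < c) :
    greenOp B R i m k g r =
      (normConst B R i m k * ∫ t in Ioi c, solG B i m k t * g t) * solF B i m k r := by
  have h1 : ∀ᵐ t ∂volume.restrict (Ioc 0 r), solF B i m k t * g t = 0 := by
    filter_upwards [ae_restrict_of_ae_restrict_of_subset Ioc_subset_Ioi_self h0,
      ae_restrict_mem measurableSet_Ioc] with t ht htr
    rw [ht (htr.2.trans_lt hrc), mul_zero]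
  have h2 : ∀ᵐ t ∂volume.restrict (Ioc r c), solG B i m k t * g t = 0 := by
    have hne : ∀ᵐ t : ℝ ∂volume.restrict (Ioc r c), t ≠ c :=
      ae_restrict_of_ae (by simp [ae_iff, measure_singleton])
    filter_upwards [ae_restrict_of_ae_restrict_of_subset
      (fun t ht => mem_Ioi.2 (hr.trans ht.1)) h0, ae_restrict_mem measurableSet_Ioc, hne]
      with t ht htr htc
    rw [ht (lt_of_le_of_ne htr.2 htc), mul_zero]
  have h3 := intervalIntegral.integral_interval_add_Ioi (integrableOn_solG_mul hB i m k hr hg)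
    (integrableOn_solG_mul hB i m k hc hg)
  rw [intervalIntegral.integral_of_le hrc.le, integral_eq_zero_of_ae h2, zero_add] at h3
  rw [greenOp_eq hB R i m k hr hg, intervalIntegral.integral_of_le hr.le,
    integral_eq_zero_of_ae h1, ← h3]
  ring

theorem greenOp_of_ge (hB : 0 < B) (R : ℝ) (i : Fin 2) (m : ℤ) (k : ℂ) {g : ℝ → ℂ}
    (hg : MemLp g 2 μ₊) {d : ℝ} (hd : 0 < d) (h0 : ∀ᵐ r ∂μ₊, d < r → g r = 0) {r : ℝ}
    (hdr : d ≤ r) :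
    greenOp B R i m k g r =
      (normConst B R i m k * ∫ t in (0 : ℝ)..d, solF B i m k t * g t) * solG B i m k r := by
  have hr : 0 < r := hd.trans_le hdr
  have h1 : ∀ᵐ t ∂volume.restrict (Ioi r), solG B i m k t * g t = 0 := by
    filter_upwards [ae_restrict_of_ae_restrict_of_subset (Ioi_subset_Ioi hr.le) h0,
      ae_restrict_mem measurableSet_Ioi] with t ht htr
    rw [ht (hdr.trans_lt htr), mul_zero]
  have h2 : ∀ᵐ t ∂volume.restrict (Ioc d r), solF B i m k t * g t = 0 := by
    filter_upwards [ae_restrict_of_ae_restrict_of_subset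
      (fun t ht => mem_Ioi.2 (hd.trans ht.1)) h0, ae_restrict_mem measurableSet_Ioc]
      with t ht htr
    rw [ht htr.1, mul_zero]
  have hii : ∀ x, 0 < x → IntervalIntegrable (fun t => solF B i m k t * g t) volume 0 x :=
    fun x hx => (intervalIntegrable_iff_integrableOn_Ioc_of_le
      hx.le).2 (integrableOn_solF_mul i m k x hg)
  have h3 := intervalIntegral.integral_interval_sub_left (hii r hr) (hii d hd)
  rw [intervalIntegral.integral_of_le hdr, integral_eq_zero_of_ae h2, sub_eq_zero] at h3
  rw [greenOp_eq hB R i m k hr hg, integral_eq_zero_of_ae h1, h3]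
  ring

/-- The elements of `L²((0,∞))` with support in a compact subset of `(0,∞)`. -/
def compactlySupported : Submodule ℂ HalfLineL2 where
  carrier := {g | ∃ c d : ℝ, 0 < c ∧ 0 < d ∧ ∀ᵐ r ∂μ₊, r ∉ Icc c d → g r = 0}
  zero_mem' := ⟨1, 1, one_pos, one_pos, by
    filter_upwards [Lp.coeFn_zero ℂ 2 μ₊] with r hr _
    rw [hr, Pi.zero_apply]⟩
  add_mem' := by
    rintro f g ⟨c, d, hc, hd, hf⟩ ⟨c', d', hc', hd', hg⟩
    refine ⟨min c c', max d d', lt_min hc hc', lt_max_of_lt_left hd, ?_⟩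
    filter_upwards [Lp.coeFn_add f g, hf, hg] with r h1 h2 h3 hr
    have h4 : r ∉ Icc c d := fun h => hr ⟨(min_le_left _ _).trans h.1, h.2.trans (le_max_left _ _)⟩
    have h5 : r ∉ Icc c' d' :=
      fun h => hr ⟨(min_le_right _ _).trans h.1, h.2.trans (le_max_right _ _)⟩
    rw [h1, Pi.add_apply, h2 h4, h3 h5, add_zero]
  smul_mem' := by
    rintro a f ⟨c, d, hc, hd, hf⟩
    refine ⟨c, d, hc, hd, ?_⟩
    filter_upwards [Lp.coeFn_smul a f, hf] with r h1 h2 hr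
    rw [h1, Pi.smul_apply, h2 hr, smul_zero]

/-- If `h` is orthogonal to the subspace, pairing it with its own truncation to `[1/(n+1), n+1]`
shows that every truncation is zero. -/
theorem dense_compactlySupported : Dense (compactlySupported : Set HalfLineL2) := by
  rw [Submodule.dense_iff_topologicalClosure_eq_top, Submodule.topologicalClosure_eq_top_iff,
    Submodule.eq_bot_iff]
  intro h hh
  have key : ∀ n : ℕ, ∀ᵐ r ∂μ₊, r ∈ Icc (1 / (n + 1 : ℝ)) (n + 1) → h r = 0 := by
    intro n
    set s : Set ℝ := Icc (1 / (n + 1 : ℝ)) (n + 1) with hs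
    have hL : MemLp (s.indicator h) 2 μ₊ := (Lp.memLp h).indicator measurableSet_Icc
    have hmem : toHalfLineL2 (s.indicator h) ∈ compactlySupported := by
      refine ⟨1 / (n + 1 : ℝ), n + 1, by positivity, by positivity, ?_⟩
      filter_upwards [coeFn_toHalfLineL2 hL] with r hr hrs
      rw [hr, indicator_of_notMem hrs]
    have h0 := (Submodule.mem_orthogonal _ _).1 hh _ hmem
    have h1 : inner ℂ (toHalfLineL2 (s.indicator h)) (toHalfLineL2 (s.indicator h)) = (0 : ℂ) := by
      rw [inner_toHalfLineL2_left hL] at h0 ⊢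
      rw [← h0]
      refine integral_congr_ae ?_
      filter_upwards [coeFn_toHalfLineL2 hL] with r hr
      rw [hr]
      by_cases hrs : r ∈ s
      · rw [indicator_of_mem hrs]
      · rw [indicator_of_notMem hrs]
        simp
    rw [inner_self_eq_zero] at h1
    have h2 := coeFn_toHalfLineL2 hL
    rw [h1] at h2
    filter_upwards [h2, Lp.coeFn_zero ℂ 2 μ₊] with r hr hr' hrs
    rw [hr', indicator_of_mem hrs, Pi.zero_apply] at hr
    exact hr.symm
  refine Lp.ext (EventuallyEq.trans ?_ (Lp.coeFn_zero ..).symm)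
  filter_upwards [ae_all_iff.2 key, ae_restrict_mem measurableSet_Ioi] with r hr hr0
  have hr0 : 0 < r := hr0
  obtain ⟨n, hn⟩ := exists_nat_ge (max r r⁻¹)
  refine hr n ⟨?_, ?_⟩
  · rw [one_div, inv_le_comm₀ (by positivity) hr0]
    linarith [le_max_right r r⁻¹]
  · linarith [le_max_left r r⁻¹]

theorem memLp_greenOp (hB : 0 < B) (hR : 0 < R) (i : Fin 2) (m : ℤ) {k : ℂ}
    (hW : wronskianGF B R i m k ≠ 0) {g : HalfLineL2} (hg : g ∈ compactlySupported) :
    MemLp (greenOp B R i m k g) 2 μ₊ := by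
  obtain ⟨c, d, hc, hd, h0⟩ := hg
  have hgL := Lp.memLp g
  have hcont := continuousOn_greenOp hB hR i m hW hgL
  -- The interval `[c, d]` may be empty, so `d` alone need not lie to the right of `c / 2`. The half
  -- is there because the formula near the origin needs `r < c` strictly.
  set e := max (c / 2) d with he
  have hed : d ≤ e := le_max_right _ _
  have hce : c / 2 ≤ e := le_max_left _ _
  have hc2 : 0 < c / 2 := by positivity
  refine memLp_of_Ioc_of_Ioi hc2.le ?_ ?_
  · refine (memLp_congr_ae ?_).1 ((memLp_solF B i m k (c / 2)).const_mul
      (normConst B R i m k * ∫ t in Ioi c, solG B i m k t * g t))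
    filter_upwards [ae_restrict_mem measurableSet_Ioc] with r hr
    refine (greenOp_of_le hB R i m k hgL hc ?_ hr.1 (by linarith [hr.2])).symm
    filter_upwards [h0] with t ht htc
    exact ht fun h => not_lt.2 h.1 htc
  · have h1 : MemLp (greenOp B R i m k g) 2 (volume.restrict (Icc (c / 2) e)) :=
      memLp_of_continuousOn_Icc (hcont.mono fun r hr => hc2.trans_le hr.1)
    have h2 : MemLp (greenOp B R i m k g) 2 (volume.restrict (Ioi e)) := by
      refine (memLp_congr_ae ?_).1 ((memLp_solG hB i m k (hc2.trans_le hce)).const_mul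
        (normConst B R i m k * ∫ t in (0 : ℝ)..d, solF B i m k t * g t))
      filter_upwards [ae_restrict_mem measurableSet_Ioi] with r hr
      refine (greenOp_of_ge hB R i m k hgL hd ?_ (hed.trans (le_of_lt hr))).symm
      filter_upwards [h0] with t ht htc
      exact ht fun h => not_lt.2 h.2 htc
    exact memLp_of_Ioc_of_Ioi hce (h1.mono_measure
      (Measure.restrict_mono Ioc_subset_Icc_self le_rfl)) h2

theorem mem_channelGraph_greenOp (hB : 0 < B) (hR : 0 < R) (i : Fin 2) (m : ℤ) {k : ℂ}
    (hW : wronskianGF B R i m k ≠ 0) {g : HalfLineL2} (hg : g ∈ compactlySupported) :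
    (toHalfLineL2 (greenOp B R i m k g), g + k • toHalfLineL2 (greenOp B R i m k g)) ∈
      channelGraph B R i m 0 := by
  have hL := memLp_greenOp hB hR i m hW hg
  have hgL := Lp.memLp g
  have hH := isH2Loc_greenOp hB hR i m hW hgL
  refine ⟨_, _, _, hH.mono sdiff_subset, deltaCondition_zero hR
    (continuousOn_of_hasDerivAt hH.hasDerivAt) (hH.hasDens.continuousOn isOpen_Ioi), ?_,
    coeFn_toHalfLineL2 hL, ?_⟩
  · obtain ⟨c, d, hc, hd, h0⟩ := hg
    refine ((originCondition_solF hB i m k).const_mul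
      (normConst B R i m k * ∫ t in Ioi c, solG B i m k t * g t)).congr ?_
    filter_upwards [Ioo_mem_nhdsGT hc] with r hr
    refine (greenOp_of_le hB R i m k hgL hc ?_ hr.1 hr.2).symm
    filter_upwards [h0] with t ht htc
    exact ht fun h => not_lt.2 h.1 htc
  · filter_upwards [Lp.coeFn_add g (k • toHalfLineL2 (greenOp B R i m k g)),
      Lp.coeFn_smul k (toHalfLineL2 (greenOp B R i m k g)), coeFn_toHalfLineL2 hL] with r h1 h2 h3
    simp only [h1, Pi.add_apply, h2, Pi.smul_apply, h3, smul_eq_mul]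
    ring

end GreenOperator

/-! ### Eigenfunction arguments and the Krein formula in one channel. -/

section ChannelResolvents

variable {B R : ℝ}

/-! ### Resolvents in a single channel -/

/-- The bounded operator `s` is the inverse of `T - k`, where `T` is the operator with graph `Γ`. -/
structure IsChannelResolvent (Γ : Submodule ℂ (HalfLineL2 × HalfLineL2)) (k : ℂ)
    (s : HalfLineL2 →L[ℂ] HalfLineL2) : Prop where
  mem : ∀ g, (s g, g + k • s g) ∈ Γ
  left_inv : ∀ p ∈ Γ, s (p.2 - k • p.1) = p.1

theorem IsChannelResolvent.eq_zero {Γ : Submodule ℂ (HalfLineL2 × HalfLineL2)} {k : ℂ}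
    {s : HalfLineL2 →L[ℂ] HalfLineL2} (h : IsChannelResolvent Γ k s) {f : HalfLineL2}
    (hf : (f, k • f) ∈ Γ) : f = 0 := by
  simpa using (h.left_inv _ hf).symm

theorem IsChannelResolvent.apply_eq {Γ : Submodule ℂ (HalfLineL2 × HalfLineL2)} {k : ℂ}
    {s : HalfLineL2 →L[ℂ] HalfLineL2} (h : IsChannelResolvent Γ k s) {f g : HalfLineL2}
    (hf : (f, g + k • f) ∈ Γ) : s g = f := by
  simpa using h.left_inv _ hf

theorem isH2Loc_of_hasDerivAt {Ω : Set ℝ} (hΩ : Ω ⊆ Ioi 0) {i : Fin 2} {m : ℤ} {k : ℂ}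
    {u u₁ : ℝ → ℂ} (hu : ∀ r ∈ Ω, HasDerivAt u (u₁ r) r)
    (hu₁ : ∀ r ∈ Ω, HasDerivAt u₁ ((radialPotential B i m r - k) * u r) r) :
    IsH2Loc Ω u u₁ (fun r => (radialPotential B i m r - k) * u r) := by
  have hc : ContinuousOn (fun r => (radialPotential B i m r - k) * u r) Ω :=
    (((continuousOn_radialPotential i m).mono hΩ).sub continuousOn_const).mul
      (continuousOn_of_hasDerivAt hu)
  exact ⟨hu, fun x y hxy hs => memLp_of_continuousOn_Icc (hc.mono hs),
    (HasDens.of_hasDerivAt hu₁ hc).integral_eq⟩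

theorem mem_channelGraph_of_solution {i : Fin 2} {m : ℤ} {k : ℂ} {α : ℝ} {u u₁ : ℝ → ℂ}
    (hu : ∀ r ∈ Ioi (0 : ℝ) \ {R}, HasDerivAt u (u₁ r) r)
    (hu₁ : ∀ r ∈ Ioi (0 : ℝ) \ {R}, HasDerivAt u₁ ((radialPotential B i m r - k) * u r) r)
    (hδ : DeltaCondition R α u u₁) (ho : OriginCondition m u) (hL : MemLp u 2 μ₊) :
    (toHalfLineL2 u, k • toHalfLineL2 u) ∈ channelGraph B R i m α := by
  refine ⟨u, u₁, _, isH2Loc_of_hasDerivAt sdiff_subset hu hu₁, hδ, ho, coeFn_toHalfLineL2 hL, ?_⟩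
  filter_upwards [Lp.coeFn_smul k (toHalfLineL2 u), coeFn_toHalfLineL2 hL] with r h1 h2
  simp only [h1, Pi.smul_apply, h2, smul_eq_mul]
  ring

theorem toHalfLineL2_ne_zero {u : ℝ → ℂ} (hL : MemLp u 2 μ₊)
    (h : ∀ᶠ r in 𝓝[>] (0 : ℝ), u r ≠ 0) : toHalfLineL2 u ≠ 0 := by
  intro h0
  have h1 := coeFn_toHalfLineL2 hL
  rw [h0] at h1
  obtain ⟨ε, hε, hsub⟩ := mem_nhdsGT_iff_exists_Ioo_subset.1 h
  have hε : 0 < ε := hε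
  have h2 : ∀ᵐ r ∂volume.restrict (Ioo 0 ε), False := by
    filter_upwards [ae_restrict_of_ae_restrict_of_subset Ioo_subset_Ioi_self h1,
      ae_restrict_of_ae_restrict_of_subset Ioo_subset_Ioi_self (Lp.coeFn_zero ℂ 2 μ₊),
      ae_restrict_mem measurableSet_Ioo] with r h3 h4 h5
    exact hsub h5 (by rw [← h3, h4, Pi.zero_apply])
  rw [eventually_false_iff_eq_bot, ae_eq_bot, Measure.restrict_eq_zero, Real.volume_Ioo] at h2
  simp only [sub_zero, ENNReal.ofReal_eq_zero] at h2
  linarith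

/-- With zero Wronskian `F/G` is constant near infinity, so `F` inherits square integrability from
`G`. Being regular at the origin and smooth at `R`, it would be a nonzero eigenfunction at a point
of the resolvent set. -/
theorem wronskianGF_ne_zero (hB : 0 < B) (hR : 0 < R) {i : Fin 2} {m : ℤ} {k : ℂ}
    {s : HalfLineL2 →L[ℂ] HalfLineL2} (h : IsChannelResolvent (channelGraph B R i m 0) k s) :
    wronskianGF B R i m k ≠ 0 := by
  intro hW
  obtain ⟨x₀, hx₀⟩ := eventually_atTop.1 (eventually_solG_ne_zero hB i m k)
  set x := max x₀ 1 with hx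
  have hx0 : 0 < x := lt_max_of_lt_right one_pos
  have hG : ∀ r, x < r → solG B i m k r ≠ 0 := fun r hr => hx₀ r ((le_max_left _ _).trans hr.le)
  have hconst : ∀ r, x < r → solF B i m k r =
      solF B i m k (x + 1) / solG B i m k (x + 1) * solG B i m k r := by
    intro r hr
    have h1 := eq_of_hasDerivAt_zero isOpen_Ioi isPreconnected_Ioi
      (w := fun r => solF B i m k r / solG B i m k r) (s := Ioi x) (fun t ht => ?_)
      (mem_Ioi.2 hr) (mem_Ioi.2 (lt_add_one x))
    · rw [← h1, div_mul_cancel₀ _ (hG r hr)]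
    · have ht0 : 0 < t := hx0.trans ht
      refine ((hasDerivAt_solF hB i m k ht0).div (hasDerivAt_solG hB i m k ht0)
        (hG t ht)).congr_deriv ?_
      have h2 := wronskian_eq hB hR i m k ht0
      rw [hW] at h2
      rw [div_eq_zero_iff]
      left
      linear_combination h2
  have hL : MemLp (solF B i m k) 2 μ₊ := by
    refine memLp_of_Ioc_of_Ioi hx0.le (memLp_solF B i m k x) ((memLp_congr_ae ?_).1
      ((memLp_solG hB i m k hx0).const_mul (solF B i m k (x + 1) / solG B i m k (x + 1))))
    filter_upwards [ae_restrict_mem measurableSet_Ioi] with r hr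
    exact (hconst r hr).symm
  refine toHalfLineL2_ne_zero hL (eventually_solF_ne_zero B i m k) (h.eq_zero
    (mem_channelGraph_of_solution (fun r hr => hasDerivAt_solF hB i m k hr.1)
      (fun r hr => hasDerivAt_deriv_solF hB i m k hr.1)
      (deltaCondition_zero hR (continuous_solF B i m k).continuousOn
        (continuousOn_deriv_solF hB i m k)) (originCondition_solF hB i m k) hL))

/-- For compactly supported data the Green operator lands in the domain and therefore is the
resolvent. In general, approximate `f`: along a subsequence the resolvents converge almost
everywhere, and the Green operators converge at every `r > 0`. -/
theorem IsChannelResolvent.ae_eq_greenOp (hB : 0 < B) (hR : 0 < R) {i : Fin 2} {m : ℤ} {k : ℂ}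
    {s : HalfLineL2 →L[ℂ] HalfLineL2} (h : IsChannelResolvent (channelGraph B R i m 0) k s)
    (f : HalfLineL2) : s f =ᵐ[μ₊] greenOp B R i m k f := by
  have hW := wronskianGF_ne_zero hB hR h
  obtain ⟨g, hgK, hg⟩ := mem_closure_iff_seq_limit.1 (dense_compactlySupported f)
  have hsg : ∀ n, s (g n) =ᵐ[μ₊] greenOp B R i m k (g n) := fun n => by
    rw [h.apply_eq (mem_channelGraph_greenOp hB hR i m hW (hgK n))]
    exact coeFn_toHalfLineL2 (memLp_greenOp hB hR i m hW (hgK n))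
  obtain ⟨ns, hns, hlim⟩ := (tendstoInMeasure_of_tendsto_Lp
    ((s.continuous.tendsto f).comp hg)).exists_seq_tendsto_ae
  filter_upwards [hlim, ae_all_iff.2 hsg, ae_restrict_mem measurableSet_Ioi] with r h1 h2 h3
  refine tendsto_nhds_unique h1 ?_
  simp only [Function.comp_apply, h2, greenOp_eq_inner hB R i m k h3]
  exact ((continuous_const.inner continuous_id).tendsto f).comp (hg.comp hns.tendsto_atTop)

/-- The derivative of `phi B R i m k` away from `R`. -/
def phiDeriv (B R : ℝ) (i : Fin 2) (m : ℤ) (k : ℂ) (r : ℝ) : ℂ :=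
  if r ≤ R then normConst B R i m k * solG B i m k R * deriv (solF B i m k) r
  else normConst B R i m k * solF B i m k R * deriv (solG B i m k) r

theorem hasDerivAt_phi (hB : 0 < B) (i : Fin 2) (m : ℤ) (k : ℂ) {r : ℝ}
    (hr : r ∈ Ioi (0 : ℝ) \ {R}) :
    HasDerivAt (phi B R i m k) (phiDeriv B R i m k r) r ∧
      HasDerivAt (phiDeriv B R i m k) ((radialPotential B i m r - k) * phi B R i m k r) r := by
  rcases lt_or_gt_of_ne hr.2 with h | h
  · have hev : ∀ᶠ t in 𝓝 r, t ≤ R := by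
      filter_upwards [Iio_mem_nhds h] with t ht using le_of_lt ht
    rw [phiDeriv, if_pos h.le, phi, if_pos h.le]
    constructor
    · refine ((hasDerivAt_solF hB i m k hr.1).const_mul _).congr_of_eventuallyEq ?_
      filter_upwards [hev] with t ht
      rw [phi, if_pos ht]
    · refine (((hasDerivAt_deriv_solF hB i m k hr.1).const_mul
        (normConst B R i m k * solG B i m k R)).congr_of_eventuallyEq ?_).congr_deriv (by ring)
      filter_upwards [hev] with t ht
      rw [phiDeriv, if_pos ht]
  · have hev : ∀ᶠ t in 𝓝 r, ¬ t ≤ R := by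
      filter_upwards [Ioi_mem_nhds h] with t ht using not_le.2 ht
    rw [phiDeriv, if_neg (not_le.2 h), phi, if_neg (not_le.2 h)]
    constructor
    · refine ((hasDerivAt_solG hB i m k hr.1).const_mul _).congr_of_eventuallyEq ?_
      filter_upwards [hev] with t ht
      rw [phi, if_neg ht]
    · refine (((hasDerivAt_deriv_solG hB i m k hr.1).const_mul
        (normConst B R i m k * solF B i m k R)).congr_of_eventuallyEq ?_).congr_deriv (by ring)
      filter_upwards [hev] with t ht
      rw [phiDeriv, if_neg ht]

theorem tendsto_phi_left (i : Fin 2) (m : ℤ) (k : ℂ) :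
    Tendsto (phi B R i m k) (𝓝[<] R)
      (𝓝 (normConst B R i m k * solG B i m k R * solF B i m k R)) := by
  refine (((continuous_solF B i m k).tendsto R).mono_left nhdsWithin_le_nhds |>.const_mul
    (normConst B R i m k * solG B i m k R)).congr' ?_
  filter_upwards [self_mem_nhdsWithin] with r hr
  rw [phi, if_pos (le_of_lt hr)]

theorem tendsto_phi_right (hB : 0 < B) (hR : 0 < R) (i : Fin 2) (m : ℤ) (k : ℂ) :
    Tendsto (phi B R i m k) (𝓝[>] R)
      (𝓝 (normConst B R i m k * solG B i m k R * solF B i m k R)) := by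
  have h0 : Tendsto (solG B i m k) (𝓝[>] R) (𝓝 (solG B i m k R)) :=
    ((continuousOn_solG hB i m k).continuousAt (Ioi_mem_nhds hR)).tendsto.mono_left
      nhdsWithin_le_nhds
  have h := h0.const_mul (normConst B R i m k * solF B i m k R)
  rw [mul_right_comm]
  refine h.congr' ?_
  filter_upwards [self_mem_nhdsWithin] with r hr
  rw [phi, if_neg (not_le.2 (mem_Ioi.1 hr))]

theorem tendsto_phiDeriv_left (hB : 0 < B) (hR : 0 < R) (i : Fin 2) (m : ℤ) (k : ℂ) :
    Tendsto (phiDeriv B R i m k) (𝓝[<] R)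
      (𝓝 (normConst B R i m k * solG B i m k R * deriv (solF B i m k) R)) := by
  refine ((((continuousOn_deriv_solF hB i m k).continuousAt
    (Ioi_mem_nhds hR)).tendsto.mono_left nhdsWithin_le_nhds).const_mul
    (normConst B R i m k * solG B i m k R)).congr' ?_
  filter_upwards [self_mem_nhdsWithin] with r hr
  rw [phiDeriv, if_pos (le_of_lt hr)]

theorem tendsto_phiDeriv_right (hB : 0 < B) (hR : 0 < R) (i : Fin 2) (m : ℤ) (k : ℂ) :
    Tendsto (phiDeriv B R i m k) (𝓝[>] R)
      (𝓝 (normConst B R i m k * solF B i m k R * deriv (solG B i m k) R)) := by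
  refine ((((continuousOn_deriv_solG hB i m k).continuousAt
    (Ioi_mem_nhds hR)).tendsto.mono_left nhdsWithin_le_nhds).const_mul
    (normConst B R i m k * solF B i m k R)).congr' ?_
  filter_upwards [self_mem_nhdsWithin] with r hr
  rw [phiDeriv, if_neg (not_le.2 (mem_Ioi.1 hr))]

theorem originCondition_phi (hB : 0 < B) (hR : 0 < R) (i : Fin 2) (m : ℤ) (k : ℂ) :
    OriginCondition m (phi B R i m k) := by
  refine ((originCondition_solF hB i m k).const_mul
    (normConst B R i m k * solG B i m k R)).congr ?_
  filter_upwards [Ioo_mem_nhdsGT hR] with r hr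
  rw [phi, if_pos hr.2.le]

/-- `φ` is continuous at `R`, and its jump condition with strength `α` is `N` times the vanishing of
the denominator; a zero would make `φ` an eigenfunction. -/
theorem kreinDenom_ne_zero (hB : 0 < B) (hR : 0 < R) {i : Fin 2} {m : ℤ} {k : ℂ} {α : ℝ}
    {s : HalfLineL2 →L[ℂ] HalfLineL2} (h : IsChannelResolvent (channelGraph B R i m α) k s)
    (hW : wronskianGF B R i m k ≠ 0) : kreinDenom B R i m α k ≠ 0 := by
  intro hD
  have hN : normConst B R i m k ≠ 0 := inv_ne_zero hW
  -- If `G(R) = 0` the denominator is minus the Wronskian and cannot vanish. Here `G(R) ≠ 0` ensures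
  -- that `φ` is a nonzero multiple of `F` near the origin.
  have hG : solG B i m k R ≠ 0 := by
    intro hG
    apply hW
    rw [kreinDenom, hG] at hD
    rw [wronskianGF, hG]
    linear_combination -hD
  rw [kreinDenom] at hD
  refine toHalfLineL2_ne_zero (memLp_phi hB hR i m k) ?_ (h.eq_zero
    (mem_channelGraph_of_solution (fun r hr => (hasDerivAt_phi hB i m k hr).1)
      (fun r hr => (hasDerivAt_phi hB i m k hr).2)
      ⟨_, _, _, tendsto_phi_left i m k, tendsto_phi_right hB hR i m k,
        tendsto_phiDeriv_left hB hR i m k, tendsto_phiDeriv_right hB hR i m k, ?_⟩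
      (originCondition_phi hB hR i m k) (memLp_phi hB hR i m k)))
  · filter_upwards [eventually_solF_ne_zero B i m k, Ioo_mem_nhdsGT hR] with r h1 h2
    rw [phi, if_pos h2.2.le]
    exact mul_ne_zero (mul_ne_zero hN hG) h1
  · linear_combination (normConst B R i m k) * hD

/-- The right-hand side solves `(h - k) u = f` away from `R`; the coefficient of `φ` is the one for
which the jump at `R` is correct, and the resolvent is determined by its graph. -/
theorem krein_channel (hB : 0 < B) (hR : 0 < R) {i : Fin 2} {m : ℤ} {k : ℂ} {α : ℝ}
    {s₀ s : HalfLineL2 →L[ℂ] HalfLineL2} (h₀ : IsChannelResolvent (channelGraph B R i m 0) k s₀)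
    (h : IsChannelResolvent (channelGraph B R i m α) k s) (f : HalfLineL2) :
    s f = s₀ f + (α / (normConst B R i m k * kreinDenom B R i m α k) *
      inner ℂ (toHalfLineL2 (phi B R i m (conj k))) f) • toHalfLineL2 (phi B R i m k) := by
  have hW := wronskianGF_ne_zero hB hR h₀
  have hN : normConst B R i m k ≠ 0 := inv_ne_zero hW
  have hD := kreinDenom_ne_zero hB hR h hW
  have hc : inner ℂ (toHalfLineL2 (phi B R i m (conj k))) f = greenOp B R i m k f R := by
    rw [inner_toHalfLineL2_left (memLp_phi hB hR i m (conj k)), greenOp]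
    simp only [phi_conj, Complex.conj_conj, channelGreen_self]
  rw [hc]
  have hcont := continuousOn_greenOp hB hR i m hW (Lp.memLp f)
  obtain ⟨u, u₁, u₂, hu, ⟨c, d₁, d₂, hc₁, hc₂, hd₁, hd₂, hd⟩, ho, hp1, hp2⟩ := h₀.mem f
  simp only at hp1 hp2
  -- The representative `u` and the Green operator agree almost everywhere and are continuous off
  -- `R`, hence agree there; continuity of the Green operator at `R` gives the trace.
  have hcR : c = greenOp B R i m k f R := by
    have heq : EqOn u (greenOp B R i m k f) (Ioi 0 \ {R}) := by
      refine Measure.eqOn_open_of_ae_eq (μ := volume) ?_ isOpen_punctured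
        (continuousOn_of_hasDerivAt hu.hasDerivAt) (hcont.mono sdiff_subset)
      exact ae_restrict_of_ae_restrict_of_subset sdiff_subset
        (hp1.symm.trans (h₀.ae_eq_greenOp hB hR f))
    refine tendsto_nhds_unique hc₁ (((hcont.continuousAt (Ioi_mem_nhds hR)).tendsto.mono_left
      nhdsWithin_le_nhds).congr' ?_)
    filter_upwards [punctured_mem_nhdsLT hR] with r hr using (heq hr).symm
  rw [← hcR]
  obtain ⟨a, ha⟩ : ∃ a : ℂ, a = α / (normConst B R i m k * kreinDenom B R i m α k) * c := ⟨_, rfl⟩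
  have ha' : a * (normConst B R i m k * kreinDenom B R i m α k) = α * c := by
    rw [ha]
    field_simp
  rw [← ha]
  have hφ : IsH2Loc (Ioi 0 \ {R}) (phi B R i m k) (phiDeriv B R i m k) _ :=
    isH2Loc_of_hasDerivAt sdiff_subset (fun r hr => (hasDerivAt_phi hB i m k hr).1)
      (fun r hr => (hasDerivAt_phi hB i m k hr).2)
  have hφL := memLp_phi hB hR i m k
  have hae : (s₀ f + a • toHalfLineL2 (phi B R i m k) : HalfLineL2) =ᵐ[μ₊]
      u + a • phi B R i m k := by
    filter_upwards [Lp.coeFn_add (s₀ f) (a • toHalfLineL2 (phi B R i m k)),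
      Lp.coeFn_smul a (toHalfLineL2 (phi B R i m k)), coeFn_toHalfLineL2 hφL, hp1]
      with r h1 h2 h3 h4
    simp only [h1, Pi.add_apply, h2, Pi.smul_apply, h3, h4]
  refine h.apply_eq ⟨_, _, _, hu.add (hφ.smul a), ?_, ?_, hae, ?_⟩
  · refine ⟨_, _, _, hc₁.add ((tendsto_phi_left i m k).const_smul a),
      hc₂.add ((tendsto_phi_right hB hR i m k).const_smul a),
      hd₁.add ((tendsto_phiDeriv_left hB hR i m k).const_smul a),
      hd₂.add ((tendsto_phiDeriv_right hB hR i m k).const_smul a), ?_⟩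
    rw [kreinDenom] at ha'
    rw [Complex.ofReal_zero, zero_mul] at hd
    simp only [smul_eq_mul]
    -- The free part has no jump, so the condition is `a N (G'F - GF')(R) = α (c + a N G F(R))`,
    -- which is `ha'`.
    linear_combination hd + ha'
  · exact ho.add ((originCondition_phi hB hR i m k).const_mul a)
  · filter_upwards [Lp.coeFn_add f (k • (s₀ f + a • toHalfLineL2 (phi B R i m k))),
      Lp.coeFn_smul k (s₀ f + a • toHalfLineL2 (phi B R i m k)), hae, hp1, hp2,
      Lp.coeFn_add f (k • s₀ f), Lp.coeFn_smul k (s₀ f)] with r h1 h2 h3 h4 h5 h6 h7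
    simp only [h6, Pi.add_apply, h7, Pi.smul_apply, h4, smul_eq_mul] at h5
    simp only [h1, Pi.add_apply, h2, Pi.smul_apply, h3, smul_eq_mul]
    linear_combination h5

/-! ### From the radial operators to the channels -/

theorem isResolventAt_iff {E : Type*} [NormedAddCommGroup E] [NormedSpace ℂ E] {T : E →ₗ.[ℂ] E}
    {k : ℂ} {S : E →L[ℂ] E} :
    IsResolventAt T k S ↔
      (∀ g, (S g, g + k • S g) ∈ T.graph) ∧ ∀ p ∈ T.graph, S (p.2 - k • p.1) = p.1 := by
  constructor
  · rintro ⟨h1, h2⟩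
    refine ⟨fun g => ?_, fun p hp => ?_⟩
    · obtain ⟨f, hf, hg⟩ := h1 g
      refine (LinearPMap.mem_graph_iff _).2 ⟨f, hf, ?_⟩
      simp only [← hf]
      rw [← hg]
      abel
    · obtain ⟨f, hf, hg⟩ := (LinearPMap.mem_graph_iff _).1 hp
      rw [← hf, ← hg]
      exact h2 f
  · rintro ⟨h1, h2⟩
    refine ⟨fun g => ?_, fun f => h2 _ (T.mem_graph f)⟩
    obtain ⟨f, hf, hg⟩ := (LinearPMap.mem_graph_iff _).1 (h1 g)
    refine ⟨f, hf, ?_⟩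
    rw [hg, hf]
    simp

/-- The `i`-th diagonal entry of an operator on `L²((0,∞)) ⊗ ℂ²`. -/
def channelPart (S : RadialSpace →L[ℂ] RadialSpace) (i : Fin 2) : HalfLineL2 →L[ℂ] HalfLineL2 :=
  PiLp.proj 2 (fun _ : Fin 2 => HalfLineL2) i ∘L S ∘L
    (((PiLp.continuousLinearEquiv 2 ℂ (fun _ : Fin 2 => HalfLineL2)).symm : _ →L[ℂ] RadialSpace) ∘L
      ContinuousLinearMap.single ℂ (fun _ : Fin 2 => HalfLineL2) i)

theorem channelPart_apply (S : RadialSpace →L[ℂ] RadialSpace) (i : Fin 2) (f : HalfLineL2) :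
    channelPart S i f = S (PiLp.single 2 i f) i := rfl

theorem single_mem_radialGraph {M : Fin 2 → ℤ} {g : Fin 2 → ℝ} {i : Fin 2}
    {p : HalfLineL2 × HalfLineL2} (hp : p ∈ channelGraph B R i (M i) (g i)) :
    ((PiLp.single 2 i p.1, PiLp.single 2 i p.2) : RadialSpace × RadialSpace) ∈
      radialGraph B R M g := by
  intro j
  by_cases hj : j = i
  · subst hj
    simpa using hp
  · simp only [PiLp.single_apply, hj, if_false]
    exact (channelGraph B R j (M j) (g j)).zero_mem

theorem isChannelResolvent_channelPart {M : Fin 2 → ℤ} {g : Fin 2 → ℝ} {k : ℂ}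
    {S : RadialSpace →L[ℂ] RadialSpace} (h : IsResolventAt (radialHamiltonian B R M g) k S)
    (i : Fin 2) : IsChannelResolvent (channelGraph B R i (M i) (g i)) k (channelPart S i) := by
  rw [isResolventAt_iff, graph_radialHamiltonian] at h
  constructor
  · intro f
    simpa [channelPart_apply] using h.1 (PiLp.single 2 i f) i
  · intro p hp
    have h1 := h.2 _ (single_mem_radialGraph hp)
    rw [channelPart_apply]
    have h2 : (PiLp.single 2 i (p.2 - k • p.1) : RadialSpace) =
        PiLp.single 2 i p.2 - k • PiLp.single 2 i p.1 := by
      ext1 j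
      by_cases hj : j = i
      · subst hj
        simp
      · simp [hj]
    rw [h2, h1]
    simp

/-- The resolvent is diagonal: the `i`-th component of `(S f, f + k S f)` lies in the channel graph,
and in a channel the solution is unique. -/
theorem apply_eq_channelPart {M : Fin 2 → ℤ} {g : Fin 2 → ℝ} {k : ℂ}
    {S : RadialSpace →L[ℂ] RadialSpace} (h : IsResolventAt (radialHamiltonian B R M g) k S)
    (f : RadialSpace) (i : Fin 2) : S f i = channelPart S i (f i) := by
  refine ((isChannelResolvent_channelPart h i).apply_eq ?_).symm
  rw [isResolventAt_iff, graph_radialHamiltonian] at h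
  exact h.1 f i

end ChannelResolvents

/-! ### Assembling spin components and partial waves. -/

section DirectSums

variable {B R : ℝ}

/-! ### The Krein formula and the free resolvent -/

theorem kreinCorrection_apply (M : Fin 2 → ℤ) (g : Fin 2 → ℝ) (k : ℂ) (f : RadialSpace)
    (i : Fin 2) :
    kreinCorrection B R M g k f i =
      ((g i : ℂ) / (normConst B R i (M i) k * kreinDenom B R i (M i) (g i) k) *
        inner ℂ (toHalfLineL2 (phi B R i (M i) (conj k))) (f i)) •
          toHalfLineL2 (phi B R i (M i) k) := by
  fin_cases i <;>
    simp [kreinCorrection, Fin.sum_univ_two, kreinCoeff, psi, inner_single_left, smul_smul]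

theorem krein_radial (hB : 0 < B) (hR : 0 < R) {M : Fin 2 → ℤ} {g : Fin 2 → ℝ} {k : ℂ}
    (hk : k ∈ opResolventSet (radialHamiltonian B R M g))
    (hk₀ : k ∈ opResolventSet (radialHamiltonian B R M 0)) :
    opResolvent (radialHamiltonian B R M g) k =
      opResolvent (radialHamiltonian B R M 0) k + kreinCorrection B R M g k := by
  have h := isResolventAt_opResolvent hk
  have h₀ := isResolventAt_opResolvent hk₀
  ext1 f
  ext1 i
  rw [add_apply, PiLp.add_apply, apply_eq_channelPart h,
    apply_eq_channelPart h₀, kreinCorrection_apply]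
  exact krein_channel hB hR (isChannelResolvent_channelPart h₀ i)
    (isChannelResolvent_channelPart h i) (f i)

theorem freeGreen_resolvent (hB : 0 < B) (hR : 0 < R) {M : Fin 2 → ℤ} {k : ℂ}
    (hk₀ : k ∈ opResolventSet (radialHamiltonian B R M 0)) (f : RadialSpace) :
    ∀ᵐ r ∂μ₊, ∀ i : Fin 2,
      (∀ j : Fin 2, IntegrableOn (fun r' => freeGreen B R M k r r' i j * f j r') (Ioi 0)) ∧
      (opResolvent (radialHamiltonian B R M 0) k f) i r =
        ∑ j, ∫ r' in Ioi (0 : ℝ), freeGreen B R M k r r' i j * f j r' := by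
  have h₀ := isResolventAt_opResolvent hk₀
  refine ae_all_iff.2 fun i => ?_
  have hae := (isChannelResolvent_channelPart h₀ i).ae_eq_greenOp hB hR (f i)
  rw [← apply_eq_channelPart h₀] at hae
  filter_upwards [hae, ae_restrict_mem measurableSet_Ioi] with r hr hr0
  have hint := integrable_channelGreen_mul hB R i (M i) k hr0 (Lp.memLp (f i))
  rw [hr]
  fin_cases i
  · refine ⟨fun j => ?_, ?_⟩
    · fin_cases j
      · simpa [freeGreen, IntegrableOn] using hint
      · simp [freeGreen]
    · simp [freeGreen, greenOp, Fin.sum_univ_two]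
  · refine ⟨fun j => ?_, ?_⟩
    · fin_cases j
      · simp [freeGreen]
      · simpa [freeGreen, IntegrableOn] using hint
    · simp [freeGreen, greenOp, Fin.sum_univ_two]

/-! ### Partial waves -/

theorem integral_exp_int_mul {n : ℤ} (hn : n ≠ 0) :
    ∫ θ in Ioo (-Real.pi) Real.pi, Complex.exp (n * Complex.I * θ) = 0 := by
  have hc : (n * Complex.I : ℂ) ≠ 0 := mul_ne_zero (by exact_mod_cast hn) Complex.I_ne_zero
  rw [← integral_Ioc_eq_integral_Ioo, ← intervalIntegral.integral_of_le (by linarith [Real.pi_pos]),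
    integral_exp_mul_complex hc, div_eq_zero_iff, sub_eq_zero]
  left
  rw [Complex.exp_eq_exp_iff_exists_int]
  -- The exponents at the two endpoints differ by `2πi n`.
  refine ⟨n, ?_⟩
  push_cast
  ring

/-- In polar coordinates the Jacobian `r` cancels the two factors `r^{-1/2}`, and the integral
splits into a radial one times `∫ e^{i(n-m)θ} dθ = 0`. -/
theorem inner_partialWave_of_ne {m n : ℤ} (hmn : m ≠ n) (f g : HalfLineL2) :
    inner ℂ (partialWave m f) (partialWave n g) = (0 : ℂ) := by
  have hpw : ∀ᵐ x : ℝ × ℝ, inner ℂ (partialWave m f x) (partialWave n g x) =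
      conj (partialWaveFun m f x) * partialWaveFun n g x := by
    filter_upwards [(memLp_partialWaveFun m f).coeFn_toLp,
      (memLp_partialWaveFun n g).coeFn_toLp] with x h₁ h₂
    change inner ℂ ((memLp_partialWaveFun m f).toLp _ x) ((memLp_partialWaveFun n g).toLp _ x) = _
    rw [h₁, h₂, RCLike.inner_apply']
  rw [L2.inner_def, integral_congr_ae hpw, ← integral_comp_polarCoord_symm]
  have hprod : (volume : Measure (ℝ × ℝ)).restrict polarCoord.target =
      μ₊.prod (volume.restrict (Ioo (-Real.pi) Real.pi)) := by
    rw [Measure.prod_restrict]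
    rfl
  rw [setIntegral_congr_fun (g := fun p : ℝ × ℝ => (conj (f p.1) * g p.1 / (2 * Real.pi)) *
    Complex.exp ((n - m : ℤ) * Complex.I * p.2)) polarCoord.open_target.measurableSet
    fun p hp => ?_, hprod]
  · rw [integral_prod_mul (fun r : ℝ => (conj (f r) * g r / (2 * Real.pi) : ℂ))
      (fun θ : ℝ => Complex.exp ((n - m : ℤ) * Complex.I * θ)),
      integral_exp_int_mul (sub_ne_zero.2 hmn.symm), mul_zero]
  · have hp0 : 0 < p.1 := hp.1
    have h1 : (p.1 : ℂ) * ((p.1 ^ (-(1 / 2) : ℝ) : ℝ) * (p.1 ^ (-(1 / 2) : ℝ) : ℝ) : ℂ) = 1 := by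
      rw [← Complex.ofReal_mul, ← Complex.ofReal_mul, ← Real.rpow_add hp0]
      norm_num
      rw [Real.rpow_neg_one, Complex.ofReal_inv, mul_inv_cancel₀]
      exact_mod_cast hp0.ne'
    have h2 : ((√(2 * Real.pi) : ℝ) : ℂ) * (√(2 * Real.pi) : ℝ) = 2 * Real.pi := by
      rw [← Complex.ofReal_mul, Real.mul_self_sqrt (by positivity)]
      push_cast
      ring
    have h3 : Complex.exp ((n - m : ℤ) * Complex.I * p.2) =
        Complex.exp (-(m * p.2 * Complex.I)) * Complex.exp (n * p.2 * Complex.I) := by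
      rw [← Complex.exp_add]
      push_cast
      ring_nf
    simp only [partialWaveFun, polarCoord.right_inv hp, map_mul, map_div₀, Complex.conj_ofReal,
      ← Complex.exp_conj, map_intCast, Complex.conj_I, mul_neg, Complex.real_smul, h3, ← h2]
    linear_combination (conj (f p.1) * g p.1 / (√(2 * Real.pi) * √(2 * Real.pi)) *
      (Complex.exp (-(m * p.2 * Complex.I)) * Complex.exp (n * p.2 * Complex.I))) * h1

/-- The projection to the `m`-th partial wave. -/
def partialWaveAdj (m : ℤ) : PlaneL2 →L[ℂ] HalfLineL2 :=
  (partialWave m).toContinuousLinearMap.adjoint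

theorem partialWaveAdj_self (m : ℤ) (f : HalfLineL2) : partialWaveAdj m (partialWave m f) = f := by
  refine ext_inner_left ℂ fun g => ?_
  rw [partialWaveAdj, ContinuousLinearMap.adjoint_inner_right]
  exact (partialWave m).inner_map_map g f

theorem partialWaveAdj_of_ne {m n : ℤ} (hmn : m ≠ n) (f : HalfLineL2) :
    partialWaveAdj m (partialWave n f) = 0 := by
  refine ext_inner_left ℂ fun g => ?_
  rw [partialWaveAdj, ContinuousLinearMap.adjoint_inner_right, inner_zero_right]
  exact inner_partialWave_of_ne hmn g f

theorem sector_adjoint_apply (M : Fin 2 → ℤ) (ψ : SpinorSpace) (i : Fin 2) :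
    (sector M).adjoint ψ i = partialWaveAdj (M i) (ψ i) := by
  refine ext_inner_left ℂ fun g => ?_
  rw [partialWaveAdj, ContinuousLinearMap.adjoint_inner_right, ← inner_single_left,
    ContinuousLinearMap.adjoint_inner_right, PiLp.inner_apply, Finset.sum_eq_single i]
  · rw [sector_apply, PiLp.single_apply, if_pos rfl]
    rfl
  · intro j _ hj
    rw [sector_apply, PiLp.single_apply, if_neg hj, map_zero, inner_zero_left]
  · simp

theorem sector_adjoint_sector (M : Fin 2 → ℤ) (f : RadialSpace) :
    (sector M).adjoint (sector M f) = f := by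
  ext1 i
  rw [sector_adjoint_apply, sector_apply, partialWaveAdj_self]

/-- Sectors `(m, m')` and `(n, n')` overlap when only one of the two indices agrees, so the check is
made component by component: an equal index returns the given channel pair, a different one returns
zero. -/
theorem sector_mem_fullGraph {α β : ℤ → ℝ} {m m' : ℤ} {p : RadialSpace × RadialSpace}
    (hp : p ∈ radialGraph B R ![m, m'] ![α m, β m']) :
    (sector ![m, m'] p.1, sector ![m, m'] p.2) ∈ fullGraph B R α β := by
  intro n n' i
  simp only [sector_adjoint_apply, sector_apply]
  have h := hp i
  by_cases hi : (![n, n'] : Fin 2 → ℤ) i = (![m, m'] : Fin 2 → ℤ) i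
  · rw [hi, partialWaveAdj_self, partialWaveAdj_self]
    fin_cases i
    · have hi : n = m := hi
      subst hi
      exact h
    · have hi : n' = m' := hi
      subst hi
      exact h
  · rw [partialWaveAdj_of_ne hi, partialWaveAdj_of_ne hi]
    exact Submodule.zero_mem _

/-- Compressing the resolvent by the isometric embedding works because the full graph both restricts
to the sector graph and contains its image. -/
theorem isResolventAt_sector {α β : ℤ → ℝ} {k : ℂ} {S : SpinorSpace →L[ℂ] SpinorSpace}
    (h : IsResolventAt (fullHamiltonian B R α β) k S) (m m' : ℤ) :
    IsResolventAt (radialHamiltonian B R ![m, m'] ![α m, β m']) k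
      ((sector ![m, m']).adjoint ∘L S ∘L sector ![m, m']) := by
  rw [isResolventAt_iff, graph_fullHamiltonian] at h
  rw [isResolventAt_iff, graph_radialHamiltonian]
  constructor
  · intro g
    have h1 := h.1 (sector ![m, m'] g) m m'
    simpa only [map_add, map_smul, sector_adjoint_sector, ContinuousLinearMap.comp_apply] using h1
  · intro p hp
    have h1 := h.2 _ (sector_mem_fullGraph hp)
    simp only [ContinuousLinearMap.comp_apply, map_sub, map_smul] at h1 ⊢
    rw [← map_smul, ← map_sub, h1, sector_adjoint_sector]

/-- Embedding the pair `(S g, g + k S g)` of the sector into the full graph and applying the full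
resolvent gives the intertwining relation. -/
theorem isDirectSum_opResolvent {α β : ℤ → ℝ} {k : ℂ}
    (hk : k ∈ opResolventSet (fullHamiltonian B R α β)) :
    IsDirectSum (opResolvent (fullHamiltonian B R α β) k)
      (fun m m' => opResolvent (radialHamiltonian B R ![m, m'] ![α m, β m']) k) := by
  intro m m'
  have h := isResolventAt_opResolvent hk
  have h1 := isResolventAt_sector h m m'
  simp only [← h1.eq_opResolvent]
  rw [isResolventAt_iff, graph_radialHamiltonian] at h1
  rw [isResolventAt_iff, graph_fullHamiltonian] at h
  ext1 g
  have h2 := h.2 _ (sector_mem_fullGraph (h1.1 g))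
  simpa only [map_add, map_smul, add_sub_cancel_right, ContinuousLinearMap.comp_apply] using h2

theorem mem_opResolventSet_radial {α β : ℤ → ℝ} {k : ℂ}
    (hk : k ∈ opResolventSet (fullHamiltonian B R α β)) (m m' : ℤ) :
    k ∈ opResolventSet (radialHamiltonian B R ![m, m'] ![α m, β m']) :=
  ⟨_, isResolventAt_sector (isResolventAt_opResolvent hk) m m'⟩

end DirectSums

end DeltaCylinder

end

theorem mainTheorem1 (B R : ℝ) (hB : 0 < B) (hR : 0 < R) (α β : ℤ → ℝ) :
    -- (i) the radial operators `H^{G_{m,m'}}_{B,m,m'}`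
    (∀ m m' : ℤ,
      IsSelfAdjoint (radialHamiltonian B R ![m, m'] ![α m, β m']) ∧
      -- the Krein formula
      (∀ k ∈ opResolventSet (radialHamiltonian B R ![m, m'] ![α m, β m']) ∩
          opResolventSet (radialHamiltonian B R ![m, m'] 0),
        (∀ i : Fin 2,
          kreinDenom B R i (![m, m'] i) (![α m, β m'] i) k ≠ 0 ∧
          MemLp (phi B R i (![m, m'] i) k) 2 (volume.restrict (Ioi (0 : ℝ))) ∧
          MemLp (phi B R i (![m, m'] i) (conj k)) 2 (volume.restrict (Ioi (0 : ℝ)))) ∧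
        opResolvent (radialHamiltonian B R ![m, m'] ![α m, β m']) k =
          opResolvent (radialHamiltonian B R ![m, m'] 0) k +
            kreinCorrection B R ![m, m'] ![α m, β m'] k) ∧
      -- the free Green function
      (∀ k ∈ opResolventSet (radialHamiltonian B R ![m, m'] 0),
        (∀ i : Fin 2, wronskianGF B R i (![m, m'] i) k ≠ 0) ∧
        (∀ f : RadialSpace, ∀ᵐ r ∂volume.restrict (Ioi (0 : ℝ)), ∀ i : Fin 2,
          (∀ j : Fin 2,
            IntegrableOn (fun r' => freeGreen B R ![m, m'] k r r' i j * f j r') (Ioi 0)) ∧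
          (opResolvent (radialHamiltonian B R ![m, m'] 0) k f) i r =
            ∑ j, ∫ r' in Ioi (0 : ℝ), freeGreen B R ![m, m'] k r r' i j * f j r') ∧
        (∀ (i : Fin 2) (r : ℝ),
          freeGreen B R ![m, m'] k R r i i = phi B R i (![m, m'] i) k r))) ∧
    -- (ii) the operator `H^G_B` on `L²(ℝ²) ⊗ ℂ²`
    (∀ k ∈ opResolventSet (fullHamiltonian B R α β) ∩ opResolventSet (fullHamiltonian B R 0 0),
      (∀ m m' : ℤ, k ∈ opResolventSet (radialHamiltonian B R ![m, m'] ![α m, β m']) ∩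
        opResolventSet (radialHamiltonian B R ![m, m'] 0)) ∧
      IsDirectSum (opResolvent (fullHamiltonian B R α β) k)
        (fun m m' => opResolvent (radialHamiltonian B R ![m, m'] ![α m, β m']) k) ∧
      ∃ D : SpinorSpace →L[ℂ] SpinorSpace,
        IsDirectSum D (fun m m' => kreinCorrection B R ![m, m'] ![α m, β m'] k) ∧
        opResolvent (fullHamiltonian B R α β) k = opResolvent (fullHamiltonian B R 0 0) k + D) := by
  -- The sectors of the free operator on the plane carry this vector of strengths, while the radial
  -- statements use the zero function.
  have h00 : ∀ m m' : ℤ, ![(0 : ℤ → ℝ) m, (0 : ℤ → ℝ) m'] = 0 := fun m m' => by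
    ext i
    fin_cases i <;> rfl
  refine ⟨fun m m' => ⟨isSelfAdjoint_radialHamiltonian hB hR _ _, fun k hk => ⟨fun i => ?_,
    krein_radial hB hR hk.1 hk.2⟩, fun k hk => ⟨fun i => ?_, fun f =>
      freeGreen_resolvent hB hR hk f, fun i r => ?_⟩⟩, fun k hk => ?_⟩
  · have hW := wronskianGF_ne_zero hB hR
      (isChannelResolvent_channelPart (isResolventAt_opResolvent hk.2) i)
    exact ⟨kreinDenom_ne_zero hB hR
      (isChannelResolvent_channelPart (isResolventAt_opResolvent hk.1) i) hW,
      memLp_phi hB hR i _ k, memLp_phi hB hR i _ (conj k)⟩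
  · exact wronskianGF_ne_zero hB hR
      (isChannelResolvent_channelPart (isResolventAt_opResolvent hk) i)
  · fin_cases i <;> rfl
  · have h₀ : ∀ m m' : ℤ, k ∈ opResolventSet (radialHamiltonian B R ![m, m'] 0) := fun m m' => by
      have h := mem_opResolventSet_radial hk.2 m m'
      rwa [h00] at h
    -- The witness for the direct sum of corrections is the difference of the two resolvents, which
    -- is bounded by construction; the Krein formula in each sector identifies its parts.
    refine ⟨fun m m' => ⟨mem_opResolventSet_radial hk.1 m m', h₀ m m'⟩,
      isDirectSum_opResolvent hk.1, opResolvent (fullHamiltonian B R α β) k -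
        opResolvent (fullHamiltonian B R 0 0) k, fun m m' => ?_, by abel⟩
    have h1 := isDirectSum_opResolvent hk.1 m m'
    have h2 := isDirectSum_opResolvent hk.2 m m'
    simp only [h00] at h2
    simp only [krein_radial hB hR (mem_opResolventSet_radial hk.1 m m') (h₀ m m'),
      ContinuousLinearMap.comp_add] at h1
    rw [ContinuousLinearMap.sub_comp, h1, h2, add_sub_cancel_left]
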